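/- Let $T>0$, $\mathbb T^3=\mathbb R^3/\mathbb Z^3$ and $\theta\in(\tfrac12,\tfrac23]$. For $v:\mathbb T^3\to\mathbb R^3$ put $$\|v\|_{B^\theta_{3,\infty}}=\|v\|_{L^3(\mathbb T^3)}+\sup_{h\in\mathbb R^3\setminus\{0\}}\frac{\|v(\cdot+h)-v\|_{L^3(\mathbb T^3)}}{|h|^\theta},\qquad \|v\|_{H^{1/2}}=\|v\|_{L^2(\mathbb T^3)}+\Big(\iint_{\mathbb T^3\times\mathbb T^3}\frac{|v(x)-v(y)|^2}{|x-y|^{4}}\,dx\,dy\Big)^{1/2},$$ where $|x-y|$ is the flat distance on $\mathbb T^3$. Let $u\in L^\infty((0,T);B^\theta_{3,\infty}(\mathbb T^3))$ be a weak solution of the incompressible Euler equations on $\mathbb T^3\times(0,T)$; that is, $u\in L^2_{\rm loc}(\mathbb T^3\times(0,T);\mathbb R^3)$ and there is $p\in L^1_{\rm loc}(\mathbb T^3\times(0,T))$ such that $$\int_0^T\!\!\int_{\mathbb T^3}\big[\partial_t\phi\cdot u+u\otimes u:\nabla\phi+p\,\operatorname{div}\phi\big]\,dx\,dt=0\qquad\forall\,\phi\in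 C^\infty_c(\mathbb T^3\times(0,T);\mathbb R^3),$$ and, for a.e. $t\in(0,T)$, $\int_{\mathbb T^3}u(x,t)\cdot\nabla\psi(x)\,dx=0$ for all $\psi\in C^\infty(\mathbb T^3)$. Then for a.e. $t\in(0,T)$ the total helicity $$H(t)=\langle\operatorname{curl}u(t),u(t)\rangle$$ is well defined as a duality pairing between $H^{-1/2}(\mathbb T^3)$ and $H^{1/2}(\mathbb T^3)$, i.e. as the limit of the distributional pairings $\langle\operatorname{curl}u(t),\varphi\rangle$ as $\varphi\in C^\infty(\mathbb T^3;\mathbb R^3)$ tends to $u(t)$ in $H^{1/2}$, and $H\in L^1_{\rm loc}(0,T)$. If moreover the distributional derivative $H'$ of $H$ on $(0,T)$ is not zero, then the Hausdorff dimension of its support satisfies $$\dim_{\mathcal H}(\operatorname{Spt}H')\ \ge\ \frac{2\theta-1}{1-\theta},$$ where $\operatorname{Spt}H'$ is the complement in $(0,T)$ of the largest open set $A\subset(0,T)$ such that $H'(\eta)=0$ for every $\eta\in C^\infty_c(A)$. -/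

import Mathlib

open MeasureTheory Set Filter Topology
open scoped ENNReal ContDiff Distributions LineDeriv

noncomputable section

namespace EulerHelicity

/-- Vectors of `ℝ³`, with the Euclidean norm. -/
abbrev E3 : Type := EuclideanSpace ℝ (Fin 3)

/-- The flat torus `𝕋³ = ℝ³ / ℤ³`, with its normalized Lebesgue measure. -/
abbrev T3 : Type := UnitAddTorus (Fin 3)

/-- The covering map `ℝ³ → 𝕋³`. -/
def proj (y : Fin 3 → ℝ) : T3 := fun i => (y i : UnitAddCircle)

/-- The partial derivative `∂ᵢ f` of a function on the torus. -/
def pd (i : Fin 3) (f : T3 → ℝ) (x : T3) : ℝ :=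
  deriv (fun s : ℝ => f (x + proj (Pi.single i s))) 0

/-- Smoothness of a map on the torus: its periodic lift to `ℝ³` is `C^∞`. -/
def IsSmooth {F : Type*} [NormedAddCommGroup F] [NormedSpace ℝ F] (f : T3 → F) : Prop :=
  ContDiff ℝ ∞ fun y : Fin 3 → ℝ => f (proj y)

/-- `φ ∈ C^∞_c(𝕋³ × (0,T); ℝ³)`. -/
structure IsTestField (T : ℝ) (φ : ℝ → T3 → E3) : Prop where
  smooth : ContDiff ℝ ∞ fun q : ℝ × (Fin 3 → ℝ) => φ q.1 (proj q.2)
  compact : HasCompactSupport (Function.uncurry φ)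
  support : tsupport (Function.uncurry φ) ⊆ Ioo 0 T ×ˢ univ

/-- `(u, p)` is a weak solution of the incompressible Euler equations on `𝕋³ × (0,T)`. -/
structure IsWeakEulerSolution (T : ℝ) (u : ℝ → T3 → E3) (p : ℝ → T3 → ℝ) : Prop where
  velocity_L2loc : ∀ K : Set (ℝ × T3), IsCompact K → K ⊆ Ioo 0 T ×ˢ univ →
    MemLp (Function.uncurry u) 2 (volume.restrict K)
  pressure_L1loc : ∀ K : Set (ℝ × T3), IsCompact K → K ⊆ Ioo 0 T ×ˢ univ →
    MemLp (Function.uncurry p) 1 (volume.restrict K)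
  momentum : ∀ φ : ℝ → T3 → E3, IsTestField T φ →
    ∫ t in Ioo 0 T, ∫ x : T3,
      ((∑ i, deriv (fun s => φ s x i) t * u t x i)
        + (∑ i, ∑ j, u t x i * u t x j * pd j (fun y => φ t y i) x)
        + p t x * ∑ i, pd i (fun y => φ t y i) x) = 0
  divergence_free : ∀ᵐ t ∂(volume.restrict (Ioo 0 T)), ∀ ψ : T3 → ℝ, IsSmooth ψ →
    ∫ x : T3, ∑ i, u t x i * pd i ψ x = 0

/-- The norm `‖v‖_{L^p} + sup_{h ≠ 0} ‖v(· + h) - v‖_{L^p} / |h|^θ` of the Besov space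
`B^θ_{p,∞}(𝕋³)`, with value `∞` outside the space. -/
def besovNorm (θ : ℝ) (p : ℝ≥0∞) (v : T3 → E3) : ℝ≥0∞ :=
  eLpNorm v p volume +
    ⨆ (h : E3) (_ : h ≠ 0),
      eLpNorm (fun x => v (x + proj h) - v x) p volume / ENNReal.ofReal (‖h‖ ^ θ)

/-- `u ∈ L^∞((0,T); B^θ_{p,∞}(𝕋³))`. -/
structure MemLinftyBesov (T θ : ℝ) (p : ℝ≥0∞) (u : ℝ → T3 → E3) : Prop where
  measurable : AEStronglyMeasurable (Function.uncurry u) (volume.restrict (Ioo 0 T ×ˢ univ))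
  bound : ∃ C : ℝ, ∀ᵐ t ∂(volume.restrict (Ioo 0 T)), besovNorm θ p (u t) ≤ ENNReal.ofReal C

/-- The Euclidean distance from `z` to the origin in `𝕋³`. -/
def torusAbs (z : T3) : ℝ := Real.sqrt (∑ i, ‖z i‖ ^ 2)

/-- The norm of the fractional Sobolev space `H^{1/2}(𝕋³)`: the `L²` norm plus the Gagliardo
seminorm, whose kernel is `|x - y|^{-(d+1)}` with `d = 3`. -/
def sobolevHalfNorm (v : T3 → E3) : ℝ≥0∞ :=
  eLpNorm v 2 volume +
    (∫⁻ x : T3, ∫⁻ y : T3, ‖v x - v y‖ₑ ^ 2 / ENNReal.ofReal (torusAbs (x - y) ^ 4))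
      ^ (1 / 2 : ℝ)

/-- The smooth vector fields on the torus. -/
abbrev SmoothField : Type := {φ : T3 → E3 // IsSmooth φ}

/-- The distributional derivative `∂ᵢ f`, tested with `ψ`. -/
def distPartial (i : Fin 3) (f ψ : T3 → ℝ) : ℝ := -∫ x : T3, f x * pd i ψ x

/-- The distributional vorticity `curl v`, tested with the smooth field `φ`. -/
def distCurl (v : T3 → E3) (φ : SmoothField) : ℝ :=
  (distPartial 1 (v · 2) (φ.1 · 0) - distPartial 2 (v · 1) (φ.1 · 0))
    + (distPartial 2 (v · 0) (φ.1 · 1) - distPartial 0 (v · 2) (φ.1 · 1))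
    + (distPartial 0 (v · 1) (φ.1 · 2) - distPartial 1 (v · 0) (φ.1 · 2))

/-- The filter of smooth fields that converge to `v` in `H^{1/2}(𝕋³)`. -/
def smoothApprox (v : T3 → E3) : Filter SmoothField :=
  comap (fun φ => sobolevHalfNorm (φ.1 - v)) (𝓝 0)

/-- `L` is the duality pairing `⟨curl v, v⟩` between `H^{-1/2}` and `H^{1/2}`: the smooth fields
accumulate at `v` in `H^{1/2}`, and `⟨curl v, φ⟩ → L` as the smooth field `φ` tends to `v` in
`H^{1/2}`. -/
def HasHelicity (v : T3 → E3) (L : ℝ) : Prop :=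
  (smoothApprox v).NeBot ∧ Tendsto (distCurl v) (smoothApprox v) (𝓝 L)

/-- The total helicity `⟨curl v, v⟩` of a field `v`, the number `L` with `HasHelicity v L`. -/
def helicity (v : T3 → E3) : ℝ := limUnder (smoothApprox v) (distCurl v)

/-- The open interval `(0,T)`. -/
def timeInterval (T : ℝ) : TopologicalSpace.Opens ℝ := ⟨Ioo 0 T, isOpen_Ioo⟩

/-- The distribution `η ↦ ∫ η H` on `(0,T)` given by a locally integrable function `H`. -/
def regularDistribution (T : ℝ) (H : ℝ → ℝ) : 𝓓'(timeInterval T, ℝ) :=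
  ContinuousLinearMap.toUniformConvergenceCLM _ _ _
    (TestFunction.integralAgainstBilinCLM (ContinuousLinearMap.mul ℝ ℝ) volume H)

/-- The distributional derivative `H'` on `(0,T)` of the total helicity `H(t) = ⟨ω(t), u(t)⟩`. -/
def helicityDeriv (T : ℝ) (u : ℝ → T3 → E3) : 𝓓'(timeInterval T, ℝ) :=
  ∂_{(1 : ℝ)} (regularDistribution T fun t => helicity (u t))

/-- The support in `(0,T)` of a distribution on `(0,T)`. -/
def spt {T : ℝ} (F : 𝓓'(timeInterval T, ℝ)) : Set ℝ :=
  Ioo 0 T ∩ Distribution.dsupport F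

end EulerHelicity

end

open MeasureTheory Set Filter Topology
open scoped ENNReal ContDiff Distributions LineDeriv

noncomputable section

namespace EulerHelicity

section

/-! Write `u_ε = k_ε ∗ u` for a smooth even mollifier and `H_ε(t) = ∫ u_ε · curl u_ε`. Two competing
estimates drive the proof. In space, passing from scale `ε` to `ε/2` changes `∫ f_ε ∂ᵢ g_ε` by at
most a multiple of `ε^(2θ-1)`, because one factor contributes an `L²` difference of order `ε^θ` and
the other a gradient of order `ε^(θ-1)`. As `2θ > 1`, the dyadic series converges and `|H - H_ε| ≲
ε^(2θ-1)` (`MollRate.exists_tendsto`, `helicity_spec`). In time, `|H_ε(t) - H_ε(s)| ≲ ε^(3θ-2) |t -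
s|` (`IsGoodSet.abs_pairF_testF_sub_le`): smooth divergence-free fields have no helicity flux, so
only the Constantin–E–Titi commutator survives, and it is cubic in increments with two derivatives.

Taking `ε` proportional to `|t - s|^(1/(1-θ))` balances the two and makes `H` Hölder continuous with
exponent `α = (2θ-1)/(1-θ)` on a set of times of full measure (`IsGoodSet.exists_holder`); hence `H`
agrees a.e. with an `α`-Hölder function `g` on the line. Off the support of `H'` the function `g` is
locally constant, so it takes countably many values there. If the support had dimension below `α`,
its image under `g` would have dimension below `1`. Then `g((0,T))`, an interval, would have
dimension below `1`, so it would be a point and `H'` would vanish (`eq_of_dimH_lt`, `le_dimH_spt`).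

The pairing itself is obtained from the same telescoping. If `φ` is smooth and `w = φ - v` lies in
`H^{1/2}`, then `w` is mollified at rate `1/2`, and `θ + 1/2 > 1` suffices for convergence, with a
bound linear in `‖w‖_{H^{1/2}}` (`abs_distCurl_sub_le`).

The time estimate needs test fields that depend on `u(t)`, while the equation is only given weakly
in time. Separability of the smooth solenoidal fields in `C¹` yields one full-measure set of times
on which the integrated equation holds for every such field (`IsEulerFamily.exists_isGoodSet`).
Since `H_ε` is the diagonal of a symmetric bilinear form, its increment is a sum of two increments
with frozen test fields. Freezing costs an error quadratic in `|t - s|`, which subdivision removes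
(`abs_sub_le_of_quadratic`). -/

instance : IsProbabilityMeasure (volume : Measure UnitAddCircle) :=
  ⟨by simp⟩

instance : IsProbabilityMeasure (volume : Measure T3) :=
  inferInstanceAs (IsProbabilityMeasure
    (Measure.pi fun _ : Fin 3 => (volume : Measure UnitAddCircle)))

instance : (volume : Measure UnitAddCircle).IsNegInvariant :=
  Measure.IsAddHaarMeasure.isNegInvariant_of_regular volume

instance : (volume : Measure T3).IsNegInvariant := inferInstance

/-! ### The covering map -/

theorem proj_add (y z : Fin 3 → ℝ) : proj (y + z) = proj y + proj z := by
  ext i; simp [proj]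

theorem proj_sub (y z : Fin 3 → ℝ) : proj (y - z) = proj y - proj z := by
  ext i; simp [proj]

theorem proj_neg (y : Fin 3 → ℝ) : proj (-y) = -proj y := by
  ext i; simp [proj]

theorem proj_zero : proj 0 = 0 := by
  ext i; simp [proj]

/-- Lets continuity on the torus be read off from periodic lifts. -/
theorem isOpenQuotientMap_proj : IsOpenQuotientMap proj :=
  IsOpenQuotientMap.piMap (f := fun (_ : Fin 3) (s : ℝ) => (s : UnitAddCircle))
    fun _ => QuotientAddGroup.isOpenQuotientMap_mk

theorem exists_proj (x : T3) : ∃ y, proj y = x := isOpenQuotientMap_proj.surjective x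

section Smooth

variable {F : Type*} [NormedAddCommGroup F] [NormedSpace ℝ F]

theorem IsSmooth.continuous {f : T3 → F} (hf : IsSmooth f) : Continuous f :=
  isOpenQuotientMap_proj.isQuotientMap.continuous_iff.2 (ContDiff.continuous hf)

end Smooth

variable {f g : T3 → ℝ} {i j : Fin 3}

theorem IsSmooth.const (c : ℝ) : IsSmooth (fun _ : T3 => c) := contDiff_const

theorem IsSmooth.add (hf : IsSmooth f) (hg : IsSmooth g) : IsSmooth (fun x => f x + g x) :=
  ContDiff.add hf hg

theorem IsSmooth.sub (hf : IsSmooth f) (hg : IsSmooth g) : IsSmooth (fun x => f x - g x) :=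
  ContDiff.sub hf hg

theorem IsSmooth.mul (hf : IsSmooth f) (hg : IsSmooth g) : IsSmooth (fun x => f x * g x) :=
  ContDiff.mul hf hg

theorem IsSmooth.comp_sub_left (hf : IsSmooth f) (x : T3) : IsSmooth (fun y => f (x - y)) := by
  obtain ⟨z, rfl⟩ := exists_proj x
  have : (fun y => f (proj z - proj y)) = (fun y => f (proj y)) ∘ fun y => z - y := by
    ext y; simp [proj_sub]
  unfold IsSmooth at *
  rw [this]
  exact hf.comp (contDiff_const.sub contDiff_id)

theorem add_proj_single_eq (y : Fin 3 → ℝ) (i : Fin 3) (s : ℝ) :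
    proj y + proj (Pi.single i s) = proj (y + s • Pi.single i (1 : ℝ)) := by
  rw [proj_add]
  congr 2
  ext j
  by_cases h : j = i
  · subst h; simp
  · simp [h]

/-- The bridge between `pd` and calculus on `ℝ³`: smoothness of derivatives and symmetry of second
derivatives are transferred through it. -/
theorem IsSmooth.pd_proj (hf : IsSmooth f) (i : Fin 3) (y : Fin 3 → ℝ) :
    pd i f (proj y) = fderiv ℝ (fun y => f (proj y)) y (Pi.single i 1) := by
  have h1 : HasDerivAt (fun s : ℝ => y + s • (Pi.single i 1 : Fin 3 → ℝ)) (Pi.single i 1) 0 := by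
    simpa using ((hasDerivAt_id (0 : ℝ)).smul_const (Pi.single i 1 : Fin 3 → ℝ)).const_add y
  have h2 : HasFDerivAt (fun y => f (proj y)) (fderiv ℝ (fun y => f (proj y)) y)
      (y + (0 : ℝ) • (Pi.single i 1 : Fin 3 → ℝ)) := by
    simpa using (ContDiff.differentiable hf (by simp) y).hasFDerivAt
  have h3 := h2.comp_hasDerivAt (0 : ℝ) h1
  unfold pd
  simp_rw [add_proj_single_eq]
  exact h3.deriv

theorem IsSmooth.pd (hf : IsSmooth f) (i : Fin 3) : IsSmooth (pd i f) := by
  unfold IsSmooth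
  simp_rw [hf.pd_proj i]
  exact (ContDiff.fderiv_right hf (by simp)).clm_apply contDiff_const

theorem IsSmooth.hasDerivAt_zero (hf : IsSmooth f) (i : Fin 3) (x : T3) :
    HasDerivAt (fun s : ℝ => f (x + proj (Pi.single i s))) (EulerHelicity.pd i f x) 0 := by
  refine DifferentiableAt.hasDerivAt ?_
  obtain ⟨y, rfl⟩ := exists_proj x
  simp_rw [add_proj_single_eq]
  have h : DifferentiableAt ℝ (fun y => f (proj y)) (y + (0 : ℝ) • (Pi.single i 1 : Fin 3 → ℝ)) :=
    ContDiff.differentiable hf (by simp) _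
  exact h.comp (0 : ℝ) (f := fun s : ℝ => y + s • (Pi.single i 1 : Fin 3 → ℝ)) (by fun_prop)

theorem IsSmooth.hasDerivAt (hf : IsSmooth f) (i : Fin 3) (x : T3) (s : ℝ) :
    HasDerivAt (fun s : ℝ => f (x + proj (Pi.single i s)))
      (EulerHelicity.pd i f (x + proj (Pi.single i s))) s := by
  have h := hf.hasDerivAt_zero i (x + proj (Pi.single i s))
  have h' := HasDerivAt.comp_sub_const (x := s) (a := s) (f := fun r : ℝ =>
    f (x + proj (Pi.single i s) + proj (Pi.single i r))) (by simpa using h)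
  refine h'.congr_of_eventuallyEq (Eventually.of_forall fun r => ?_)
  dsimp only
  rw [add_assoc, ← proj_add, ← Pi.single_add, add_sub_cancel]

theorem IsSmooth.hasFDerivAt (hf : IsSmooth f) (y : Fin 3 → ℝ) :
    HasFDerivAt (fun y => f (proj y))
      (∑ i, EulerHelicity.pd i f (proj y) •
        (ContinuousLinearMap.proj i : (Fin 3 → ℝ) →L[ℝ] ℝ)) y := by
  refine (ContDiff.differentiable hf (by simp) y).hasFDerivAt.congr_fderiv ?_
  ext v
  have : v = ∑ i, v i • (Pi.single i 1 : Fin 3 → ℝ) := by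
    ext j; simp [Finset.sum_apply, Pi.single_apply]
  conv_lhs => rw [this]
  simp [hf.pd_proj, mul_comm, -Finset.sum_apply]

theorem pd_const (c : ℝ) (i : Fin 3) : pd i (fun _ => c) = fun _ => 0 := by
  ext x; simp [pd]

theorem pd_add (hf : IsSmooth f) (hg : IsSmooth g) (i : Fin 3) (x : T3) :
    pd i (fun x => f x + g x) x = pd i f x + pd i g x :=
  ((hf.hasDerivAt_zero i x).add (hg.hasDerivAt_zero i x)).deriv

theorem pd_sub (hf : IsSmooth f) (hg : IsSmooth g) (i : Fin 3) (x : T3) :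
    pd i (fun x => f x - g x) x = pd i f x - pd i g x :=
  ((hf.hasDerivAt_zero i x).sub (hg.hasDerivAt_zero i x)).deriv

theorem pd_neg (hf : IsSmooth f) (i : Fin 3) (x : T3) :
    pd i (fun x => -f x) x = -pd i f x :=
  (hf.hasDerivAt_zero i x).neg.deriv

theorem pd_mul (hf : IsSmooth f) (hg : IsSmooth g) (i : Fin 3) (x : T3) :
    pd i (fun x => f x * g x) x = pd i f x * g x + f x * pd i g x := by
  have := ((hf.hasDerivAt_zero i x).mul (hg.hasDerivAt_zero i x)).deriv
  simp only [Pi.single_zero, proj_zero, add_zero] at this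
  exact this

theorem pd_const_mul (hf : IsSmooth f) (c : ℝ) (i : Fin 3) (x : T3) :
    pd i (fun x => c * f x) x = c * pd i f x :=
  ((hf.hasDerivAt_zero i x).const_mul c).deriv

theorem pd_comp_sub_left (hf : IsSmooth f) (i : Fin 3) (x y : T3) :
    pd i (fun y => f (x - y)) y = -pd i f (x - y) := by
  have h := (hf.hasDerivAt i (x - y) (-0))
  have h2 := HasDerivAt.scomp (0 : ℝ) (by simpa using h) (hasDerivAt_neg (0 : ℝ))
  have h3 := h2.deriv
  simp only [smul_eq_mul, neg_mul, one_mul, proj_zero, add_zero] at h3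
  rw [← h3]
  unfold pd
  congr 1
  ext s
  simp only [Function.comp]
  rw [show (Pi.single i (-s) : Fin 3 → ℝ) = -Pi.single i s by rw [Pi.single_neg], proj_neg]
  congr 1
  abel

theorem pd_comm (hf : IsSmooth f) (i j : Fin 3) (x : T3) :
    pd i (pd j f) x = pd j (pd i f) x := by
  obtain ⟨y, rfl⟩ := exists_proj x
  rw [(hf.pd j).pd_proj, (hf.pd i).pd_proj]
  simp_rw [hf.pd_proj]
  have hd : DifferentiableAt ℝ (fderiv ℝ (fun y => f (proj y))) y :=
    (ContDiff.fderiv_right (m := 1) hf (by norm_cast)).differentiable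
      (by simp) y
  rw [fderiv_clm_apply hd (by fun_prop), fderiv_clm_apply hd (by fun_prop)]
  have hs : IsSymmSndFDerivAt ℝ (fun y => f (proj y)) y :=
    (ContDiff.contDiffAt hf).isSymmSndFDerivAt (by simp; norm_cast)
  simpa using hs.eq (Pi.single i 1) (Pi.single j 1)

end

section

variable {f g k : T3 → ℝ} {i j : Fin 3}

/-! ### Integration on the torus -/

theorem integrable_of_continuous (hf : Continuous f) : Integrable f :=
  hf.integrable_of_hasCompactSupport (HasCompactSupport.of_compactSpace f)

theorem exists_forall_abs_le (hf : Continuous f) : ∃ C, 0 ≤ C ∧ ∀ x, |f x| ≤ C := by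
  obtain ⟨C, hC⟩ := isCompact_univ.exists_bound_of_continuousOn (f := f) hf.continuousOn
  exact ⟨C, (norm_nonneg (f 0)).trans (hC 0 (mem_univ _)), fun x => hC x (mem_univ x)⟩

theorem integrable_continuous_mul (hk : Continuous k) (hf : Integrable f) :
    Integrable (fun x => k x * f x) := by
  obtain ⟨C, -, hC⟩ := exists_forall_abs_le hk
  exact hf.bdd_mul hk.aestronglyMeasurable (Eventually.of_forall hC)

theorem abs_integral_le_of_abs_le (hg : Integrable g) (h : ∀ x, |f x| ≤ g x) :
    |∫ x, f x| ≤ ∫ x, g x :=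
  norm_integral_le_of_norm_le (f := f) hg (Eventually.of_forall h)

/-- By translation invariance the integral of a translate of `f` does not depend on the shift;
differentiate under the integral sign. -/
theorem integral_pd (hf : IsSmooth f) (i : Fin 3) : ∫ x, pd i f x = 0 := by
  obtain ⟨C, -, hC⟩ := exists_forall_abs_le (hf.pd i).continuous
  have hc : ∀ s : ℝ, Continuous fun x => f (x + proj (Pi.single i s)) := fun s =>
    hf.continuous.comp (continuous_id.add continuous_const)
  have h := (hasDerivAt_integral_of_dominated_loc_of_deriv_le (μ := (volume : Measure T3))
    (F := fun (s : ℝ) x => f (x + proj (Pi.single i s)))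
    (F' := fun (s : ℝ) x => pd i f (x + proj (Pi.single i s))) (x₀ := (0 : ℝ)) (s := univ)
    (bound := fun _ => C) univ_mem
    (Eventually.of_forall fun s => (hc s).aestronglyMeasurable)
    (integrable_of_continuous (hc 0))
    (((hf.pd i).continuous.comp (continuous_id.add continuous_const)).aestronglyMeasurable)
    (Eventually.of_forall fun x s _ => hC _) (integrable_const _)
    (Eventually.of_forall fun x s _ => hf.hasDerivAt i x s)).2
  simp only [integral_add_right_eq_self] at h
  exact h.unique (hasDerivAt_const _ _)

theorem integral_mul_pd (hf : IsSmooth f) (hg : IsSmooth g) (i : Fin 3) :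
    ∫ x, f x * pd i g x = -∫ x, pd i f x * g x := by
  have h := integral_pd (hf.mul hg) i
  simp_rw [pd_mul hf hg] at h
  rw [integral_add (integrable_of_continuous ((hf.pd i).mul hg).continuous)
    (integrable_of_continuous (hf.mul (hg.pd i)).continuous)] at h
  linarith

/-! ### Convolution on the torus -/

/-- The convolution `k ∗ f` on the torus. -/
def cv (k f : T3 → ℝ) (x : T3) : ℝ := ∫ y, k (x - y) * f y

theorem cv_eq_integral_comp_sub (k f : T3 → ℝ) (x : T3) : cv k f x = ∫ z, k z * f (x - z) := by
  rw [cv, ← integral_sub_left_eq_self _ volume x]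
  simp

theorem integrable_cv_integrand (hk : Continuous k) (hf : Integrable f) (x : T3) :
    Integrable fun y => k (x - y) * f y :=
  integrable_continuous_mul (k := fun y => k (x - y))
    (hk.comp (continuous_const.sub continuous_id)) hf

theorem hasFDerivAt_cv (hk : IsSmooth k) (hf : Integrable f) (y : Fin 3 → ℝ) :
    HasFDerivAt (fun y => cv k f (proj y))
      (∑ i, cv (pd i k) f (proj y) • (ContinuousLinearMap.proj i : (Fin 3 → ℝ) →L[ℝ] ℝ)) y := by
  have hb : ∀ i, ∃ C, 0 ≤ C ∧ ∀ x, |pd i k x| ≤ C := fun i =>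
    exists_forall_abs_le (hk.pd i).continuous
  choose C hC0 hC using hb
  set L : Fin 3 → (Fin 3 → ℝ) →L[ℝ] ℝ := fun i => ContinuousLinearMap.proj i with hL
  have hd : ∀ (x : T3) (y : Fin 3 → ℝ), HasFDerivAt (fun y => k (proj y - x) * f x)
      (f x • ∑ i, pd i k (proj y - x) • L i) y := by
    intro x y
    obtain ⟨z, rfl⟩ := exists_proj x
    have h1 := (hk.hasFDerivAt (y - z)).comp y
      ((hasFDerivAt_id y).sub_const z)
    have h2 := h1.mul_const (f (proj z))
    simp only [Function.comp_def, id, proj_sub] at h2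
    exact h2.congr_fderiv (by ext v; simp [hL])
  have hi : ∀ (i) (y : Fin 3 → ℝ), Integrable fun x => (pd i k (proj y - x) * f x) • L i :=
    fun i y => (integrable_cv_integrand (hk.pd i).continuous hf (proj y)).smul_const (L i)
  have hF : ∀ (y : Fin 3 → ℝ) x, f x • ∑ i, pd i k (proj y - x) • L i
      = ∑ i, (pd i k (proj y - x) * f x) • L i := by
    intro y x
    rw [Finset.smul_sum]
    exact Finset.sum_congr rfl fun i _ => by rw [smul_smul, mul_comm]
  have hsum : AEStronglyMeasurable (fun x => f x • ∑ i, pd i k (proj y - x) • L i)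
      (volume : Measure T3) := by
    refine hf.aestronglyMeasurable.smul (Continuous.aestronglyMeasurable ?_)
    exact continuous_finsetSum _ fun i _ =>
      ((hk.pd i).continuous.comp (continuous_const.sub continuous_id)).smul continuous_const
  have hval : ∫ x, f x • ∑ i, pd i k (proj y - x) • L i = ∑ i, cv (pd i k) f (proj y) • L i := by
    rw [integral_congr_ae (Eventually.of_forall fun x => hF y x),
      integral_finsetSum _ fun i _ => hi i y]
    exact Finset.sum_congr rfl fun i _ => by rw [integral_smul_const]; rfl
  have h := hasFDerivAt_integral_of_dominated_of_fderiv_le (μ := (volume : Measure T3))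
    (F := fun (y : Fin 3 → ℝ) x => k (proj y - x) * f x)
    (F' := fun (y : Fin 3 → ℝ) x => f x • ∑ i, pd i k (proj y - x) • L i) (x₀ := y) (s := univ)
    (bound := fun x => |f x| * ∑ i, C i * ‖L i‖) univ_mem
    (Eventually.of_forall fun z =>
      (integrable_cv_integrand hk.continuous hf _).aestronglyMeasurable)
    (integrable_cv_integrand hk.continuous hf _)
    hsum
    (Eventually.of_forall fun x s _ => by
      rw [norm_smul]
      refine mul_le_mul_of_nonneg_left ((norm_sum_le _ _).trans (Finset.sum_le_sum fun i _ => ?_))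
        (norm_nonneg _)
      rw [norm_smul]
      exact mul_le_mul_of_nonneg_right (hC i _) (norm_nonneg _))
    (hf.abs.mul_const _)
    (Eventually.of_forall fun x s _ => hd x s)
  exact h.congr_fderiv hval

/-- Derivatives fall on the kernel, and each `∂ᵢ k` is again a smooth kernel, so the induction must
range over all `k`. -/
theorem IsSmooth.cv (hk : IsSmooth k) (hf : Integrable f) : IsSmooth (cv k f) := by
  refine contDiff_infty.2 fun n => ?_
  induction n generalizing k with
  | zero =>
    exact contDiff_zero.2 (continuous_iff_continuousAt.2 fun y =>
      (hasFDerivAt_cv hk hf y).continuousAt)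
  | succ n ih =>
    refine contDiff_succ_iff_hasFDerivAt.2 ⟨_, ?_, hasFDerivAt_cv hk hf⟩
    exact ContDiff.sum fun i _ => (ih (hk.pd i)).smul contDiff_const

theorem pd_cv (hk : IsSmooth k) (hf : Integrable f) (i : Fin 3) (x : T3) :
    pd i (EulerHelicity.cv k f) x = EulerHelicity.cv (pd i k) f x := by
  obtain ⟨y, rfl⟩ := exists_proj x
  rw [(hk.cv hf).pd_proj, (hasFDerivAt_cv hk hf y).fderiv]
  simp [Pi.single_apply]

theorem cv_sub (hk : Continuous k) (hf : Integrable f) (hg : Integrable g) (x : T3) :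
    cv k (fun y => f y - g y) x = cv k f x - cv k g x := by
  simp_rw [cv, mul_sub]
  exact integral_sub (integrable_cv_integrand hk hf x) (integrable_cv_integrand hk hg x)

theorem cv_pd_left (hk : IsSmooth k) (hf : IsSmooth f) (i : Fin 3) (x : T3) :
    cv (pd i k) f x = cv k (pd i f) x := by
  have h := integral_mul_pd (hk.comp_sub_left x) hf i
  simp_rw [pd_comp_sub_left hk, neg_mul, integral_neg, neg_neg] at h
  exact h.symm

theorem pd_cv_right (hk : IsSmooth k) (hf : IsSmooth f) (i : Fin 3) (x : T3) :
    pd i (cv k f) x = cv k (pd i f) x := by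
  rw [pd_cv hk (integrable_of_continuous hf.continuous), cv_pd_left hk hf]

/-- Evenness of the kernel makes convolution self-adjoint, by Fubini. This is what moves
mollification from the solution to the test field. -/
theorem integral_cv_mul (hk : Continuous k) (he : ∀ x, k (-x) = k x) (hf : Integrable f)
    (hg : Integrable g) : ∫ x, cv k f x * g x = ∫ x, f x * cv k g x := by
  have hint : Integrable (fun q : T3 × T3 => k (q.1 - q.2) * (g q.1 * f q.2))
      ((volume : Measure T3).prod volume) := by
    obtain ⟨C, -, hC⟩ := exists_forall_abs_le hk
    exact (hg.mul_prod hf).bdd_mul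
      (hk.comp (continuous_fst.sub continuous_snd)).aestronglyMeasurable
      (Eventually.of_forall fun q => hC _)
  calc ∫ x, cv k f x * g x = ∫ x, ∫ y, k (x - y) * (g x * f y) := by
        refine integral_congr_ae (Eventually.of_forall fun x => ?_)
        simp only [cv]
        rw [← integral_mul_const]
        exact integral_congr_ae (Eventually.of_forall fun y => by ring)
    _ = ∫ y, ∫ x, k (x - y) * (g x * f y) := integral_integral_swap hint
    _ = ∫ x, f x * cv k g x := by
        refine integral_congr_ae (Eventually.of_forall fun x => ?_)
        simp only [cv]
        rw [← integral_const_mul]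
        refine integral_congr_ae (Eventually.of_forall fun y => ?_)
        simp only
        rw [← he (x - y), neg_sub]
        ring

end

section

variable {f g k : T3 → ℝ} {i j : Fin 3}

/-! ### The distance to the origin -/

theorem torusAbs_nonneg (z : T3) : 0 ≤ torusAbs z := Real.sqrt_nonneg _

theorem torusAbs_sq (z : T3) : torusAbs z ^ 2 = ∑ i, ‖z i‖ ^ 2 :=
  Real.sq_sqrt (Finset.sum_nonneg fun _ _ => sq_nonneg _)

theorem torusAbs_neg (z : T3) : torusAbs (-z) = torusAbs z := by simp [torusAbs]

theorem norm_apply_le_torusAbs (z : T3) (i : Fin 3) : ‖z i‖ ≤ torusAbs z :=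
  Real.le_sqrt_of_sq_le (Finset.single_le_sum (f := fun i => ‖z i‖ ^ 2)
    (fun _ _ => sq_nonneg _) (Finset.mem_univ i))

theorem continuous_torusAbs : Continuous torusAbs := by
  unfold torusAbs; fun_prop

/-- Subtract the nearest integer from each coordinate of any representative. -/
theorem exists_proj_abs_eq (z : T3) : ∃ h : Fin 3 → ℝ, proj h = z ∧ ∀ i, |h i| = ‖z i‖ := by
  have h1 : ∀ i, ∃ s : ℝ, (s : UnitAddCircle) = z i ∧ |s| = ‖z i‖ := fun i => by
    obtain ⟨s, hs⟩ := QuotientAddGroup.mk_surjective (z i)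
    refine ⟨s - round s, ?_, ?_⟩
    · rw [AddCircle.coe_sub, ← hs]
      have : ((round s : ℝ) : UnitAddCircle) = 0 := by
        rw [AddCircle.coe_eq_zero_iff]
        exact ⟨round s, by simp⟩
      rw [this, sub_zero]
    · rw [← hs]; exact UnitAddCircle.norm_eq.symm
  choose s hs hn using h1
  exact ⟨s, by ext i; simp [proj, hs], hn⟩

theorem exists_proj_norm_eq (z : T3) : ∃ h : E3, proj h = z ∧ ‖h‖ = torusAbs z := by
  obtain ⟨s, hs, hn⟩ := exists_proj_abs_eq z
  refine ⟨WithLp.toLp 2 s, hs, ?_⟩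
  rw [EuclideanSpace.norm_eq, torusAbs]
  simp [hn]

/-! ### A smooth mollifier -/

theorem periodic_sin_sq : Function.Periodic (fun s : ℝ => Real.sin (Real.pi * s) ^ 2) 1 := by
  intro s
  simp only [mul_add, mul_one, Real.sin_add_pi, neg_sq]

/-- The function `z ↦ ∑ sin² (π zᵢ)` on the torus, comparable to the squared distance to `0`. -/
def sinSq (z : T3) : ℝ := ∑ i, periodic_sin_sq.lift (z i)

theorem sinSq_proj (y : Fin 3 → ℝ) : sinSq (proj y) = ∑ i, Real.sin (Real.pi * y i) ^ 2 := by
  simp [sinSq, proj, Function.Periodic.lift_coe]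

theorem isSmooth_sinSq : IsSmooth sinSq := by
  unfold IsSmooth
  simp_rw [sinSq_proj]
  fun_prop

theorem sinSq_nonneg (z : T3) : 0 ≤ sinSq z := by
  obtain ⟨y, rfl⟩ := exists_proj z
  rw [sinSq_proj]
  exact Finset.sum_nonneg fun _ _ => sq_nonneg _

theorem sinSq_neg (z : T3) : sinSq (-z) = sinSq z := by
  obtain ⟨y, rfl⟩ := exists_proj z
  rw [← proj_neg, sinSq_proj, sinSq_proj]
  simp

/-- Jordan's inequality `|sin x| ≥ 2|x|/π`, applied to the representative with coordinates in
`[-1/2, 1/2]`. -/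
theorem four_mul_torusAbs_sq_le (z : T3) : 4 * torusAbs z ^ 2 ≤ sinSq z := by
  obtain ⟨h, rfl, hn⟩ := exists_proj_abs_eq z
  rw [sinSq_proj, torusAbs_sq, Finset.mul_sum]
  refine Finset.sum_le_sum fun i _ => ?_
  have h1 : |h i| ≤ 1 / 2 := by
    rw [hn]
    simpa using AddCircle.norm_le_half_period 1 one_ne_zero (x := proj h i)
  have h2 : |Real.pi * h i| ≤ Real.pi / 2 := by
    rw [abs_mul, abs_of_pos Real.pi_pos]
    nlinarith [Real.pi_pos]
  have h3 := Real.mul_abs_le_abs_sin h2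
  rw [abs_mul, abs_of_pos Real.pi_pos, ← mul_assoc, div_mul_cancel₀ _ Real.pi_ne_zero, hn] at h3
  calc 4 * ‖proj h i‖ ^ 2 = (2 * ‖proj h i‖) ^ 2 := by ring
    _ ≤ |Real.sin (Real.pi * h i)| ^ 2 := pow_le_pow_left₀ (by positivity) h3 2
    _ = _ := sq_abs _

theorem sinSq_le (z : T3) : sinSq z ≤ Real.pi ^ 2 * torusAbs z ^ 2 := by
  obtain ⟨h, rfl, hn⟩ := exists_proj_norm_eq z
  rw [sinSq_proj, ← hn, EuclideanSpace.real_norm_sq_eq, Finset.mul_sum]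
  refine Finset.sum_le_sum fun i _ => ?_
  rw [← mul_pow]
  exact sq_le_sq.2 (Real.abs_sin_le_abs)

/-- The square root matters: where `sinSq ≤ ε²`, the gradient of `sinSq / ε²` is of size `1/ε`,
whereas a uniform bound on the gradient would only give `1/ε²`. -/
theorem abs_pd_sinSq_le (i : Fin 3) (z : T3) : |pd i sinSq z| ≤ 2 * Real.pi * √(sinSq z) := by
  obtain ⟨y, rfl⟩ := exists_proj z
  have hd : ∀ j, HasDerivAt
      (fun s : ℝ => Real.sin (Real.pi * (y + s • (Pi.single i 1 : Fin 3 → ℝ)) j) ^ 2)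
      (if j = i then
        2 * Real.sin (Real.pi * y i) * (Real.cos (Real.pi * y i) * Real.pi) else 0) 0 := by
    intro j
    split_ifs with h
    · subst h
      have h1 : HasDerivAt (fun s : ℝ => Real.pi * (y j + s)) Real.pi 0 := by
        simpa using ((hasDerivAt_id (0 : ℝ)).const_add (y j)).const_mul Real.pi
      simpa using h1.sin.fun_pow 2
    · simpa [h] using hasDerivAt_const (0 : ℝ) (Real.sin (Real.pi * y j) ^ 2)
  have h1 : pd i sinSq (proj y) =
      2 * Real.sin (Real.pi * y i) * (Real.cos (Real.pi * y i) * Real.pi) := by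
    unfold pd
    simp_rw [add_proj_single_eq, sinSq_proj]
    rw [(HasDerivAt.fun_sum fun j _ => hd j).deriv]
    simp
  have h2 : |Real.sin (Real.pi * y i)| ≤ √(sinSq (proj y)) := by
    refine Real.abs_le_sqrt ?_
    rw [sinSq_proj]
    exact Finset.single_le_sum (f := fun i => Real.sin (Real.pi * y i) ^ 2)
      (fun _ _ => sq_nonneg _) (Finset.mem_univ i)
  rw [h1, abs_mul, abs_mul, abs_mul, abs_of_pos Real.pi_pos, abs_two]
  have h3 := Real.abs_cos_le_one (Real.pi * y i)
  have h4 : |Real.cos (Real.pi * y i)| * Real.pi ≤ Real.pi :=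
    mul_le_of_le_one_left Real.pi_pos.le h3
  calc 2 * |Real.sin (Real.pi * y i)| * (|Real.cos (Real.pi * y i)| * Real.pi)
      ≤ 2 * √(sinSq (proj y)) * Real.pi := by gcongr
    _ = _ := by ring

theorem pd_comp {φ : ℝ → ℝ} (hφ : Differentiable ℝ φ) (hf : IsSmooth f) (i : Fin 3) (x : T3) :
    pd i (fun x => φ (f x)) x = deriv φ (f x) * pd i f x := by
  have h := hf.hasDerivAt_zero i x
  have h2 : HasDerivAt φ (deriv φ (f x)) (f (x + proj (Pi.single i 0))) := by
    simpa [proj_zero] using (hφ (f x)).hasDerivAt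
  exact (h2.comp (0 : ℝ) h).deriv

theorem IsSmooth.comp {φ : ℝ → ℝ} (hφ : ContDiff ℝ ∞ φ) (hf : IsSmooth f) :
    IsSmooth (fun x => φ (f x)) := ContDiff.comp hφ hf

theorem volume_closedBall_zero {r : ℝ} (h0 : 0 ≤ r) (h1 : 2 * r ≤ 1) :
    volume.real (Metric.closedBall (0 : T3) r) = (2 * r) ^ 3 := by
  rw [measureReal_def, volume_pi_closedBall _ h0]
  simp only [AddCircle.volume_closedBall, min_eq_right h1, Finset.prod_const, Finset.card_univ,
    Fintype.card_fin, ENNReal.toReal_pow]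
  rw [ENNReal.toReal_ofReal (by linarith)]

theorem torusAbs_sq_le_norm (z : T3) : torusAbs z ^ 2 ≤ 3 * ‖z‖ ^ 2 := by
  rw [torusAbs_sq]
  calc ∑ i, ‖z i‖ ^ 2 ≤ ∑ _i : Fin 3, ‖z‖ ^ 2 := Finset.sum_le_sum fun i _ =>
        pow_le_pow_left₀ (norm_nonneg _) (norm_le_pi_norm z i) 2
    _ = 3 * ‖z‖ ^ 2 := by simp

theorem norm_le_torusAbs (z : T3) : ‖z‖ ≤ torusAbs z :=
  (pi_norm_le_iff_of_nonneg (torusAbs_nonneg z)).2 (norm_apply_le_torusAbs z)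

/-- A smooth cutoff, equal to `1` on `(-∞, 1/2]` and to `0` on `[1, ∞)`. -/
def cutoff (t : ℝ) : ℝ := Real.smoothTransition (2 - 2 * t)

theorem contDiff_cutoff : ContDiff ℝ ∞ cutoff :=
  Real.smoothTransition.contDiff.comp (by fun_prop)

theorem cutoff_of_one_le {t : ℝ} (ht : 1 ≤ t) : cutoff t = 0 :=
  Real.smoothTransition.zero_of_nonpos (by linarith)

theorem cutoff_of_le_half {t : ℝ} (ht : t ≤ 1 / 2) : cutoff t = 1 :=
  Real.smoothTransition.one_of_one_le (by linarith)

theorem deriv_cutoff_of_one_lt {t : ℝ} (ht : 1 < t) : deriv cutoff t = 0 := by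
  have : cutoff =ᶠ[𝓝 t] fun _ => 0 := (lt_mem_nhds ht).mono fun s hs => cutoff_of_one_le hs.le
  rw [this.deriv_eq]; simp

theorem deriv_deriv_cutoff_of_one_lt {t : ℝ} (ht : 1 < t) : deriv (deriv cutoff) t = 0 := by
  have : deriv cutoff =ᶠ[𝓝 t] fun _ => 0 :=
    (lt_mem_nhds ht).mono fun s hs => deriv_cutoff_of_one_lt hs
  rw [this.deriv_eq]; simp

/-- `k` is a smooth even probability density on the torus, concentrated at scale `ε`, with
derivatives of the natural size up to the factor `C`. -/
structure IsMollifier (C ε : ℝ) (k : T3 → ℝ) : Prop where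
  smooth : IsSmooth k
  even : ∀ z, k (-z) = k z
  nonneg : ∀ z, 0 ≤ k z
  integral_eq_one : ∫ z, k z = 1
  eq_zero : ∀ z, ε < torusAbs z → k z = 0
  pd_eq_zero : ∀ i z, ε < torusAbs z → pd i k z = 0
  pd_pd_eq_zero : ∀ i j z, ε < torusAbs z → pd j (pd i k) z = 0
  integral_abs_pd : ∀ i, ∫ z, |pd i k z| ≤ C / ε
  integral_abs_pd_pd : ∀ i j, ∫ z, |pd j (pd i k) z| ≤ C / ε ^ 2
  integral_sq : ∫ z, k z ^ 2 ≤ C / ε ^ 3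
  integral_sq_pd : ∀ i, ∫ z, pd i k z ^ 2 ≤ C / ε ^ 5

/-- The set `sinSq ≤ ε²` lies in the sup-norm ball of radius `ε/2`, which is a cube of volume `ε³`.
-/
theorem integral_le_of_support {h : T3 → ℝ} {A ε : ℝ} (hε : 0 < ε) (hε1 : ε ≤ 1)
    (hh : Continuous h) (hA : ∀ z, h z ≤ A) (h0 : ∀ z, ε ^ 2 < sinSq z → h z = 0) :
    ∫ z, h z ≤ A * ε ^ 3 := by
  have hsub : ∀ z, z ∉ Metric.closedBall (0 : T3) (ε / 2) → h z = 0 := by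
    intro z hz
    refine h0 z ?_
    rw [mem_closedBall_zero_iff, not_le] at hz
    have h1 := hz.trans_le (norm_le_torusAbs z)
    have h2 := four_mul_torusAbs_sq_le z
    nlinarith
  have h1 : ∫ z, h z = ∫ z in Metric.closedBall (0 : T3) (ε / 2), h z :=
    (setIntegral_eq_integral_of_forall_compl_eq_zero hsub).symm
  rw [h1]
  calc ∫ z in Metric.closedBall (0 : T3) (ε / 2), h z
      ≤ ∫ z in Metric.closedBall (0 : T3) (ε / 2), A :=
        integral_mono (integrable_of_continuous hh).integrableOn (integrable_const _) hA
    _ = A * ε ^ 3 := by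
        rw [setIntegral_const, volume_closedBall_zero (by linarith) (by linarith)]
        simp only [smul_eq_mul]
        ring

theorem exists_isMollifier :
    ∃ C, 0 ≤ C ∧ ∀ ε, 0 < ε → ε ≤ 1 → ∃ k, IsMollifier C ε k := by
  have hc1 : ContDiff ℝ ∞ (deriv cutoff) := (contDiff_infty_iff_deriv.1 contDiff_cutoff).2
  have hc2 : ContDiff ℝ ∞ (deriv (deriv cutoff)) := (contDiff_infty_iff_deriv.1 hc1).2
  obtain ⟨B₁, hB₁⟩ := (isCompact_Icc (a := (0 : ℝ)) (b := 1)).exists_bound_of_continuousOn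
    hc1.continuous.continuousOn
  obtain ⟨B₂, hB₂⟩ := (isCompact_Icc (a := (0 : ℝ)) (b := 1)).exists_bound_of_continuousOn
    hc2.continuous.continuousOn
  have hB₁0 : 0 ≤ B₁ := (norm_nonneg _).trans (hB₁ 0 (by simp))
  have hB₂0 : 0 ≤ B₂ := (norm_nonneg _).trans (hB₂ 0 (by simp))
  have hD' : ∀ q : Fin 3 × Fin 3, ∃ D, 0 ≤ D ∧ ∀ x, |pd q.2 (pd q.1 sinSq) x| ≤ D := fun q =>
    exists_forall_abs_le ((isSmooth_sinSq.pd q.1).pd q.2).continuous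
  choose D' hD'0 hD' using hD'
  set D := ∑ q, D' q with hDdef
  have hD0 : 0 ≤ D := Finset.sum_nonneg fun q _ => hD'0 q
  have hD : ∀ i j x, |pd j (pd i sinSq) x| ≤ D := fun i j x =>
    (hD' (i, j) x).trans (Finset.single_le_sum (fun q _ => hD'0 q) (Finset.mem_univ (i, j)))
  set A₁ := B₁ * (2 * Real.pi) with hA₁
  set A₂ := B₂ * (2 * Real.pi) ^ 2 + B₁ * D with hA₂
  have hA₁0 : 0 ≤ A₁ := by positivity
  have hA₂0 : 0 ≤ A₂ := by positivity
  -- Normalization divides by a mass of at least `ε³/125`, once in the `L¹` bounds and twice in the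
  -- squared `L²` bounds, whence `125²`.
  refine ⟨125 ^ 2 * (1 + A₁ + A₂ + A₁ ^ 2), by positivity, fun ε hε hε1 => ?_⟩
  set f : T3 → ℝ := fun z => (ε ^ 2)⁻¹ * sinSq z with hf
  have hfs : IsSmooth f := (IsSmooth.const _).mul isSmooth_sinSq
  have hf1 : ∀ z, ε ^ 2 < sinSq z → 1 < f z := fun z hz => by
    rw [hf]; dsimp only
    rwa [← div_eq_inv_mul, one_lt_div (by positivity)]
  have hf0 : ∀ z, sinSq z ≤ ε ^ 2 → f z ∈ Icc (0 : ℝ) 1 := fun z hz => by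
    refine ⟨mul_nonneg (by positivity) (sinSq_nonneg z), ?_⟩
    rw [hf]; dsimp only
    rwa [← div_eq_inv_mul, div_le_one (by positivity)]
  have hpf : ∀ i z, pd i f z = (ε ^ 2)⁻¹ * pd i sinSq z := fun i z =>
    pd_const_mul isSmooth_sinSq _ i z
  have hpf' : ∀ i z, sinSq z ≤ ε ^ 2 → |pd i f z| ≤ 2 * Real.pi / ε := fun i z hz => by
    rw [hpf, abs_mul, abs_of_pos (by positivity : 0 < (ε ^ 2)⁻¹)]
    have h1 : √(sinSq z) ≤ ε := by rw [← Real.sqrt_sq hε.le]; exact Real.sqrt_le_sqrt hz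
    calc (ε ^ 2)⁻¹ * |pd i sinSq z| ≤ (ε ^ 2)⁻¹ * (2 * Real.pi * ε) := by
          gcongr
          exact (abs_pd_sinSq_le i z).trans (by gcongr)
      _ = 2 * Real.pi / ε := by field_simp
  set r : T3 → ℝ := fun z => cutoff (f z) with hr
  have hrs : IsSmooth r := hfs.comp contDiff_cutoff
  have hr0 : ∀ z, 0 ≤ r z := fun z => Real.smoothTransition.nonneg _
  have hr1 : ∀ z, r z ≤ 1 := fun z => Real.smoothTransition.le_one _
  have hpr : ∀ i z, pd i r z = deriv cutoff (f z) * pd i f z := fun i z =>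
    pd_comp (contDiff_cutoff.differentiable (by simp)) hfs i z
  have hppr : ∀ i j z, pd j (pd i r) z =
      deriv (deriv cutoff) (f z) * pd j f z * pd i f z
        + deriv cutoff (f z) * ((ε ^ 2)⁻¹ * pd j (pd i sinSq) z) := by
    intro i j z
    have h1 : pd i r = fun z => deriv cutoff (f z) * pd i f z := funext (hpr i)
    have h2 : pd i f = fun z => (ε ^ 2)⁻¹ * pd i sinSq z := funext (hpf i)
    rw [h1, pd_mul (hfs.comp hc1) (hfs.pd i), pd_comp (hc1.differentiable (by simp)) hfs]
    congr 2
    rw [h2, pd_const_mul (isSmooth_sinSq.pd i)]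
  have hz0 : ∀ z, ε ^ 2 < sinSq z → r z = 0 := fun z hz => cutoff_of_one_le (hf1 z hz).le
  have hz1 : ∀ i z, ε ^ 2 < sinSq z → pd i r z = 0 := fun i z hz => by
    rw [hpr, deriv_cutoff_of_one_lt (hf1 z hz), zero_mul]
  have hz2 : ∀ i j z, ε ^ 2 < sinSq z → pd j (pd i r) z = 0 := fun i j z hz => by
    rw [hppr, deriv_cutoff_of_one_lt (hf1 z hz), deriv_deriv_cutoff_of_one_lt (hf1 z hz)]
    simp
  have hb1 : ∀ i z, |pd i r z| ≤ A₁ / ε := fun i z => by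
    rcases lt_or_ge (ε ^ 2) (sinSq z) with hz | hz
    · rw [hz1 i z hz, abs_zero]; positivity
    · rw [hpr, abs_mul]
      calc _ ≤ B₁ * (2 * Real.pi / ε) := by
            gcongr
            exacts [hB₁ _ (hf0 z hz), hpf' i z hz]
        _ = _ := by rw [hA₁]; ring
  have hb2 : ∀ i j z, |pd j (pd i r) z| ≤ A₂ / ε ^ 2 := fun i j z => by
    rcases lt_or_ge (ε ^ 2) (sinSq z) with hz | hz
    · rw [hz2 i j z hz, abs_zero]; positivity
    · rw [hppr]
      refine (abs_add_le _ _).trans ?_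
      rw [abs_mul, abs_mul, abs_mul, abs_mul, abs_of_pos (by positivity : 0 < (ε ^ 2)⁻¹)]
      calc _ ≤ B₂ * (2 * Real.pi / ε) * (2 * Real.pi / ε) + B₁ * ((ε ^ 2)⁻¹ * D) := by
            gcongr
            exacts [hB₂ _ (hf0 z hz), hpf' j z hz, hpf' i z hz, hB₁ _ (hf0 z hz), hD i j z]
        _ = _ := by rw [hA₂]; field_simp
  set m := ∫ z, r z with hm
  -- On the sup-norm ball of radius `ε/10`, `sinSq ≤ π² · 3 (ε/10)² ≤ ε²/2`, so the cutoff equals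
  -- `1` there; the ball has volume `(ε/5)³`.
  have hmass : ε ^ 3 / 125 ≤ m := by
    have h1 : ∀ z ∈ Metric.closedBall (0 : T3) (ε / 10), r z = 1 := fun z hz => by
      refine cutoff_of_le_half ?_
      rw [mem_closedBall_zero_iff] at hz
      have h2 := torusAbs_sq_le_norm z
      have h3 := sinSq_le z
      have h4 : Real.pi ^ 2 ≤ 10 := by nlinarith [Real.pi_lt_d2, Real.pi_pos]
      have h5 : ‖z‖ ^ 2 ≤ (ε / 10) ^ 2 := pow_le_pow_left₀ (norm_nonneg _) hz 2
      rw [hf]; dsimp only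
      rw [← div_eq_inv_mul, div_le_iff₀ (by positivity)]
      calc sinSq z ≤ Real.pi ^ 2 * torusAbs z ^ 2 := h3
        _ ≤ 10 * (3 * (ε / 10) ^ 2) := by gcongr; linarith
        _ ≤ _ := by nlinarith [sq_nonneg ε]
    calc ε ^ 3 / 125 = ∫ z in Metric.closedBall (0 : T3) (ε / 10), (1 : ℝ) := by
          rw [setIntegral_const, volume_closedBall_zero (by linarith) (by linarith)]
          simp only [smul_eq_mul]; ring
      _ = ∫ z in Metric.closedBall (0 : T3) (ε / 10), r z :=
          (setIntegral_congr_fun measurableSet_closedBall h1).symm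
      _ ≤ m := setIntegral_le_integral (integrable_of_continuous hrs.continuous)
          (Eventually.of_forall hr0)
  have hm0 : 0 < m := lt_of_lt_of_le (by positivity) hmass
  have hminv : m⁻¹ ≤ 125 / ε ^ 3 := by
    rw [inv_le_comm₀ hm0 (by positivity), inv_div]; exact hmass
  have hbig : ∀ z, ε < torusAbs z → ε ^ 2 < sinSq z := fun z hz => by
    have := four_mul_torusAbs_sq_le z
    nlinarith
  have hpk : ∀ i, pd i (fun z => m⁻¹ * r z) = fun z => m⁻¹ * pd i r z := fun i =>
    funext fun z => pd_const_mul hrs _ i z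
  have hppk : ∀ i j, pd j (pd i (fun z => m⁻¹ * r z)) = fun z => m⁻¹ * pd j (pd i r) z :=
    fun i j => by
      rw [hpk]
      exact funext fun z => pd_const_mul (hrs.pd i) _ j z
  have hm1 : 0 ≤ m⁻¹ := (inv_pos.2 hm0).le
  refine ⟨fun z => m⁻¹ * r z, (IsSmooth.const _).mul hrs, fun z => ?_, fun z => ?_, ?_,
    fun z hz => ?_, fun i z hz => ?_, fun i j z hz => ?_, fun i => ?_, fun i j => ?_, ?_,
    fun i => ?_⟩
  · simp only [hr, hf, sinSq_neg]
  · exact mul_nonneg hm1 (hr0 z)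
  · rw [integral_const_mul, inv_mul_cancel₀ hm0.ne']
  · simp [hz0 z (hbig z hz)]
  · rw [hpk]; simp [hz1 i z (hbig z hz)]
  · rw [hppk]; simp [hz2 i j z (hbig z hz)]
  · simp_rw [hpk, abs_mul, abs_of_nonneg hm1]
    rw [integral_const_mul]
    calc m⁻¹ * ∫ z, |pd i r z| ≤ 125 / ε ^ 3 * (A₁ / ε * ε ^ 3) := by
          gcongr
          exact integral_le_of_support hε hε1 (hrs.pd i).continuous.abs (hb1 i)
            fun z hz => by rw [hz1 i z hz, abs_zero]
      _ = 125 * A₁ / ε := by field_simp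
      _ ≤ _ := by gcongr <;> nlinarith [sq_nonneg A₁]
  · simp_rw [hppk, abs_mul, abs_of_nonneg hm1]
    rw [integral_const_mul]
    calc m⁻¹ * ∫ z, |pd j (pd i r) z| ≤ 125 / ε ^ 3 * (A₂ / ε ^ 2 * ε ^ 3) := by
          gcongr
          exact integral_le_of_support hε hε1 ((hrs.pd i).pd j).continuous.abs (hb2 i j)
            fun z hz => by rw [hz2 i j z hz, abs_zero]
      _ = 125 * A₂ / ε ^ 2 := by field_simp
      _ ≤ _ := by gcongr <;> nlinarith [sq_nonneg A₁]
  · simp_rw [mul_pow]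
    rw [integral_const_mul]
    calc m⁻¹ ^ 2 * ∫ z, r z ^ 2 ≤ (125 / ε ^ 3) ^ 2 * (1 * ε ^ 3) := by
          gcongr
          exact integral_le_of_support hε hε1 (hrs.continuous.pow 2)
            (fun z => pow_le_one₀ (hr0 z) (hr1 z)) fun z hz => by rw [hz0 z hz]; simp
      _ = 125 ^ 2 * 1 / ε ^ 3 := by field_simp
      _ ≤ _ := by gcongr; nlinarith [sq_nonneg A₁]
  · simp_rw [hpk, mul_pow]
    rw [integral_const_mul]
    calc m⁻¹ ^ 2 * ∫ z, pd i r z ^ 2 ≤ (125 / ε ^ 3) ^ 2 * ((A₁ / ε) ^ 2 * ε ^ 3) := by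
          gcongr
          refine integral_le_of_support hε hε1 ((hrs.pd i).continuous.pow 2)
            (fun z => ?_) fun z hz => by rw [hz1 i z hz]; simp
          rw [← sq_abs]
          exact pow_le_pow_left₀ (abs_nonneg _) (hb1 i z) 2
      _ = 125 ^ 2 * A₁ ^ 2 / ε ^ 5 := by field_simp
      _ ≤ _ := by gcongr; nlinarith [sq_nonneg A₁]

end

section

variable {f g k : T3 → ℝ} {i j : Fin 3}

/-! ### Mollification estimates -/

/-- Applied both to a mollifier, of integral one, and to its derivatives, of integral zero:
approximation errors and derivatives of mollifications are then averages of the same increments. -/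
theorem cv_sub_integral_mul (hg : Continuous g) (hf : Integrable f) (x : T3) :
    cv g f x - (∫ z, g z) * f x = ∫ z, g z * (f (x - z) - f x) := by
  rw [cv_eq_integral_comp_sub, ← integral_mul_const, ← integral_sub]
  · simp_rw [mul_sub]
  · exact integrable_continuous_mul hg (hf.comp_sub_left x)
  · exact (integrable_of_continuous hg).mul_const _

section Increments

variable {E : Type*} [NormedAddCommGroup E] {w : T3 → E}

theorem aestronglyMeasurable_comp_sub (hw : AEStronglyMeasurable w) :
    AEStronglyMeasurable (fun q : T3 × T3 => w (q.1 - q.2))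
      ((volume : Measure T3).prod volume) :=
  hw.comp_quasiMeasurePreserving (quasiMeasurePreserving_sub volume volume)

theorem aestronglyMeasurable_increment (hw : AEStronglyMeasurable w) :
    AEStronglyMeasurable (fun q : T3 × T3 => w (q.1 - q.2) - w q.1)
      ((volume : Measure T3).prod volume) :=
  (aestronglyMeasurable_comp_sub hw).sub hw.comp_fst

theorem aestronglyMeasurable_translate (hw : AEStronglyMeasurable w) (z : T3) :
    AEStronglyMeasurable (fun x => w (x - z)) :=
  hw.comp_measurePreserving (measurePreserving_sub_right volume z)

theorem aestronglyMeasurable_translate_sub (hw : AEStronglyMeasurable w) (z : T3) :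
    AEStronglyMeasurable (fun x => w (x - z) - w x) :=
  (aestronglyMeasurable_translate hw z).sub hw

end Increments

/-- Hölder's inequality on the finite measure `|g| dz`, comparing the `L¹` and `L^q` norms of `F`.
-/
theorem rpow_lintegral_enorm_mul_le {q : ℝ} (hq : 1 ≤ q) (hg : Continuous g) {F : T3 → ℝ}
    (hF : AEStronglyMeasurable F) :
    (∫⁻ z, ‖g z‖ₑ * ‖F z‖ₑ) ^ q ≤
      (∫⁻ z, ‖g z‖ₑ) ^ (q - 1) * ∫⁻ z, ‖g z‖ₑ * ‖F z‖ₑ ^ q := by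
  have hq0 : 0 < q := by linarith
  set ν := (volume : Measure T3).withDensity fun z => ‖g z‖ₑ with hν
  have hgm : Measurable fun z => ‖g z‖ₑ := hg.enorm.measurable
  have h1 := eLpNorm_le_eLpNorm_mul_rpow_measure_univ (μ := ν) (p := 1) (q := ENNReal.ofReal q)
    (by simpa using ENNReal.ofReal_le_ofReal hq)
    (hF.mono_ac (withDensity_absolutelyContinuous volume _))
  rw [eLpNorm_one_eq_lintegral_enorm, eLpNorm_eq_lintegral_rpow_enorm_toReal (by simpa using hq0)
    ENNReal.ofReal_ne_top, ENNReal.toReal_ofReal hq0.le, ENNReal.toReal_one, div_one] at h1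
  rw [lintegral_withDensity_eq_lintegral_mul₀ hgm.aemeasurable hF.enorm,
    lintegral_withDensity_eq_lintegral_mul₀ hgm.aemeasurable (hF.enorm.pow_const q), hν,
    withDensity_apply _ MeasurableSet.univ, Measure.restrict_univ] at h1
  simp only [Pi.mul_apply] at h1
  calc _ ≤ _ := ENNReal.rpow_le_rpow h1 hq0.le
    _ = _ := by
      rw [ENNReal.mul_rpow_of_nonneg _ _ hq0.le, ← ENNReal.rpow_mul, ← ENNReal.rpow_mul,
        one_div, inv_mul_cancel₀ hq0.ne', ENNReal.rpow_one, mul_comm, sub_mul,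
        inv_mul_cancel₀ hq0.ne', one_mul]

theorem ofReal_integral_abs (hg : Continuous g) : ENNReal.ofReal (∫ z, |g z|) = ∫⁻ z, ‖g z‖ₑ := by
  rw [ofReal_integral_eq_lintegral_ofReal (integrable_of_continuous hg).abs
    (Eventually.of_forall fun _ => abs_nonneg _)]
  simp_rw [← Real.enorm_eq_ofReal_abs]

/-- Minkowski's integral inequality. -/
theorem eLpNorm_integral_mul_le {q : ℝ} (hq : 1 ≤ q) (hg : Continuous g) {F : T3 × T3 → ℝ}
    (hF : AEStronglyMeasurable F ((volume : Measure T3).prod volume)) {A : ℝ≥0∞}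
    (hFz : ∀ z, AEStronglyMeasurable fun x => F (x, z))
    (hA : ∀ z, g z ≠ 0 → eLpNorm (fun x => F (x, z)) (ENNReal.ofReal q) volume ≤ A) :
    eLpNorm (fun x => ∫ z, g z * F (x, z)) (ENNReal.ofReal q) volume ≤
      ENNReal.ofReal (∫ z, |g z|) * A := by
  have hq0 : 0 < q := by linarith
  have hp0 : ENNReal.ofReal q ≠ 0 := by simpa using hq0
  set a := ∫⁻ z, ‖g z‖ₑ with ha
  rw [ofReal_integral_abs hg, eLpNorm_eq_lintegral_rpow_enorm_toReal hp0 ENNReal.ofReal_ne_top,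
    ENNReal.toReal_ofReal hq0.le, one_div, ENNReal.rpow_inv_le_iff hq0]
  have hm2 : AEMeasurable (fun q' : T3 × T3 => ‖g q'.2‖ₑ * ‖F (q'.1, q'.2)‖ₑ ^ q)
      ((volume : Measure T3).prod volume) :=
    (hg.enorm.measurable.comp measurable_snd).aemeasurable.mul (hF.enorm.pow_const q)
  calc ∫⁻ x, ‖∫ z, g z * F (x, z)‖ₑ ^ q
      ≤ ∫⁻ x, a ^ (q - 1) * ∫⁻ z, ‖g z‖ₑ * ‖F (x, z)‖ₑ ^ q := by
        refine lintegral_mono_ae ?_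
        filter_upwards [hF.prodMk_left] with x hx
        refine le_trans ?_ (rpow_lintegral_enorm_mul_le hq hg hx)
        refine ENNReal.rpow_le_rpow ?_ hq0.le
        refine (enorm_integral_le_lintegral_enorm _).trans_eq ?_
        simp_rw [enorm_mul]
    _ = a ^ (q - 1) * ∫⁻ z, ∫⁻ x, ‖g z‖ₑ * ‖F (x, z)‖ₑ ^ q := by
        rw [lintegral_const_mul'' _ hm2.lintegral_prod_right', lintegral_lintegral_swap hm2]
    _ ≤ a ^ (q - 1) * ∫⁻ z, ‖g z‖ₑ * A ^ q := by
        gcongr with z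
        rw [lintegral_const_mul'' _ ((hFz z).enorm.pow_const q)]
        -- Shifts outside the support of `g` carry no weight, so the bound `A` is needed only for
        -- shifts of size at most the mollification scale.
        by_cases hz : g z = 0
        · simp [hz]
        · gcongr
          have := hA z hz
          rw [eLpNorm_eq_lintegral_rpow_enorm_toReal hp0 ENNReal.ofReal_ne_top,
            ENNReal.toReal_ofReal hq0.le, one_div, ENNReal.rpow_inv_le_iff hq0] at this
          exact this
    _ = (a * A) ^ q := by
        rw [lintegral_mul_const _ hg.enorm.measurable, ← ha, ← mul_assoc,
          ENNReal.mul_rpow_of_nonneg _ _ hq0.le]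
        congr 1
        have hat : a ≠ ⊤ := (integrable_of_continuous hg).2.ne
        rcases eq_or_ne a 0 with h0 | h0
        · simp [h0, hq0]
        · nth_rw 2 [← ENNReal.rpow_one a]
          rw [← ENNReal.rpow_add _ _ h0 hat]
          congr 1; ring

theorem eLpNorm_cv_sub_le {q : ℝ} (hq : 1 ≤ q) (hg : Continuous g) (hf : Integrable f) {A : ℝ≥0∞}
    (hA : ∀ z, g z ≠ 0 → eLpNorm (fun x => f (x - z) - f x) (ENNReal.ofReal q) volume ≤ A) :
    eLpNorm (fun x => cv g f x - (∫ z, g z) * f x) (ENNReal.ofReal q) volume ≤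
      ENNReal.ofReal (∫ z, |g z|) * A := by
  simp_rw [cv_sub_integral_mul hg hf]
  exact eLpNorm_integral_mul_le hq hg (aestronglyMeasurable_increment hf.aestronglyMeasurable)
    (aestronglyMeasurable_translate_sub hf.aestronglyMeasurable) hA

theorem eLpNorm_cv_le {q : ℝ} (hq : 1 ≤ q) (hg : Continuous g) (hf : Integrable f) :
    eLpNorm (cv g f) (ENNReal.ofReal q) volume ≤
      ENNReal.ofReal (∫ z, |g z|) * eLpNorm f (ENNReal.ofReal q) volume := by
  have h : cv g f = fun x => ∫ z, g z * f (x - z) := funext (cv_eq_integral_comp_sub g f)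
  rw [h]
  refine eLpNorm_integral_mul_le hq hg (aestronglyMeasurable_comp_sub hf.aestronglyMeasurable)
    (aestronglyMeasurable_translate hf.aestronglyMeasurable) fun z _ => ?_
  exact (eLpNorm_comp_measurePreserving hf.aestronglyMeasurable
    (measurePreserving_sub_right volume z)).le

/-! ### The Gagliardo seminorm -/

/-- The squared Gagliardo seminorm of `H^{1/2}(𝕋³)`. -/
def gagliardo {E : Type*} [NormedAddCommGroup E] (w : T3 → E) : ℝ≥0∞ :=
  ∫⁻ x : T3, ∫⁻ y : T3, ‖w x - w y‖ₑ ^ 2 / ENNReal.ofReal (torusAbs (x - y) ^ 4)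

theorem sobolevHalfNorm_eq (v : T3 → E3) :
    sobolevHalfNorm v = eLpNorm v 2 volume + gagliardo v ^ (1 / 2 : ℝ) := rfl

theorem gagliardo_eq {E : Type*} [NormedAddCommGroup E] (w : T3 → E) :
    gagliardo w =
      ∫⁻ x : T3, ∫⁻ z : T3, ‖w (x - z) - w x‖ₑ ^ 2 / ENNReal.ofReal (torusAbs z ^ 4) := by
  refine lintegral_congr fun x => ?_
  rw [← lintegral_sub_left_eq_self _ x]
  refine lintegral_congr fun z => ?_
  rw [sub_sub_cancel, ← enorm_neg, neg_sub]

theorem eLpNorm_two_sq {E : Type*} [NormedAddCommGroup E] (w : T3 → E) :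
    eLpNorm w 2 volume ^ 2 = ∫⁻ x, ‖w x‖ₑ ^ 2 := by
  rw [eLpNorm_eq_lintegral_rpow_enorm_toReal (by simp) (by simp), ← ENNReal.rpow_natCast,
    ← ENNReal.rpow_mul]
  simp

/-- The constant in the embedding of `B^s_{2,∞}` into `H^{1/2}`. -/
def gagliardoConst (s : ℝ) : ℝ≥0∞ :=
  ∫⁻ z : T3, ENNReal.ofReal (torusAbs z ^ s) ^ 2 / ENNReal.ofReal (torusAbs z ^ 4)

/-- By Tonelli, integrate in `x` first at fixed shift `z`; what remains is the integral of
`|z|^(2s-4)`. -/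
theorem gagliardo_le {E : Type*} [NormedAddCommGroup E] {w : T3 → E} (hw : AEStronglyMeasurable w)
    {s M : ℝ} (hM : 0 ≤ M)
    (h : ∀ z, eLpNorm (fun x => w (x - z) - w x) 2 volume ≤ ENNReal.ofReal (M * torusAbs z ^ s)) :
    gagliardo w ≤ ENNReal.ofReal M ^ 2 * gagliardoConst s := by
  have hm := aestronglyMeasurable_increment hw
  have hc : Measurable fun z : T3 => ENNReal.ofReal (torusAbs z ^ 4) :=
    (continuous_torusAbs.pow 4).measurable.ennreal_ofReal
  have hc' : Measurable fun z : T3 => ENNReal.ofReal (torusAbs z ^ s) :=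
    (continuous_torusAbs.measurable.pow_const s).ennreal_ofReal
  have hm2 : AEMeasurable (fun q' : T3 × T3 => ‖w (q'.1 - q'.2) - w q'.1‖ₑ ^ 2 /
      ENNReal.ofReal (torusAbs q'.2 ^ 4)) ((volume : Measure T3).prod volume) :=
    (hm.enorm.pow_const 2).div (hc.comp measurable_snd).aemeasurable
  rw [gagliardo_eq, lintegral_lintegral_swap hm2, gagliardoConst,
    ← lintegral_const_mul _ (by fun_prop)]
  refine lintegral_mono fun z => ?_
  simp_rw [div_eq_mul_inv]
  rw [lintegral_mul_const'' _ ((aestronglyMeasurable_translate_sub hw z).enorm.pow_const 2),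
    ← mul_assoc, ← mul_pow, ← ENNReal.ofReal_mul hM]
  gcongr
  refine (eLpNorm_two_sq _).symm.trans_le ?_
  gcongr
  exact h z

/-- Cauchy–Schwarz in `z` after inserting the weight `|z|²` and its inverse: one factor is `∫ g²
|z|⁴ ≤ ε⁴ ∫ g²`, the other integrates in `x` to the Gagliardo seminorm. -/
theorem eLpNorm_cv_sub_sq_le {ε : ℝ} (hg : Continuous g) (hε : ∀ z, ε < torusAbs z → g z = 0)
    (hf : Integrable f) :
    eLpNorm (fun x => cv g f x - (∫ z, g z) * f x) 2 volume ^ 2 ≤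
      ENNReal.ofReal ((∫ z, g z ^ 2) * ε ^ 4) * gagliardo f := by
  have hm := aestronglyMeasurable_increment hf.aestronglyMeasurable
  have hc : Measurable fun z : T3 => ENNReal.ofReal (torusAbs z ^ 2) :=
    (continuous_torusAbs.pow 2).measurable.ennreal_ofReal
  have hgm : Measurable fun z => ‖g z‖ₑ := hg.enorm.measurable
  simp_rw [cv_sub_integral_mul hg hf]
  rw [eLpNorm_two_sq, gagliardo_eq, ← lintegral_const_mul'' _ (by
    exact ((hm.enorm.pow_const 2).div
      ((continuous_torusAbs.pow 4).measurable.ennreal_ofReal.comp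
        measurable_snd).aemeasurable).lintegral_prod_right')]
  have hsq : ∀ z : T3, ENNReal.ofReal (torusAbs z ^ 4) = ENNReal.ofReal (torusAbs z ^ 2) ^ 2 :=
    fun z => by rw [← ENNReal.ofReal_pow (by positivity)]; congr 1; ring
  refine lintegral_mono_ae ?_
  filter_upwards [hm.prodMk_left] with x hx
  have h1 : ∀ z, ‖g z * (f (x - z) - f x)‖ₑ ≤
      (‖g z‖ₑ * ENNReal.ofReal (torusAbs z ^ 2)) *
        (‖f (x - z) - f x‖ₑ / ENNReal.ofReal (torusAbs z ^ 2)) := by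
    intro z
    -- At `z = 0` the weight cannot be cancelled, but there the increment is zero.
    rcases eq_or_lt_of_le (torusAbs_nonneg z) with hz | hz
    · have : z = 0 := by
        have := norm_le_torusAbs z
        rw [← hz] at this
        exact norm_le_zero_iff.1 this
      simp [this]
    · rw [enorm_mul, mul_assoc, ENNReal.mul_div_cancel (by simpa using hz.ne')
        ENNReal.ofReal_ne_top]
  have h2 := ENNReal.lintegral_mul_le_Lp_mul_Lq volume Real.HolderConjugate.two_two
    (hgm.mul hc).aemeasurable (hx.enorm.div hc.aemeasurable)
  simp only [Pi.mul_apply] at h2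
  calc ‖∫ z, g z * (f (x - z) - f x)‖ₑ ^ 2
      ≤ (∫⁻ z, (‖g z‖ₑ * ENNReal.ofReal (torusAbs z ^ 2)) *
        (‖f (x - z) - f x‖ₑ / ENNReal.ofReal (torusAbs z ^ 2))) ^ 2 := by
        gcongr
        exact (enorm_integral_le_lintegral_enorm _).trans (lintegral_mono h1)
    _ ≤ _ := pow_le_pow_left₀ zero_le h2 2
    _ = (∫⁻ z, (‖g z‖ₑ * ENNReal.ofReal (torusAbs z ^ 2)) ^ 2) *
        ∫⁻ z, (‖f (x - z) - f x‖ₑ / ENNReal.ofReal (torusAbs z ^ 2)) ^ 2 := by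
        rw [mul_pow, ← ENNReal.rpow_natCast, ← ENNReal.rpow_natCast, ← ENNReal.rpow_mul,
          ← ENNReal.rpow_mul]
        norm_num
    _ ≤ _ := by
        gcongr with z
        · rw [← integral_mul_const, ofReal_integral_eq_lintegral_ofReal
            ((integrable_of_continuous (f := fun z => g z ^ 2) (hg.pow 2)).mul_const _)
            (Eventually.of_forall fun z => mul_nonneg (sq_nonneg _) (by positivity))]
          refine lintegral_mono fun z => ?_
          rcases lt_or_ge ε (torusAbs z) with hz | hz
          · simp [hε z hz]
          · rw [Real.enorm_eq_ofReal_abs, ← ENNReal.ofReal_mul (abs_nonneg _),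
              ← ENNReal.ofReal_pow (by positivity), mul_pow, sq_abs, ← pow_mul]
            gcongr
            exact torusAbs_nonneg z
        · rw [hsq, div_eq_mul_inv, div_eq_mul_inv, mul_pow, ENNReal.inv_pow]

theorem integrable_norm_rpow_unitAddCircle {b : ℝ} (hb : b < 1) :
    Integrable fun t : UnitAddCircle => ‖t‖ ^ (-b) := by
  refine ⟨(measurable_norm.pow_const _).aestronglyMeasurable, ?_⟩
  rw [HasFiniteIntegral, ← UnitAddCircle.lintegral_preimage (-(1 / 2))]
  have h1 : IntervalIntegrable (fun s : ℝ => |s| ^ (-b)) volume 0 (1 / 2) := by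
    refine (intervalIntegral.intervalIntegrable_rpow' (r := -b) (by linarith)).congr ?_
    intro s hs
    rw [uIoc_of_le (by norm_num)] at hs
    simp [abs_of_pos hs.1]
  have h2 : IntervalIntegrable (fun s : ℝ => |s| ^ (-b)) volume (-(1 / 2)) 0 := by
    have := ((IntervalIntegrable.iff_comp_neg (by simp)).1 h1).symm
    simpa using this
  have h3 := (h2.trans h1).1.2
  rw [HasFiniteIntegral] at h3
  norm_num at h3 ⊢
  refine lt_of_le_of_lt (setLIntegral_mono' measurableSet_Ioc fun s hs => ?_) h3
  rw [(AddCircle.norm_coe_eq_abs_iff 1 one_ne_zero).2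
    (by rw [abs_le, abs_one]; constructor <;> linarith [hs.1, hs.2])]

/-- Since `|zᵢ| ≤ |z|`, the kernel `|z|^(-(4-2s))` is at most `∏ |zᵢ|^(-b)` with `b = (4-2s)/3`. The
product integrates coordinate by coordinate, and `b < 1` is exactly `s > 1/2`. -/
theorem gagliardoConst_lt_top {s : ℝ} (hs : 1 / 2 < s) (hs1 : s ≤ 1) : gagliardoConst s < ⊤ := by
  set b := (4 - 2 * s) / 3 with hb
  have hb1 : b < 1 := by rw [hb]; linarith
  have hb0 : 0 ≤ b := by rw [hb]; linarith
  have hint : Integrable (fun z : T3 => ∏ i, ‖z i‖ ^ (-b)) :=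
    Integrable.fintype_prod fun _ => integrable_norm_rpow_unitAddCircle hb1
  have hsing : (volume : Measure UnitAddCircle) {0} = 0 := by
    rw [← Metric.closedBall_zero, AddCircle.volume_closedBall]
    simp
  have hne : ∀ i, ∀ᵐ z : T3, z i ≠ 0 := fun i =>
    compl_mem_ae_iff.2 (Measure.pi_eval_preimage_null
      (μ := fun _ : Fin 3 => (volume : Measure UnitAddCircle)) (i := i) hsing)
  refine lt_of_le_of_lt (lintegral_mono_ae ?_) hint.2
  filter_upwards [hne 0, hne 1, hne 2] with z h0 h1 h2
  have hz : ∀ i, 0 < ‖z i‖ := fun i => norm_pos_iff.2 (by fin_cases i <;> assumption)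
  have hr : 0 < torusAbs z := (hz 0).trans_le (norm_apply_le_torusAbs z 0)
  rw [Real.enorm_eq_ofReal (Finset.prod_nonneg fun i _ => by positivity),
    ← ENNReal.ofReal_pow (by positivity), ← ENNReal.ofReal_div_of_pos (by positivity)]
  refine ENNReal.ofReal_le_ofReal ?_
  calc (torusAbs z ^ s) ^ 2 / torusAbs z ^ 4 = ∏ _i : Fin 3, torusAbs z ^ (-b) := by
        rw [Finset.prod_const, Finset.card_univ, Fintype.card_fin, ← Real.rpow_natCast,
          ← Real.rpow_natCast (torusAbs z), ← Real.rpow_natCast (torusAbs z ^ (-b)),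
          ← Real.rpow_mul hr.le, ← Real.rpow_mul hr.le, ← Real.rpow_sub hr]
        congr 1
        rw [hb]; push_cast; ring
    _ ≤ ∏ i, ‖z i‖ ^ (-b) := Finset.prod_le_prod (fun i _ => by positivity) fun i _ =>
        Real.rpow_le_rpow_of_nonpos (hz i) (norm_apply_le_torusAbs z i) (by linarith)

end

section

variable {f g k : T3 → ℝ} {i j : Fin 3}

/-! ### Besov functions and their mollifications -/

/-- The constant in the bounds of the mollifier `moll`. -/
def mollConst : ℝ := exists_isMollifier.choose

theorem mollConst_nonneg : 0 ≤ mollConst := exists_isMollifier.choose_spec.1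

open Classical in
/-- A family of mollifiers, indexed by the scale `ε ∈ (0, 1]`. -/
def moll (ε : ℝ) : T3 → ℝ :=
  if h : 0 < ε ∧ ε ≤ 1 then (exists_isMollifier.choose_spec.2 ε h.1 h.2).choose else 0

theorem isMollifier_moll {ε : ℝ} (h0 : 0 < ε) (h1 : ε ≤ 1) :
    IsMollifier mollConst ε (moll ε) := by
  rw [moll, dif_pos ⟨h0, h1⟩]
  exact (exists_isMollifier.choose_spec.2 ε h0 h1).choose_spec

/-- `f` lies in the ball of radius `M` of `B^θ_{3,∞}(𝕋³)`. -/
structure IsBesov (θ M : ℝ) (f : T3 → ℝ) : Prop where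
  aesm : AEStronglyMeasurable f
  norm_le : eLpNorm f 3 volume ≤ ENNReal.ofReal M
  increment_le : ∀ z, eLpNorm (fun x => f (x - z) - f x) 3 volume ≤
    ENNReal.ofReal (M * torusAbs z ^ θ)

theorem IsBesov.memLp {θ M : ℝ} (h : IsBesov θ M f) : MemLp f 3 :=
  ⟨h.aesm, h.norm_le.trans_lt ENNReal.ofReal_lt_top⟩

theorem IsBesov.memLp_two {θ M : ℝ} (h : IsBesov θ M f) : MemLp f 2 :=
  h.memLp.mono_exponent (by norm_num)

theorem IsBesov.integrable {θ M : ℝ} (h : IsBesov θ M f) : Integrable f :=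
  h.memLp.integrable (by norm_num)

theorem ofReal_three : ENNReal.ofReal 3 = 3 := by norm_num

theorem IsMollifier.integral_abs {C ε : ℝ} (hk : IsMollifier C ε k) : ∫ z, |k z| = 1 := by
  simp_rw [abs_of_nonneg (hk.nonneg _)]; exact hk.integral_eq_one

theorem IsBesov.increment_le_of_le {ε θ M : ℝ} (hf : IsBesov θ M f) (hθ : 0 ≤ θ) (hM : 0 ≤ M)
    {z : T3} (hz : torusAbs z ≤ ε) :
    eLpNorm (fun x => f (x - z) - f x) 3 volume ≤ ENNReal.ofReal (M * ε ^ θ) :=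
  (hf.increment_le z).trans (ENNReal.ofReal_le_ofReal (mul_le_mul_of_nonneg_left
    (Real.rpow_le_rpow (torusAbs_nonneg z) hz hθ) hM))

theorem IsBesov.eLpNorm_cv_sub_le {ε θ M : ℝ} (hf : IsBesov θ M f) (hθ : 0 ≤ θ) (hM : 0 ≤ M)
    (hg : Continuous g) (hε : ∀ z, ε < torusAbs z → g z = 0) :
    eLpNorm (fun x => cv g f x - (∫ z, g z) * f x) 3 volume ≤
      ENNReal.ofReal ((∫ z, |g z|) * (M * ε ^ θ)) := by
  rw [← ofReal_three, ENNReal.ofReal_mul (integral_nonneg fun _ => abs_nonneg _)]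
  refine EulerHelicity.eLpNorm_cv_sub_le (by norm_num) hg hf.integrable fun z hz => ?_
  rw [ofReal_three]
  exact hf.increment_le_of_le hθ hM (not_lt.1 fun h => hz (hε z h))

theorem IsMollifier.eLpNorm_cv_sub_le {C ε θ M : ℝ} (hk : IsMollifier C ε k) (hf : IsBesov θ M f)
    (hθ : 0 ≤ θ) (hM : 0 ≤ M) :
    eLpNorm (fun x => cv k f x - f x) 3 volume ≤ ENNReal.ofReal (M * ε ^ θ) := by
  have := hf.eLpNorm_cv_sub_le hθ hM hk.smooth.continuous hk.eq_zero
  simpa only [hk.integral_eq_one, hk.integral_abs, one_mul] using this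

theorem IsMollifier.eLpNorm_pd_cv_le {C ε θ M : ℝ} (hk : IsMollifier C ε k) (hε : 0 < ε)
    (hf : IsBesov θ M f) (hθ : 0 ≤ θ) (hM : 0 ≤ M) (i : Fin 3) :
    eLpNorm (pd i (cv k f)) 3 volume ≤ ENNReal.ofReal (C / ε * (M * ε ^ θ)) := by
  have := hf.eLpNorm_cv_sub_le hθ hM (hk.smooth.pd i).continuous (hk.pd_eq_zero i)
  simp only [integral_pd hk.smooth, zero_mul, sub_zero, ← pd_cv hk.smooth hf.integrable] at this
  refine this.trans (ENNReal.ofReal_le_ofReal ?_)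
  have := hk.integral_abs_pd i
  gcongr

theorem IsMollifier.eLpNorm_pd_pd_cv_le {C ε θ M : ℝ} (hk : IsMollifier C ε k) (hε : 0 < ε)
    (hf : IsBesov θ M f) (hθ : 0 ≤ θ) (hM : 0 ≤ M) (i j : Fin 3) :
    eLpNorm (pd j (pd i (cv k f))) 3 volume ≤ ENNReal.ofReal (C / ε ^ 2 * (M * ε ^ θ)) := by
  have h := hf.eLpNorm_cv_sub_le hθ hM ((hk.smooth.pd i).pd j).continuous (hk.pd_pd_eq_zero i j)
  have h1 : pd i (cv k f) = cv (pd i k) f := funext (pd_cv hk.smooth hf.integrable i)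
  simp only [integral_pd (hk.smooth.pd i), zero_mul, sub_zero,
    ← pd_cv (hk.smooth.pd i) hf.integrable] at h
  rw [h1]
  refine h.trans (ENNReal.ofReal_le_ofReal ?_)
  have := hk.integral_abs_pd_pd i j
  gcongr

/-- The mollifications of `f` converge to `f` in `L²` at the rate `a ε^α`, and their gradients grow
at most like `a ε^(α-1)`. -/
structure MollRate (a α : ℝ) (f : T3 → ℝ) : Prop where
  integrable : Integrable f
  sub_le : ∀ ε, 0 < ε → ε ≤ 1 →
    eLpNorm (fun x => cv (moll ε) f x - f x) 2 volume ≤ ENNReal.ofReal (a * ε ^ α)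
  pd_le : ∀ ε, 0 < ε → ε ≤ 1 → ∀ i,
    eLpNorm (pd i (cv (moll ε) f)) 2 volume ≤ ENNReal.ofReal (a * ε ^ (α - 1))

/-- The torus has measure one, so the `L³` bounds imply the `L²` bounds with the same constants. -/
theorem IsBesov.mollRate {θ M : ℝ} (hf : IsBesov θ M f) (hθ : 0 ≤ θ) (hM : 0 ≤ M) :
    MollRate ((1 + mollConst) * M) θ f := by
  have hC := mollConst_nonneg
  refine ⟨hf.integrable, fun ε h0 h1 => ?_, fun ε h0 h1 i => ?_⟩
  · have hk := isMollifier_moll h0 h1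
    refine ((eLpNorm_le_eLpNorm_of_exponent_le (by norm_num)
      ((hk.smooth.cv hf.integrable).continuous.aestronglyMeasurable.sub hf.aesm)).trans
      (hk.eLpNorm_cv_sub_le hf hθ hM)).trans (ENNReal.ofReal_le_ofReal ?_)
    gcongr
    nlinarith
  · have hk := isMollifier_moll h0 h1
    refine ((eLpNorm_le_eLpNorm_of_exponent_le (by norm_num)
      ((hk.smooth.cv hf.integrable).pd i).continuous.aestronglyMeasurable).trans
      (hk.eLpNorm_pd_cv_le h0 hf hθ hM i)).trans (ENNReal.ofReal_le_ofReal ?_)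
    rw [Real.rpow_sub h0, Real.rpow_one]
    have : 0 ≤ ε ^ θ := by positivity
    calc mollConst / ε * (M * ε ^ θ) = mollConst * M * (ε ^ θ / ε) := by ring
      _ ≤ _ := by gcongr; linarith

/-- The squared errors are at most `ε⁴ G` times `∫ k² ≲ ε⁻³` or `∫ (∂ᵢ k)² ≲ ε⁻⁵`, that is, of order
`ε` and `ε⁻¹`: rate `1/2`. -/
theorem mollRate_of_gagliardo (hf : Integrable f) (hG : gagliardo f ≠ ⊤) :
    MollRate √(mollConst * (gagliardo f).toReal) (1 / 2) f := by
  have hC := mollConst_nonneg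
  set G := (gagliardo f).toReal with hGdef
  have hG0 : 0 ≤ G := ENNReal.toReal_nonneg
  have hGe : gagliardo f = ENNReal.ofReal G := (ENNReal.ofReal_toReal hG).symm
  have key : ∀ {g : T3 → ℝ} {ε A : ℝ} (_ : 0 ≤ A) (_ : Continuous g)
      (_ : ∀ z, ε < torusAbs z → g z = 0) (_ : (∫ z, g z ^ 2) * ε ^ 4 * G ≤ A ^ 2),
      eLpNorm (fun x => cv g f x - (∫ z, g z) * f x) 2 volume ≤ ENNReal.ofReal A := by
    intro g ε A hA hg hε hle
    refine (ENNReal.pow_right_strictMono two_ne_zero).le_iff_le.1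
      ((eLpNorm_cv_sub_sq_le hg hε hf).trans ?_)
    rw [hGe, ← ENNReal.ofReal_mul (mul_nonneg (integral_nonneg fun _ => sq_nonneg _)
      (by positivity)), ← ENNReal.ofReal_pow hA]
    exact ENNReal.ofReal_le_ofReal hle
  refine ⟨hf, fun ε h0 h1 => ?_, fun ε h0 h1 i => ?_⟩
  · have hk := isMollifier_moll h0 h1
    have := key (A := √(mollConst * G) * ε ^ (1 / 2 : ℝ)) (by positivity) hk.smooth.continuous
      hk.eq_zero (by
        rw [mul_pow, Real.sq_sqrt (by positivity), ← Real.rpow_natCast (ε ^ (1 / 2 : ℝ)),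
          ← Real.rpow_mul h0.le]
        norm_num
        have := hk.integral_sq
        calc _ ≤ mollConst / ε ^ 3 * ε ^ 4 * G := by gcongr
          _ = _ := by field_simp)
    simpa only [hk.integral_eq_one, one_mul] using this
  · have hk := isMollifier_moll h0 h1
    have := key (A := √(mollConst * G) * ε ^ (1 / 2 - 1 : ℝ)) (by positivity)
      (hk.smooth.pd i).continuous (hk.pd_eq_zero i) (by
        rw [mul_pow, Real.sq_sqrt (by positivity), ← Real.rpow_natCast (ε ^ (1 / 2 - 1 : ℝ)),
          ← Real.rpow_mul h0.le]
        norm_num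
        rw [Real.rpow_neg_one]
        have := hk.integral_sq_pd i
        calc _ ≤ mollConst / ε ^ 5 * ε ^ 4 * G := by gcongr
          _ = _ := by field_simp)
    simpa only [integral_pd hk.smooth, zero_mul, sub_zero, ← pd_cv hk.smooth hf] using this

/-! ### Telescoping in the mollification scale -/

theorem abs_integral_mul_le {A B : ℝ} (hA : 0 ≤ A) (hB : 0 ≤ B) (hfm : AEStronglyMeasurable f)
    (hgm : AEStronglyMeasurable g) (hf : eLpNorm f 2 volume ≤ ENNReal.ofReal A)
    (hg : eLpNorm g 2 volume ≤ ENNReal.ofReal B) : |∫ x, f x * g x| ≤ A * B := by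
  have h1 : ∫⁻ x, ‖f x * g x‖ₑ ≤ ENNReal.ofReal (A * B) := by
    rw [ENNReal.ofReal_mul hA]
    refine le_trans ?_ (mul_le_mul' hf hg)
    have := ENNReal.lintegral_mul_le_Lp_mul_Lq volume Real.HolderConjugate.two_two
      hfm.enorm hgm.enorm
    simp_rw [enorm_mul]
    rw [eLpNorm_eq_lintegral_rpow_enorm_toReal (by simp) (by simp),
      eLpNorm_eq_lintegral_rpow_enorm_toReal (by simp) (by simp)]
    exact this
  have h2 := (enorm_integral_le_lintegral_enorm fun x => f x * g x).trans h1
  rw [Real.enorm_eq_ofReal_abs] at h2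
  exact (ENNReal.ofReal_le_ofReal_iff (mul_nonneg hA hB)).1 h2

/-- With `f', g'` at scale `ε/2` and `f, g` at scale `ε`, the difference is `∫ (f' - f) ∂g' + ∫ f
∂(g' - g)`. Integrating the second term by parts puts the derivative on `f`, so each term pairs one
small difference with one gradient. -/
theorem MollRate.abs_pair_sub_le {a b α β : ℝ} (hf : MollRate a α f) (hg : MollRate b β g)
    (ha : 0 ≤ a) (hb : 0 ≤ b) (hα : 0 ≤ α) (hβ : 0 ≤ β) (i : Fin 3) {ε : ℝ} (h0 : 0 < ε)
    (h1 : ε ≤ 1) :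
    |(∫ x, cv (moll (ε / 2)) f x * pd i (cv (moll (ε / 2)) g) x)
      - ∫ x, cv (moll ε) f x * pd i (cv (moll ε) g) x| ≤ 6 * a * b * ε ^ (α + β - 1) := by
  have h0' : 0 < ε / 2 := by positivity
  have h1' : ε / 2 ≤ 1 := by linarith
  have hk := isMollifier_moll h0 h1
  have hk' := isMollifier_moll h0' h1'
  have sf := hk.smooth.cv hf.integrable
  have sf' := hk'.smooth.cv hf.integrable
  have sg := hk.smooth.cv hg.integrable
  have sg' := hk'.smooth.cv hg.integrable
  have hdiff : ∀ {h : T3 → ℝ} {c γ : ℝ}, 0 ≤ c → 0 ≤ γ → MollRate c γ h →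
      eLpNorm (fun x => cv (moll (ε / 2)) h x - cv (moll ε) h x) 2 volume ≤
        ENNReal.ofReal (2 * c * ε ^ γ) := by
    intro h c γ hc hγ hh
    have e : (fun x => cv (moll (ε / 2)) h x - cv (moll ε) h x) =
        (fun x => cv (moll (ε / 2)) h x - h x) - fun x => cv (moll ε) h x - h x := by
      ext x; simp
    rw [e]
    refine (eLpNorm_sub_le
      ((hk'.smooth.cv hh.integrable).continuous.aestronglyMeasurable.sub
        hh.integrable.aestronglyMeasurable)
      ((hk.smooth.cv hh.integrable).continuous.aestronglyMeasurable.sub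
        hh.integrable.aestronglyMeasurable) (by norm_num)).trans ?_
    refine (add_le_add (hh.sub_le _ h0' h1') (hh.sub_le _ h0 h1)).trans ?_
    rw [← ENNReal.ofReal_add (by positivity) (by positivity)]
    refine ENNReal.ofReal_le_ofReal ?_
    have : (ε / 2) ^ γ ≤ ε ^ γ := Real.rpow_le_rpow h0'.le (by linarith) hγ
    nlinarith
  have e1 : (∫ x, cv (moll (ε / 2)) f x * pd i (cv (moll (ε / 2)) g) x)
      - ∫ x, cv (moll ε) f x * pd i (cv (moll ε) g) x =
      (∫ x, (cv (moll (ε / 2)) f x - cv (moll ε) f x) * pd i (cv (moll (ε / 2)) g) x)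
      - ∫ x, (cv (moll (ε / 2)) g x - cv (moll ε) g x) * pd i (cv (moll ε) f) x := by
    have e2 := integral_mul_pd sf (sg'.sub sg) i
    simp_rw [pd_sub sg' sg] at e2
    have e3 : ∫ x, (cv (moll (ε / 2)) g x - cv (moll ε) g x) * pd i (cv (moll ε) f) x =
        ∫ x, pd i (cv (moll ε) f) x * (cv (moll (ε / 2)) g x - cv (moll ε) g x) := by
      simp_rw [mul_comm]
    rw [e3, ← neg_eq_iff_eq_neg.2 e2]
    simp_rw [sub_mul, mul_sub]
    rw [integral_sub (integrable_of_continuous (sf'.mul (sg'.pd i)).continuous)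
      (integrable_of_continuous (sf.mul (sg'.pd i)).continuous),
      integral_sub (integrable_of_continuous (sf.mul (sg'.pd i)).continuous)
      (integrable_of_continuous (sf.mul (sg.pd i)).continuous)]
    ring
  rw [e1]
  refine (abs_sub _ _).trans ?_
  have b1 := abs_integral_mul_le (by positivity) (by positivity)
    (sf'.sub sf).continuous.aestronglyMeasurable (sg'.pd i).continuous.aestronglyMeasurable
    (hdiff ha hα hf) (hg.pd_le _ h0' h1' i)
  have b2 := abs_integral_mul_le (by positivity) (by positivity)
    (sg'.sub sg).continuous.aestronglyMeasurable (sf.pd i).continuous.aestronglyMeasurable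
    (hdiff hb hβ hg) (hf.pd_le _ h0 h1 i)
  refine (add_le_add b1 b2).trans ?_
  -- Halving the scale costs `2^(1-β) ≤ 2`; this makes the total constant `4 + 2 = 6`.
  have hpow : (ε / 2) ^ (β - 1) ≤ 2 * ε ^ (β - 1) := by
    rw [Real.div_rpow h0.le (by norm_num), div_le_iff₀ (by positivity)]
    have : (1 : ℝ) ≤ 2 * 2 ^ (β - 1) := by
      rw [Real.rpow_sub (by norm_num), Real.rpow_one]
      have := Real.one_le_rpow (x := 2) (by norm_num) hβ
      linarith
    have h2 : 0 ≤ ε ^ (β - 1) := by positivity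
    nlinarith
  have hm1 : ε ^ α * ε ^ (β - 1) = ε ^ (α + β - 1) := by
    rw [← Real.rpow_add h0]; ring_nf
  have hm2 : ε ^ β * ε ^ (α - 1) = ε ^ (α + β - 1) := by
    rw [← Real.rpow_add h0]; ring_nf
  calc 2 * a * ε ^ α * (b * (ε / 2) ^ (β - 1)) + 2 * b * ε ^ β * (a * ε ^ (α - 1))
      ≤ 2 * a * ε ^ α * (b * (2 * ε ^ (β - 1))) + 2 * b * ε ^ β * (a * ε ^ (α - 1)) := by gcongr
    _ = 4 * a * b * (ε ^ α * ε ^ (β - 1)) + 2 * a * b * (ε ^ β * ε ^ (α - 1)) := by ring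
    _ = _ := by rw [hm1, hm2]; ring

/-- The sum of the geometric series that controls the telescoping sums. -/
def geomConst (γ : ℝ) : ℝ := 6 / (1 - (1 / 2 : ℝ) ^ γ)

theorem geomConst_nonneg {γ : ℝ} (hγ : 0 < γ) : 0 ≤ geomConst γ :=
  div_nonneg (by norm_num) (sub_nonneg.2 (Real.rpow_le_one (by norm_num) (by norm_num) hγ.le))

/-- Consecutive dyadic scales differ by a geometric sequence of ratio `2^(-γ)`, `γ = α + β - 1 > 0`.
The two rates are independent, so that a Besov function can be paired with one known only to be in
`H^{1/2}`. -/
theorem MollRate.exists_tendsto {a b α β : ℝ} (hf : MollRate a α f) (hg : MollRate b β g)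
    (ha : 0 ≤ a) (hb : 0 ≤ b) (hα : 0 ≤ α) (hβ : 0 ≤ β) (hαβ : 1 < α + β) (i : Fin 3) {ε : ℝ}
    (h0 : 0 < ε) (h1 : ε ≤ 1) :
    ∃ L, Tendsto (fun n : ℕ =>
        ∫ x, cv (moll (ε / 2 ^ n)) f x * pd i (cv (moll (ε / 2 ^ n)) g) x) atTop (𝓝 L) ∧
      |L - ∫ x, cv (moll ε) f x * pd i (cv (moll ε) g) x| ≤
        geomConst (α + β - 1) * (a * b * ε ^ (α + β - 1)) := by
  set γ := α + β - 1 with hγ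
  have hγ0 : 0 < γ := by rw [hγ]; linarith
  set r := (1 / 2 : ℝ) ^ γ with hr
  have hr1 : r < 1 := Real.rpow_lt_one (by norm_num) (by norm_num) hγ0
  set F : ℕ → ℝ := fun n =>
    ∫ x, cv (moll (ε / 2 ^ n)) f x * pd i (cv (moll (ε / 2 ^ n)) g) x with hF
  have hd : ∀ n, dist (F n) (F (n + 1)) ≤ 6 * a * b * ε ^ γ * r ^ n := by
    intro n
    have hp : (1 : ℝ) ≤ 2 ^ n := one_le_pow₀ (by norm_num)
    have h := hf.abs_pair_sub_le hg ha hb hα hβ i (ε := ε / 2 ^ n) (by positivity)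
      ((div_le_self h0.le hp).trans h1)
    have e : ε / 2 ^ n / 2 = ε / 2 ^ (n + 1) := by rw [div_div, pow_succ]
    rw [e] at h
    rw [dist_comm, Real.dist_eq]
    refine h.trans_eq ?_
    rw [← hγ, Real.div_rpow h0.le (by positivity), hr, ← Real.rpow_natCast, ← Real.rpow_mul
      (by norm_num), ← Real.rpow_natCast, ← Real.rpow_mul (by norm_num), one_div,
      Real.inv_rpow (by norm_num), mul_comm γ]
    ring
  obtain ⟨L, hL⟩ := cauchySeq_tendsto_of_complete (cauchySeq_of_le_geometric r _ hr1 hd)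
  refine ⟨L, hL, ?_⟩
  have := dist_le_of_le_geometric_of_tendsto₀ r _ hr1 hd hL
  rw [dist_comm, Real.dist_eq] at this
  simp only [hF, pow_zero, div_one] at this
  refine this.trans_eq ?_
  rw [geomConst]
  ring

end

section

variable {f g k : T3 → ℝ} {i j : Fin 3}

/-! ### The helicity pairing -/

/-- The pairing `∫ a · curl b`, for fields given by their components. -/
def curlPair (a b : Fin 3 → T3 → ℝ) : ℝ :=
  (distPartial 1 (a 2) (b 0) - distPartial 2 (a 1) (b 0))
    + (distPartial 2 (a 0) (b 1) - distPartial 0 (a 2) (b 1))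
    + (distPartial 0 (a 1) (b 2) - distPartial 1 (a 0) (b 2))

/-- Componentwise mollification at scale `ε`. -/
def molF (ε : ℝ) (a : Fin 3 → T3 → ℝ) (i : Fin 3) : T3 → ℝ := cv (moll ε) (a i)

theorem curlPair_exists_tendsto {a b : Fin 3 → T3 → ℝ} {A B α β : ℝ}
    (ha : ∀ i, MollRate A α (a i)) (hb : ∀ i, MollRate B β (b i)) (hA : 0 ≤ A) (hB : 0 ≤ B)
    (hα : 0 ≤ α) (hβ : 0 ≤ β) (hαβ : 1 < α + β) {ε : ℝ} (h0 : 0 < ε) (h1 : ε ≤ 1) :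
    ∃ L, Tendsto (fun n : ℕ => curlPair (molF (ε / 2 ^ n) a) (molF (ε / 2 ^ n) b)) atTop (𝓝 L) ∧
      |L - curlPair (molF ε a) (molF ε b)| ≤
        6 * (geomConst (α + β - 1) * (A * B * ε ^ (α + β - 1))) := by
  have h : ∀ l j i, ∃ L, Tendsto (fun n : ℕ =>
        distPartial i (molF (ε / 2 ^ n) a l) (molF (ε / 2 ^ n) b j)) atTop (𝓝 L) ∧
      |L - distPartial i (molF ε a l) (molF ε b j)| ≤
        geomConst (α + β - 1) * (A * B * ε ^ (α + β - 1)) := by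
    intro l j i
    obtain ⟨L, hL, hL'⟩ := (ha l).exists_tendsto (hb j) hA hB hα hβ hαβ i h0 h1
    refine ⟨-L, hL.neg, ?_⟩
    rw [distPartial, ← abs_neg]
    convert hL' using 2
    simp only [molF]
    ring
  choose L hL hL' using h
  refine ⟨(L 2 0 1 - L 1 0 2) + (L 0 1 2 - L 2 1 0) + (L 1 2 0 - L 0 2 1),
    (((hL 2 0 1).sub (hL 1 0 2)).add ((hL 0 1 2).sub (hL 2 1 0))).add
      ((hL 1 2 0).sub (hL 0 2 1)), ?_⟩
  have e1 := abs_le.1 (hL' 2 0 1)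
  have e2 := abs_le.1 (hL' 1 0 2)
  have e3 := abs_le.1 (hL' 0 1 2)
  have e4 := abs_le.1 (hL' 2 1 0)
  have e5 := abs_le.1 (hL' 1 2 0)
  have e6 := abs_le.1 (hL' 0 2 1)
  rw [curlPair, abs_le]
  constructor <;> linarith

theorem abs_curlPair_le {a b : Fin 3 → T3 → ℝ} {A : ℝ}
    (h : ∀ l j i, |∫ x, a l x * pd i (b j) x| ≤ A) : |curlPair a b| ≤ 6 * A := by
  have e1 := abs_le.1 (h 2 0 1)
  have e2 := abs_le.1 (h 1 0 2)
  have e3 := abs_le.1 (h 0 1 2)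
  have e4 := abs_le.1 (h 2 1 0)
  have e5 := abs_le.1 (h 1 2 0)
  have e6 := abs_le.1 (h 0 2 1)
  simp only [curlPair, distPartial]
  rw [abs_le]
  constructor <;> linarith

/-- Self-adjointness of the mollification rewrites the error as `f_δ - f` tested against `∂ᵢ g` and
its mollification, both bounded by `sup |∂ᵢ g|`. -/
theorem IsBesov.tendsto_distPartial {θ M : ℝ} (hf : IsBesov θ M f) (hθ : 0 < θ) (hM : 0 ≤ M)
    (hg : IsSmooth g) (i : Fin 3) {ε : ℝ} (h0 : 0 < ε) (h1 : ε ≤ 1) :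
    Tendsto (fun n : ℕ => distPartial i (cv (moll (ε / 2 ^ n)) f) (cv (moll (ε / 2 ^ n)) g)) atTop
      (𝓝 (distPartial i f g)) := by
  obtain ⟨B, hB0, hB⟩ := exists_forall_abs_le (hg.pd i).continuous
  have hbd : ∀ δ, 0 < δ → δ ≤ 1 →
      |distPartial i (cv (moll δ) f) (cv (moll δ) g) - distPartial i f g| ≤
        2 * (M * δ ^ θ * B) := by
    intro δ d0 d1
    have hk := isMollifier_moll d0 d1
    have hk' := hk.smooth.continuous
    have sf := hk.smooth.cv hf.integrable
    have sg := hk.smooth.cv (integrable_of_continuous (hg.pd i).continuous)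
    have hcvB : ∀ x, |cv (moll δ) (pd i g) x| ≤ B := fun x => by
      rw [cv_eq_integral_comp_sub]
      calc |∫ z, moll δ z * pd i g (x - z)| ≤ ∫ z, |moll δ z| * B := by
            refine abs_integral_le_of_abs_le
              ((integrable_of_continuous hk').abs.mul_const B) fun z => ?_
            rw [abs_mul]
            exact mul_le_mul_of_nonneg_left (hB _) (abs_nonneg _)
        _ = B := by rw [integral_mul_const, hk.integral_abs, one_mul]
    have hsub : Integrable fun x => cv (moll δ) f x - f x :=
      (integrable_of_continuous sf.continuous).sub hf.integrable
    have h1n : ∫ x, |cv (moll δ) f x - f x| ≤ M * δ ^ θ := by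
      have h := (eLpNorm_le_eLpNorm_of_exponent_le (p := 1) (q := 3) (by norm_num)
        hsub.aestronglyMeasurable).trans (hk.eLpNorm_cv_sub_le hf hθ.le hM)
      rw [eLpNorm_one_eq_lintegral_enorm] at h
      rw [← ENNReal.ofReal_le_ofReal_iff (by positivity),
        ofReal_integral_eq_lintegral_ofReal hsub.abs (Eventually.of_forall fun _ => abs_nonneg _)]
      simpa only [Real.enorm_eq_ofReal_abs] using h
    have hle : ∀ ψ : T3 → ℝ, (∀ x, |ψ x| ≤ B) →
        |∫ x, (cv (moll δ) f x - f x) * ψ x| ≤ M * δ ^ θ * B := by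
      intro ψ hψ
      calc |∫ x, (cv (moll δ) f x - f x) * ψ x| ≤ ∫ x, |cv (moll δ) f x - f x| * B := by
            refine abs_integral_le_of_abs_le (hsub.abs.mul_const B) fun x => ?_
            rw [abs_mul]
            exact mul_le_mul_of_nonneg_left (hψ x) (abs_nonneg _)
        _ ≤ _ := by rw [integral_mul_const]; gcongr
    have i1 : Integrable fun x => f x * cv (moll δ) (pd i g) x := by
      simp_rw [mul_comm (f _)]
      exact integrable_continuous_mul sg.continuous hf.integrable
    have i2 : Integrable fun x => f x * pd i g x := by
      simp_rw [mul_comm (f _)]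
      exact integrable_continuous_mul (hg.pd i).continuous hf.integrable
    have e : distPartial i (cv (moll δ) f) (cv (moll δ) g) - distPartial i f g =
        -((∫ x, (cv (moll δ) f x - f x) * cv (moll δ) (pd i g) x)
          + ∫ x, (cv (moll δ) f x - f x) * pd i g x) := by
      have e1 := integral_cv_mul hk' hk.even hf.integrable
        (integrable_of_continuous (hg.pd i).continuous)
      simp_rw [distPartial, pd_cv_right hk.smooth hg, sub_mul]
      rw [integral_sub (integrable_of_continuous (sf.mul sg).continuous) i1,
        integral_sub (integrable_of_continuous (sf.mul (hg.pd i)).continuous) i2, e1]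
      ring
    rw [e, abs_neg]
    refine (abs_add_le _ _).trans ?_
    linarith [hle _ hcvB, hle _ hB]
  rw [tendsto_iff_dist_tendsto_zero]
  have hp : ∀ n : ℕ, (1 : ℝ) ≤ 2 ^ n := fun n => one_le_pow₀ (by norm_num)
  refine squeeze_zero (fun _ => dist_nonneg) (fun n => hbd (ε / 2 ^ n)
    (by have := hp n; positivity) ((div_le_self h0.le (hp n)).trans h1)) ?_
  have hlim : Tendsto (fun n : ℕ => ε / 2 ^ n) atTop (𝓝 0) :=
    tendsto_const_nhds.div_atTop (tendsto_pow_atTop_atTop_of_one_lt (by norm_num))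
  have := ((hlim.rpow_const (Or.inr hθ.le)).const_mul M).mul_const B |>.const_mul 2
  simpa [Real.zero_rpow hθ.ne'] using this

theorem MollRate.mono {a b α : ℝ} (h : MollRate a α f) (hab : a ≤ b) : MollRate b α f :=
  ⟨h.integrable, fun ε h0 h1 => (h.sub_le ε h0 h1).trans (ENNReal.ofReal_le_ofReal (by gcongr)),
    fun ε h0 h1 i => (h.pd_le ε h0 h1 i).trans (ENNReal.ofReal_le_ofReal (by gcongr))⟩

theorem gagliardo_apply_le (w : T3 → E3) (i : Fin 3) :
    gagliardo (fun x => w x i) ≤ gagliardo w := by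
  refine lintegral_mono fun x => lintegral_mono fun y => ?_
  gcongr
  have : ‖w x i - w y i‖ ≤ ‖w x - w y‖ := by
    simpa using PiLp.norm_apply_le (w x - w y) i
  exact enorm_le_iff_norm_le.2 this

theorem curlPair_sub_right {a b c : Fin 3 → T3 → ℝ} (ha : ∀ i, IsSmooth (a i))
    (hb : ∀ i, IsSmooth (b i)) (hc : ∀ i, IsSmooth (c i)) :
    curlPair a (fun i x => b i x - c i x) = curlPair a b - curlPair a c := by
  have : ∀ l j i, distPartial i (a l) (fun x => b j x - c j x) =
      distPartial i (a l) (b j) - distPartial i (a l) (c j) := by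
    intro l j i
    simp_rw [distPartial, pd_sub (hb j) (hc j), mul_sub]
    rw [integral_sub (integrable_of_continuous ((ha l).mul ((hb j).pd i)).continuous)
      (integrable_of_continuous ((ha l).mul ((hc j).pd i)).continuous)]
    ring
  simp only [curlPair, this]
  ring

theorem IsSmooth.apply {φ : T3 → E3} (hφ : IsSmooth φ) (i : Fin 3) : IsSmooth fun x => φ x i :=
  contDiff_euclidean.1 hφ i

theorem isSmooth_toLp {a : Fin 3 → T3 → ℝ} (ha : ∀ i, IsSmooth (a i)) :
    IsSmooth (fun x => (WithLp.toLp 2 fun i => a i x : E3)) :=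
  contDiff_euclidean.2 ha

/-- Continuity of the pairing in `H^{1/2}`, with `K` independent of `φ`. The mollified pairings of
`v` with `w = φ - v` converge to `⟨curl v, φ⟩ - L`, and their limit is bounded by the pairing at the
fixed scale `ε` plus the telescoping tail, both linear in the norm of `w`. -/
theorem abs_distCurl_sub_le {θ M : ℝ} (hθ : 1 / 2 < θ) (hM : 0 ≤ M) {v : T3 → E3}
    (hv : ∀ i, IsBesov θ M fun x => v x i) {ε : ℝ} (h0 : 0 < ε) (h1 : ε ≤ 1) {L : ℝ}
    (hL : Tendsto (fun n : ℕ => curlPair (molF (ε / 2 ^ n) fun i x => v x i)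
      (molF (ε / 2 ^ n) fun i x => v x i)) atTop (𝓝 L)) :
    ∃ K, 0 ≤ K ∧ ∀ φ : SmoothField, sobolevHalfNorm (φ.1 - v) ≠ ⊤ →
      |distCurl v φ - L| ≤ K * (sobolevHalfNorm (φ.1 - v)).toReal := by
  have hC := mollConst_nonneg
  have hθ0 : 0 < θ := by linarith
  set A := (1 + mollConst) * M with hA
  have hA0 : 0 ≤ A := by positivity
  have hr : ∀ i, MollRate A θ fun x => v x i := fun i => (hv i).mollRate hθ0.le hM
  refine ⟨(6 * (M * ε ^ (1 / 2 - 1 : ℝ)) + 6 * (geomConst (θ + 1 / 2 - 1) *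
    (A * ε ^ (θ + 1 / 2 - 1)))) * √mollConst, ?_, fun φ hφ => ?_⟩
  · have := geomConst_nonneg (γ := θ + 1 / 2 - 1) (by linarith)
    positivity
  set w : T3 → E3 := φ.1 - v with hw
  set N := (sobolevHalfNorm w).toReal with hN
  have hgag : gagliardo w ^ (1 / 2 : ℝ) ≤ sobolevHalfNorm w := by
    rw [sobolevHalfNorm_eq]; exact le_add_self
  have hgt : gagliardo w ≠ ⊤ := fun h => by
    rw [h, ENNReal.top_rpow_of_pos (by norm_num), top_le_iff] at hgag
    exact hφ hgag
  set B := √mollConst * N with hB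
  have hN0 : 0 ≤ N := ENNReal.toReal_nonneg
  have hB0 : 0 ≤ B := by positivity
  have hφi : ∀ i, IsSmooth fun x => φ.1 x i := fun i => φ.2.apply i
  have hwi : ∀ i, Integrable fun x => w x i := fun i => by
    have : (fun x => w x i) = fun x => φ.1 x i - v x i := by ext x; simp [hw]
    rw [this]
    exact (integrable_of_continuous (hφi i).continuous).sub (hv i).integrable
  have hwr : ∀ i, MollRate B (1 / 2) fun x => w x i := fun i => by
    have h2 := gagliardo_apply_le w i
    refine (mollRate_of_gagliardo (hwi i) (ne_top_of_le_ne_top hgt h2)).mono ?_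
    rw [Real.sqrt_mul hC]
    refine mul_le_mul_of_nonneg_left ?_ (Real.sqrt_nonneg _)
    refine (Real.sqrt_le_sqrt (ENNReal.toReal_mono hgt h2)).trans ?_
    rw [Real.sqrt_eq_rpow, ENNReal.toReal_rpow]
    exact ENNReal.toReal_mono hφ hgag
  obtain ⟨D, hD, hD'⟩ := curlPair_exists_tendsto hr hwr hA0 hB0 hθ0.le (by norm_num)
    (by linarith) h0 h1
  have hp : ∀ n : ℕ, (1 : ℝ) ≤ 2 ^ n := fun n => one_le_pow₀ (by norm_num)
  have hDeq : D = distCurl v φ - L := by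
    refine tendsto_nhds_unique hD ?_
    have t1 : Tendsto (fun n : ℕ => curlPair (molF (ε / 2 ^ n) fun i x => v x i)
        (molF (ε / 2 ^ n) fun i x => φ.1 x i)) atTop (𝓝 (distCurl v φ)) := by
      have t := fun l j i => (hv l).tendsto_distPartial hθ0 hM (hφi j) i h0 h1
      exact (((t 2 0 1).sub (t 1 0 2)).add ((t 0 1 2).sub (t 2 1 0))).add
        ((t 1 2 0).sub (t 0 2 1))
    refine (t1.sub hL).congr fun n => ?_
    have hk := isMollifier_moll (ε := ε / 2 ^ n) (by have := hp n; positivity)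
      ((div_le_self h0.le (hp n)).trans h1)
    have i1 : ∀ i, Integrable fun x => φ.1 x i := fun i =>
      integrable_of_continuous (hφi i).continuous
    rw [← curlPair_sub_right (a := molF (ε / 2 ^ n) fun i x => v x i)
      (b := molF (ε / 2 ^ n) fun i x => φ.1 x i) (c := molF (ε / 2 ^ n) fun i x => v x i)
      (fun i => hk.smooth.cv (hv i).integrable)
      (fun i => hk.smooth.cv (i1 i)) (fun i => hk.smooth.cv (hv i).integrable)]
    congr 1
    ext i x
    simp only [molF, hw]
    rw [← cv_sub hk.smooth.continuous (i1 i) (hv i).integrable]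
    rfl
  rw [← hDeq]
  have hk := isMollifier_moll h0 h1
  -- At a fixed scale, Cauchy–Schwarz is enough: mollification does not increase `‖v‖_{L²}`, and the
  -- gradient of the mollified `w` is of order `ε^(-1/2)`.
  have hbase : |curlPair (molF ε fun i x => v x i) (molF ε fun i x => w x i)| ≤
      6 * (M * (B * ε ^ (1 / 2 - 1 : ℝ))) := by
    refine abs_curlPair_le fun l j i => ?_
    refine abs_integral_mul_le hM (by positivity)
      (hk.smooth.cv (hv l).integrable).continuous.aestronglyMeasurable
      ((hk.smooth.cv (hwi j)).pd i).continuous.aestronglyMeasurable ?_ ((hwr j).pd_le ε h0 h1 i)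
    have h2 := eLpNorm_cv_le (q := 2) (by norm_num) hk.smooth.continuous (hv l).integrable
    rw [hk.integral_abs, ENNReal.ofReal_one, one_mul, ENNReal.ofReal_ofNat] at h2
    exact h2.trans ((eLpNorm_le_eLpNorm_of_exponent_le (by norm_num) (hv l).aesm).trans
      (hv l).norm_le)
  calc |D| = |(D - curlPair (molF ε fun i x => v x i) (molF ε fun i x => w x i)) +
        curlPair (molF ε fun i x => v x i) (molF ε fun i x => w x i)| := by congr 1; ring
    _ ≤ _ := abs_add_le _ _
    _ ≤ _ := add_le_add hD' hbase
    _ = _ := by rw [hB]; ring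

/-! ### Approximation by smooth fields in `H^{1/2}` and existence of the helicity -/

theorem IsMollifier.increment_cv_sub_le {C ε θ s M : ℝ} (hk : IsMollifier C ε k) (hε : 0 < ε)
    (hf : IsBesov θ M f) (hs : 0 < s) (hsθ : s ≤ θ) (hM : 0 ≤ M) (z : T3) :
    eLpNorm (fun x => (cv k f (x - z) - f (x - z)) - (cv k f x - f x)) 3 volume ≤
      ENNReal.ofReal (2 * (M * (ε ^ (θ - s) * torusAbs z ^ s))) := by
  have hθ : 0 ≤ θ := hs.le.trans hsθ
  have hz0 := torusAbs_nonneg z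
  have hc := (hk.smooth.cv hf.integrable).continuous.aestronglyMeasurable (μ := volume)
  have two_ofReal : ∀ a : ℝ, 0 ≤ a →
      ENNReal.ofReal a + ENNReal.ofReal a = ENNReal.ofReal (2 * a) := fun a ha => by
    rw [← ENNReal.ofReal_add ha ha, two_mul]
  -- For shifts below `ε`, use the increments of `f`, giving `|z|^θ ≤ ε^(θ-s) |z|^s`; for larger
  -- shifts, use the approximation error itself, giving `ε^θ ≤ ε^(θ-s) |z|^s`.
  rcases le_total (torusAbs z) ε with hz | hz
  · have e : (fun x => (cv k f (x - z) - f (x - z)) - (cv k f x - f x)) =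
        cv k (fun x => f (x - z) - f x) - fun x => f (x - z) - f x := by
      ext x
      rw [Pi.sub_apply, cv_sub hk.smooth.continuous (hf.integrable.comp_sub_right z) hf.integrable]
      have : cv k (fun x => f (x - z)) x = cv k f (x - z) := by
        rw [cv_eq_integral_comp_sub, cv_eq_integral_comp_sub]
        simp_rw [sub_right_comm]
      rw [this]; ring
    have hi : Integrable fun x => f (x - z) - f x :=
      (hf.integrable.comp_sub_right z).sub hf.integrable
    have h1 := eLpNorm_cv_le (q := 3) (by norm_num) hk.smooth.continuous hi
    rw [hk.integral_abs, ENNReal.ofReal_one, one_mul, ofReal_three] at h1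
    rw [e]
    refine (eLpNorm_sub_le (hk.smooth.cv hi).continuous.aestronglyMeasurable
      hi.aestronglyMeasurable (by norm_num)).trans ?_
    refine (add_le_add (h1.trans (hf.increment_le z)) (hf.increment_le z)).trans ?_
    rw [two_ofReal _ (by positivity)]
    refine ENNReal.ofReal_le_ofReal ?_
    gcongr
    rcases eq_or_lt_of_le hz0 with h | h
    · rw [← h, Real.zero_rpow (hs.trans_le hsθ).ne', Real.zero_rpow hs.ne', mul_zero]
    · calc torusAbs z ^ θ = torusAbs z ^ (θ - s) * torusAbs z ^ s := by
            rw [← Real.rpow_add h]; ring_nf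
        _ ≤ _ := by gcongr
  · have h1 := hk.eLpNorm_cv_sub_le hf hθ hM
    have h2 := eLpNorm_comp_measurePreserving (p := 3) (hc.sub hf.aesm)
      (measurePreserving_sub_right volume z)
    refine (eLpNorm_sub_le (f := fun x => cv k f (x - z) - f (x - z))
      (g := fun x => cv k f x - f x)
      ((hc.sub hf.aesm).comp_measurePreserving (measurePreserving_sub_right volume z))
      (hc.sub hf.aesm) (by norm_num)).trans ?_
    refine (add_le_add (h2.le.trans h1) h1).trans ?_
    rw [two_ofReal _ (by positivity)]
    refine ENNReal.ofReal_le_ofReal ?_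
    gcongr
    calc ε ^ θ = ε ^ (θ - s) * ε ^ s := by rw [← Real.rpow_add hε]; ring_nf
      _ ≤ _ := by gcongr

theorem eLpNorm_le_sum_apply {p : ℝ≥0∞} (hp : 1 ≤ p) {w : T3 → E3}
    (hw : ∀ i, AEStronglyMeasurable fun x => w x i) :
    eLpNorm w p volume ≤ ∑ i, eLpNorm (fun x => w x i) p volume := by
  have h1 : eLpNorm w p volume ≤ eLpNorm (∑ i, fun x => ‖w x i‖) p volume := by
    refine eLpNorm_mono_real fun x => ?_
    rw [Finset.sum_apply, EuclideanSpace.norm_eq]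
    refine Real.sqrt_le_iff.2 ⟨Finset.sum_nonneg fun _ _ => norm_nonneg _, ?_⟩
    exact Finset.sum_sq_le_sq_sum_of_nonneg fun _ _ => norm_nonneg _
  refine h1.trans ((eLpNorm_sum_le (fun i _ => (hw i).norm) hp).trans (le_of_eq ?_))
  simp_rw [eLpNorm_norm]

theorem smoothApprox_neBot {θ M : ℝ} (hθ : 1 / 2 < θ) (hθ1 : θ ≤ 1) (hM : 0 ≤ M) {v : T3 → E3}
    (hv : ∀ i, IsBesov θ M fun x => v x i) : (smoothApprox v).NeBot := by
  have hθ0 : 0 < θ := by linarith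
  -- `s > 1/2` keeps the Gagliardo integral finite, while `s < θ` leaves a factor `ε^(θ-s)` that
  -- tends to zero.
  obtain ⟨s, hs, hsθ⟩ := exists_between hθ
  set ε : ℕ → ℝ := fun n => 1 / 2 ^ n with hε
  have hp : ∀ n : ℕ, (1 : ℝ) ≤ 2 ^ n := fun n => one_le_pow₀ (by norm_num)
  have hε0 : ∀ n, 0 < ε n := fun n => by have := hp n; positivity
  have hk := fun n => isMollifier_moll (hε0 n) (div_le_one_of_le₀ (hp n) (by positivity))
  have hlim : Tendsto ε atTop (𝓝 0) :=
    tendsto_const_nhds.div_atTop (tendsto_pow_atTop_atTop_of_one_lt (by norm_num))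
  set φ : ℕ → SmoothField := fun n =>
    ⟨fun x => WithLp.toLp 2 fun i => cv (moll (ε n)) (fun x => v x i) x,
      isSmooth_toLp fun i => (hk n).smooth.cv (hv i).integrable⟩ with hφ
  have hφa : ∀ n i x, ((φ n).1 - v) x i = cv (moll (ε n)) (fun x => v x i) x - v x i :=
    fun n i x => rfl
  have hmi : ∀ n i, AEStronglyMeasurable fun x => ((φ n).1 - v) x i := fun n i =>
    ((hk n).smooth.cv (hv i).integrable).continuous.aestronglyMeasurable.sub (hv i).aesm
  have hm : ∀ n, AEStronglyMeasurable ((φ n).1 - v) := fun n => by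
    refine (φ n).2.continuous.aestronglyMeasurable.sub ?_
    have h1 : AEMeasurable (fun x => (v x).ofLp) :=
      aemeasurable_pi_iff.2 fun i => (hv i).aesm.aemeasurable
    exact ((MeasurableEquiv.toLp 2 (Fin 3 → ℝ)).measurable.comp_aemeasurable
      h1).aestronglyMeasurable
  have hbound : ∀ n, sobolevHalfNorm ((φ n).1 - v) ≤ ENNReal.ofReal (3 * (M * ε n ^ θ)) +
      (ENNReal.ofReal (6 * (M * ε n ^ (θ - s))) ^ 2 * gagliardoConst s) ^ (1 / 2 : ℝ) := by
    intro n
    have hεn := hε0 n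
    rw [sobolevHalfNorm_eq]
    gcongr
    · refine (eLpNorm_le_sum_apply (by norm_num) (hmi n)).trans ?_
      calc _ ≤ ∑ _i : Fin 3, ENNReal.ofReal (M * ε n ^ θ) := Finset.sum_le_sum fun i _ =>
            (eLpNorm_le_eLpNorm_of_exponent_le (by norm_num) (hmi n i)).trans
              ((hk n).eLpNorm_cv_sub_le (hv i) hθ0.le hM)
        _ = _ := by
            rw [Finset.sum_const, Finset.card_univ, Fintype.card_fin, nsmul_eq_mul,
              ← ENNReal.ofReal_natCast, ← ENNReal.ofReal_mul (by norm_num)]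
            norm_num
    · refine gagliardo_le (hm n) (by positivity) fun z => ?_
      have hmz : ∀ i, AEStronglyMeasurable fun x => (((φ n).1 - v) (x - z) - ((φ n).1 - v) x) i :=
        fun i => aestronglyMeasurable_translate_sub (hmi n i) z
      refine (eLpNorm_le_sum_apply (by norm_num) hmz).trans ?_
      calc _ ≤ ∑ _i : Fin 3, ENNReal.ofReal (2 * (M * (ε n ^ (θ - s) * torusAbs z ^ s))) :=
            Finset.sum_le_sum fun i _ =>
            (eLpNorm_le_eLpNorm_of_exponent_le (by norm_num) (hmz i)).trans
              ((hk n).increment_cv_sub_le (hε0 n) (hv i) (by linarith) hsθ.le hM z)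
        _ = _ := by
            rw [Finset.sum_const, Finset.card_univ, Fintype.card_fin, nsmul_eq_mul,
              ← ENNReal.ofReal_natCast, ← ENNReal.ofReal_mul (by norm_num)]
            congr 1
            push_cast
            ring
  have hgc := (gagliardoConst_lt_top hs (by linarith)).ne
  have htend : Tendsto (fun n => sobolevHalfNorm ((φ n).1 - v)) atTop (𝓝 0) := by
    refine tendsto_of_tendsto_of_tendsto_of_le_of_le tendsto_const_nhds ?_
      (fun _ => zero_le) hbound
    have r : ∀ (c γ : ℝ), 0 < γ →
        Tendsto (fun n => ENNReal.ofReal (c * (M * ε n ^ γ))) atTop (𝓝 0) := by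
      intro c γ hγ
      have h1 := ((hlim.rpow_const (p := γ) (Or.inr hγ.le)).const_mul M).const_mul c
      rw [Real.zero_rpow hγ.ne', mul_zero, mul_zero] at h1
      simpa using ENNReal.tendsto_ofReal h1
    have h2 : Tendsto (fun n => (ENNReal.ofReal (6 * (M * ε n ^ (θ - s))) ^ 2 *
        gagliardoConst s) ^ (1 / 2 : ℝ)) atTop (𝓝 0) := by
      have h3 := ENNReal.Tendsto.mul_const (b := gagliardoConst s)
        (ENNReal.Tendsto.pow (n := 2) (r 6 (θ - s) (by linarith))) (Or.inr hgc)
      have h4 := h3.ennrpow_const (1 / 2)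
      simpa using h4
    simpa using (r 3 θ hθ0).add h2
  exact (tendsto_comap_iff.2 htend : Tendsto φ atTop (smoothApprox v)).neBot

theorem exists_hasHelicity {θ M : ℝ} (hθ : 1 / 2 < θ) (hθ1 : θ ≤ 1) (hM : 0 ≤ M) {v : T3 → E3}
    (hv : ∀ i, IsBesov θ M fun x => v x i) {ε : ℝ} (h0 : 0 < ε) (h1 : ε ≤ 1) :
    ∃ L, HasHelicity v L ∧
      |L - curlPair (molF ε fun i x => v x i) (molF ε fun i x => v x i)| ≤
        6 * (geomConst (2 * θ - 1) * (((1 + mollConst) * M) ^ 2 * ε ^ (2 * θ - 1))) := by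
  have hC := mollConst_nonneg
  have hθ0 : 0 ≤ θ := by linarith
  have hr : ∀ i, MollRate ((1 + mollConst) * M) θ fun x => v x i := fun i =>
    (hv i).mollRate hθ0 hM
  obtain ⟨L, hL, hL'⟩ := curlPair_exists_tendsto hr hr (by positivity) (by positivity) hθ0 hθ0
    (by linarith) h0 h1
  refine ⟨L, ⟨smoothApprox_neBot hθ hθ1 hM hv, ?_⟩, ?_⟩
  · obtain ⟨K, hK0, hK⟩ := abs_distCurl_sub_le hθ hM hv h0 h1 hL
    have t0 : Tendsto (fun φ : SmoothField => sobolevHalfNorm (φ.1 - v)) (smoothApprox v) (𝓝 0) :=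
      tendsto_comap
    have t1 : Tendsto (fun φ : SmoothField => K * (sobolevHalfNorm (φ.1 - v)).toReal)
        (smoothApprox v) (𝓝 0) := by
      simpa using ((ENNReal.tendsto_toReal ENNReal.zero_ne_top).comp t0).const_mul K
    rw [tendsto_iff_dist_tendsto_zero]
    refine squeeze_zero' (Eventually.of_forall fun _ => dist_nonneg) ?_ t1
    filter_upwards [t0.eventually (gt_mem_nhds ENNReal.zero_lt_top)] with φ hφ
    exact hK φ hφ.ne
  · convert hL' using 3
    · ring_nf
    · rw [← sq]; ring_nf

/-- A priori the dyadic limit depends on the starting scale; uniqueness of limits along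
`smoothApprox v` identifies all of them with `helicity v`. -/
theorem helicity_spec {θ M : ℝ} (hθ : 1 / 2 < θ) (hθ1 : θ ≤ 1) (hM : 0 ≤ M) {v : T3 → E3}
    (hv : ∀ i, IsBesov θ M fun x => v x i) :
    HasHelicity v (helicity v) ∧ ∀ ε, 0 < ε → ε ≤ 1 →
      |helicity v - curlPair (molF ε fun i x => v x i) (molF ε fun i x => v x i)| ≤
        6 * (geomConst (2 * θ - 1) * (((1 + mollConst) * M) ^ 2 * ε ^ (2 * θ - 1))) := by
  have key : ∀ ε, 0 < ε → ε ≤ 1 → HasHelicity v (helicity v) ∧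
      |helicity v - curlPair (molF ε fun i x => v x i) (molF ε fun i x => v x i)| ≤
        6 * (geomConst (2 * θ - 1) * (((1 + mollConst) * M) ^ 2 * ε ^ (2 * θ - 1))) := by
    intro ε h0 h1
    obtain ⟨L, hL, hL'⟩ := exists_hasHelicity hθ hθ1 hM hv h0 h1
    have := hL.1
    have : helicity v = L := hL.2.limUnder_eq
    rw [this]
    exact ⟨hL, hL'⟩
  exact ⟨(key 1 one_pos le_rfl).1, fun ε h0 h1 => (key ε h0 h1).2⟩

end

section

variable {f g k : T3 → ℝ} {i j : Fin 3}

theorem integrable_fun_sub {α : Type*} [MeasurableSpace α] {μ : Measure α} {f g : α → ℝ}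
    (hf : Integrable f μ) (hg : Integrable g μ) : Integrable (fun x => f x - g x) μ :=
  hf.sub hg

/-! ### Vector calculus -/

/-- The curl of a field given by its components. -/
def curlF (a : Fin 3 → T3 → ℝ) : Fin 3 → T3 → ℝ :=
  ![fun x => pd 1 (a 2) x - pd 2 (a 1) x, fun x => pd 2 (a 0) x - pd 0 (a 2) x,
    fun x => pd 0 (a 1) x - pd 1 (a 0) x]

theorem isSmooth_curlF {a : Fin 3 → T3 → ℝ} (ha : ∀ i, IsSmooth (a i)) (i : Fin 3) :
    IsSmooth (curlF a i) := by
  fin_cases i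
  · exact ((ha 2).pd 1).sub ((ha 1).pd 2)
  · exact ((ha 0).pd 2).sub ((ha 2).pd 0)
  · exact ((ha 1).pd 0).sub ((ha 0).pd 1)

theorem pd_curlF {a : Fin 3 → T3 → ℝ} (ha : ∀ i, IsSmooth (a i)) (j : Fin 3) (x : T3) :
    pd j (curlF a 0) x = pd j (pd 1 (a 2)) x - pd j (pd 2 (a 1)) x ∧
    pd j (curlF a 1) x = pd j (pd 2 (a 0)) x - pd j (pd 0 (a 2)) x ∧
    pd j (curlF a 2) x = pd j (pd 0 (a 1)) x - pd j (pd 1 (a 0)) x :=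
  ⟨pd_sub ((ha 2).pd 1) ((ha 1).pd 2) j x, pd_sub ((ha 0).pd 2) ((ha 2).pd 0) j x,
    pd_sub ((ha 1).pd 0) ((ha 0).pd 1) j x⟩

theorem div_curlF {a : Fin 3 → T3 → ℝ} (ha : ∀ i, IsSmooth (a i)) (x : T3) :
    ∑ i, pd i (curlF a i) x = 0 := by
  rw [Fin.sum_univ_three, (pd_curlF ha 0 x).1, (pd_curlF ha 1 x).2.1, (pd_curlF ha 2 x).2.2,
    pd_comm (ha 2) 0 1, pd_comm (ha 1) 0 2, pd_comm (ha 0) 1 2]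
  ring

theorem curlPair_eq_integral {a b : Fin 3 → T3 → ℝ} (ha : ∀ i, Integrable (a i))
    (hb : ∀ i, IsSmooth (b i)) : curlPair a b = ∫ x, ∑ i, a i x * curlF b i x := by
  have h : ∀ l j i, Integrable fun x => a l x * pd i (b j) x := fun l j i => by
    simp_rw [mul_comm (a l _)]
    exact integrable_continuous_mul ((hb j).pd i).continuous (ha l)
  have e : ∀ x, ∑ i, a i x * curlF b i x =
      (a 0 x * pd 1 (b 2) x - a 0 x * pd 2 (b 1) x) + (a 1 x * pd 2 (b 0) x - a 1 x * pd 0 (b 2) x)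
        + (a 2 x * pd 0 (b 1) x - a 2 x * pd 1 (b 0) x) := by
    intro x
    simp only [Fin.sum_univ_three, curlF, Matrix.cons_val]
    ring
  simp_rw [e]
  have d0 := integrable_fun_sub (h 0 2 1) (h 0 1 2)
  have d1 := integrable_fun_sub (h 1 0 2) (h 1 2 0)
  have d2 := integrable_fun_sub (h 2 1 0) (h 2 0 1)
  rw [integral_add (d0.fun_add d1) d2, integral_add d0 d1,
    integral_sub (h 0 2 1) (h 0 1 2), integral_sub (h 1 0 2) (h 1 2 0),
    integral_sub (h 2 1 0) (h 2 0 1)]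
  simp only [curlPair, distPartial]
  ring

/-- The sign from integration by parts is undone by the antisymmetry of the curl. -/
theorem curlPair_comm {a b : Fin 3 → T3 → ℝ} (ha : ∀ i, IsSmooth (a i))
    (hb : ∀ i, IsSmooth (b i)) : curlPair a b = curlPair b a := by
  have h : ∀ l j i, distPartial i (a l) (b j) = -distPartial i (b j) (a l) := fun l j i => by
    simp only [distPartial]
    rw [integral_mul_pd (ha l) (hb j)]
    simp_rw [mul_comm]
  simp only [curlPair, h]
  ring

/-- Conservation of helicity in the smooth case. With `ω = curl a`, the identity `(a·∇)a = ω × a +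
∇(|a|²/2)` gives `ω · (a·∇)a = ω · ∇(|a|²/2)`. As `a` and `ω` are divergence free, the integrand is
the divergence of `(a·ω) a - ½|a|² ω`, the field `F` below. -/
theorem integral_convection_curl_eq_zero {a : Fin 3 → T3 → ℝ} (ha : ∀ i, IsSmooth (a i))
    (hdiv : ∀ x, ∑ i, pd i (a i) x = 0) :
    ∫ x, ∑ i, ∑ j, a i x * a j x * pd j (curlF a i) x = 0 := by
  have hw := isSmooth_curlF ha
  have hs : IsSmooth fun x => a 0 x * curlF a 0 x + a 1 x * curlF a 1 x + a 2 x * curlF a 2 x :=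
    (((ha 0).mul (hw 0)).add ((ha 1).mul (hw 1))).add ((ha 2).mul (hw 2))
  have hq : IsSmooth fun x => 2⁻¹ * (a 0 x * a 0 x + a 1 x * a 1 x + a 2 x * a 2 x) :=
    (IsSmooth.const _).mul ((((ha 0).mul (ha 0)).add ((ha 1).mul (ha 1))).add ((ha 2).mul (ha 2)))
  set F : Fin 3 → T3 → ℝ := fun j x =>
    a j x * (a 0 x * curlF a 0 x + a 1 x * curlF a 1 x + a 2 x * curlF a 2 x) -
      2⁻¹ * (a 0 x * a 0 x + a 1 x * a 1 x + a 2 x * a 2 x) * curlF a j x with hF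
  have hFs : ∀ j, IsSmooth (F j) := fun j => ((ha j).mul hs).sub (hq.mul (hw j))
  have hpF : ∀ j x, pd j (F j) x =
      pd j (a j) x * (a 0 x * curlF a 0 x + a 1 x * curlF a 1 x + a 2 x * curlF a 2 x)
      + a j x * ((pd j (a 0) x * curlF a 0 x + a 0 x * pd j (curlF a 0) x)
        + (pd j (a 1) x * curlF a 1 x + a 1 x * pd j (curlF a 1) x)
        + (pd j (a 2) x * curlF a 2 x + a 2 x * pd j (curlF a 2) x))
      - ((a 0 x * pd j (a 0) x + a 1 x * pd j (a 1) x + a 2 x * pd j (a 2) x) * curlF a j x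
        + 2⁻¹ * (a 0 x * a 0 x + a 1 x * a 1 x + a 2 x * a 2 x) * pd j (curlF a j) x) := by
    intro j x
    rw [hF]
    dsimp only
    rw [pd_sub ((ha j).mul hs) (hq.mul (hw j)), pd_mul (ha j) hs, pd_mul hq (hw j),
      pd_const_mul ((((ha 0).mul (ha 0)).add ((ha 1).mul (ha 1))).add ((ha 2).mul (ha 2))),
      pd_add (((ha 0).mul (hw 0)).add ((ha 1).mul (hw 1))) ((ha 2).mul (hw 2)),
      pd_add ((ha 0).mul (hw 0)) ((ha 1).mul (hw 1)),
      pd_add (((ha 0).mul (ha 0)).add ((ha 1).mul (ha 1))) ((ha 2).mul (ha 2)),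
      pd_add ((ha 0).mul (ha 0)) ((ha 1).mul (ha 1)), pd_mul (ha 0) (hw 0), pd_mul (ha 1) (hw 1),
      pd_mul (ha 2) (hw 2), pd_mul (ha 0) (ha 0), pd_mul (ha 1) (ha 1), pd_mul (ha 2) (ha 2)]
    ring
  have e : ∀ x, ∑ i, ∑ j, a i x * a j x * pd j (curlF a i) x = ∑ j, pd j (F j) x := by
    intro x
    have d1 := hdiv x
    have d2 := div_curlF ha x
    have c0 : curlF a 0 x = pd 1 (a 2) x - pd 2 (a 1) x := rfl
    have c1 : curlF a 1 x = pd 2 (a 0) x - pd 0 (a 2) x := rfl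
    have c2 : curlF a 2 x = pd 0 (a 1) x - pd 1 (a 0) x := rfl
    simp only [Fin.sum_univ_three] at d1 d2 ⊢
    simp only [hpF, c0, c1, c2]
    -- The identity holds modulo `div a = 0` and `div ω = 0`, with coefficients `-(a·ω)` and
    -- `½|a|²`.
    linear_combination (-(a 0 x * (pd 1 (a 2) x - pd 2 (a 1) x)
      + a 1 x * (pd 2 (a 0) x - pd 0 (a 2) x) + a 2 x * (pd 0 (a 1) x - pd 1 (a 0) x))) * d1
      + 2⁻¹ * (a 0 x * a 0 x + a 1 x * a 1 x + a 2 x * a 2 x) * d2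
  simp_rw [e]
  rw [integral_finsetSum _ fun j _ => integrable_of_continuous ((hFs j).pd j).continuous]
  simp [integral_pd (hFs _)]

/-! ### The commutator estimate -/

theorem lintegral_mul_mul_le {f g h : T3 → ℝ} (hf : AEStronglyMeasurable f)
    (hg : AEStronglyMeasurable g) (hh : AEStronglyMeasurable h) :
    ∫⁻ x, ‖f x‖ₑ * ‖g x‖ₑ * ‖h x‖ₑ ≤
      eLpNorm f 3 volume * eLpNorm g 3 volume * eLpNorm h 3 volume := by
  have := ENNReal.lintegral_prod_norm_pow_le (μ := (volume : Measure T3)) Finset.univ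
    (f := ![fun x => ‖f x‖ₑ ^ (3 : ℝ), fun x => ‖g x‖ₑ ^ (3 : ℝ), fun x => ‖h x‖ₑ ^ (3 : ℝ)])
    (by
      intro i _
      fin_cases i
      exacts [hf.enorm.pow_const _, hg.enorm.pow_const _, hh.enorm.pow_const _])
    (p := fun _ => 1 / 3) (by norm_num) (by norm_num)
  simp only [Fin.prod_univ_three, Matrix.cons_val, ← ENNReal.rpow_mul] at this
  norm_num at this
  simp only [eLpNorm_eq_lintegral_rpow_enorm_toReal (p := 3) (by norm_num) (by norm_num)]
  norm_num
  exact this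

/-- The Constantin–E–Titi identity: the commutator `(fg)_ε - f_ε g_ε` is quadratic in increments,
hence of order `ε^(2θ)` rather than `ε^θ`. -/
theorem cv_mul_eq (hk : Continuous k) (h1 : ∫ z, k z = 1) (hf : MemLp f 2) (hg : MemLp g 2)
    (x : T3) :
    cv k (fun y => f y * g y) x = cv k f x * cv k g x
      + (∫ z, k z * ((f (x - z) - f x) * (g (x - z) - g x)))
      - (cv k f x - f x) * (cv k g x - g x) := by
  have hfi := (hf.integrable (by norm_num)).comp_sub_left x
  have hgi := (hg.integrable (by norm_num)).comp_sub_left x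
  have hfg : Integrable fun z => f (x - z) * g (x - z) :=
    (hf.integrable_mul hg).comp_sub_left x
  have i1 := integrable_continuous_mul hk hfg
  have i2 := (integrable_continuous_mul hk hfi).mul_const (g x)
  have i3 := (integrable_continuous_mul hk hgi).mul_const (f x)
  have i4 := (integrable_of_continuous hk).mul_const (f x * g x)
  have e : ∀ z, k z * ((f (x - z) - f x) * (g (x - z) - g x)) =
      k z * (f (x - z) * g (x - z)) - k z * f (x - z) * g x - k z * g (x - z) * f x
        + k z * (f x * g x) := fun z => by ring
  simp_rw [e]
  have i12 := integrable_fun_sub i1 i2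
  rw [integral_add (integrable_fun_sub i12 i3) i4, integral_sub i12 i3, integral_sub i1 i2,
    integral_mul_const, integral_mul_const, integral_mul_const, h1]
  simp only [cv_eq_integral_comp_sub]
  ring

theorem IsMollifier.abs_integral_commutator_le {C ε θ M B : ℝ} (hk : IsMollifier C ε k)
    (hε : 0 < ε) (hf : IsBesov θ M f) (hg : IsBesov θ M g) (hθ : 0 ≤ θ) (hM : 0 ≤ M) (hB : 0 ≤ B)
    {h : T3 → ℝ} (hh : Continuous h) (hhB : eLpNorm h 3 volume ≤ ENNReal.ofReal B) :
    |∫ x, (cv k (fun y => f y * g y) x - cv k f x * cv k g x) * h x| ≤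
      2 * ((M * ε ^ θ) * (M * ε ^ θ) * B) := by
  set A := M * ε ^ θ with hA
  have hA0 : 0 ≤ A := by positivity
  have hkc := hk.smooth.continuous
  have hdf := aestronglyMeasurable_increment hf.aesm
  have hdg := aestronglyMeasurable_increment hg.aesm
  have hhm := hh.aestronglyMeasurable (μ := (volume : Measure T3))
  have mf : AEStronglyMeasurable fun x => cv k f x - f x :=
    (hk.smooth.cv hf.integrable).continuous.aestronglyMeasurable.sub hf.aesm
  have mg : AEStronglyMeasurable fun x => cv k g x - g x :=
    (hk.smooth.cv hg.integrable).continuous.aestronglyMeasurable.sub hg.aesm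
  -- Integrating in `x` first at fixed `z` allows Hölder with exponents `3, 3, 3`; the kernel then
  -- has total mass one.
  have h1 : ∫⁻ x, ∫⁻ z, ‖k z‖ₑ * (‖f (x - z) - f x‖ₑ * ‖g (x - z) - g x‖ₑ * ‖h x‖ₑ) ≤
      ENNReal.ofReal (A * A * B) := by
    rw [lintegral_lintegral_swap ((hkc.enorm.measurable.comp measurable_snd).aemeasurable.mul
      ((hdf.enorm.mul hdg.enorm).mul (hhm.comp_fst).enorm))]
    calc _ ≤ ∫⁻ z, ‖k z‖ₑ * ENNReal.ofReal (A * A * B) := by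
          refine lintegral_mono fun z => ?_
          have m1 := aestronglyMeasurable_translate_sub hf.aesm z
          have m2 := aestronglyMeasurable_translate_sub hg.aesm z
          have m3 : AEMeasurable fun x => ‖f (x - z) - f x‖ₑ * ‖g (x - z) - g x‖ₑ * ‖h x‖ₑ :=
            (m1.enorm.mul m2.enorm).mul hhm.enorm
          rw [lintegral_const_mul'' _ m3]
          by_cases hz : k z = 0
          · simp [hz]
          have hz' : torusAbs z ≤ ε := not_lt.1 fun h => hz (hk.eq_zero z h)
          gcongr
          refine (lintegral_mul_mul_le m1 m2 hhm).trans ?_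
          rw [ENNReal.ofReal_mul (by positivity), ENNReal.ofReal_mul hA0]
          gcongr
          · exact hf.increment_le_of_le hθ hM hz'
          · exact hg.increment_le_of_le hθ hM hz'
      _ = _ := by
          rw [lintegral_mul_const _ hkc.enorm.measurable, ← ofReal_integral_abs hkc,
            hk.integral_abs, ENNReal.ofReal_one, one_mul]
  have h2 : ∫⁻ x, ‖cv k f x - f x‖ₑ * ‖cv k g x - g x‖ₑ * ‖h x‖ₑ ≤
      ENNReal.ofReal (A * A * B) := by
    refine (lintegral_mul_mul_le mf mg hhm).trans ?_
    rw [ENNReal.ofReal_mul (by positivity), ENNReal.ofReal_mul hA0]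
    gcongr
    · exact hk.eLpNorm_cv_sub_le hf hθ hM
    · exact hk.eLpNorm_cv_sub_le hg hθ hM
  have h3 : ‖∫ x, (cv k (fun y => f y * g y) x - cv k f x * cv k g x) * h x‖ₑ ≤
      ENNReal.ofReal (2 * (A * A * B)) := by
    calc _ ≤ ∫⁻ x, ‖(cv k (fun y => f y * g y) x - cv k f x * cv k g x) * h x‖ₑ :=
          enorm_integral_le_lintegral_enorm _
      _ ≤ ∫⁻ x, ((∫⁻ z, ‖k z‖ₑ * (‖f (x - z) - f x‖ₑ * ‖g (x - z) - g x‖ₑ * ‖h x‖ₑ))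
          + ‖cv k f x - f x‖ₑ * ‖cv k g x - g x‖ₑ * ‖h x‖ₑ) := by
          refine lintegral_mono fun x => ?_
          have e : cv k (fun y => f y * g y) x - cv k f x * cv k g x =
              (∫ z, k z * ((f (x - z) - f x) * (g (x - z) - g x)))
                - (cv k f x - f x) * (cv k g x - g x) := by
            rw [cv_mul_eq hkc hk.integral_eq_one hf.memLp_two hg.memLp_two]; ring
          dsimp only
          rw [e, enorm_mul]
          refine (mul_le_mul_left (enorm_sub_le (E := ℝ)) _).trans ?_
          rw [add_mul, enorm_mul]
          gcongr
          refine (mul_le_mul_left (enorm_integral_le_lintegral_enorm _) _).trans ?_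
          rw [← lintegral_mul_const' _ _ enorm_ne_top]
          refine lintegral_mono fun z => le_of_eq ?_
          simp only [enorm_mul]
          ring
      _ = _ := lintegral_add_right' _ ((mf.enorm.mul mg.enorm).mul hhm.enorm)
      _ ≤ _ := add_le_add h1 h2
      _ = _ := by rw [← ENNReal.ofReal_add (by positivity) (by positivity), two_mul]
  rw [Real.enorm_eq_ofReal_abs] at h3
  exact (ENNReal.ofReal_le_ofReal_iff (by positivity)).1 h3

/-- A field with components in `B^θ_{3,∞}` which is weakly divergence free. -/
structure IsBesovSolenoidal (θ M : ℝ) (v : Fin 3 → T3 → ℝ) : Prop where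
  besov : ∀ i, IsBesov θ M (v i)
  div_free : ∀ ψ : T3 → ℝ, IsSmooth ψ → ∫ x, ∑ i, v i x * pd i ψ x = 0

/-- Test the weak divergence condition with `y ↦ k (x - y)`. -/
theorem IsBesovSolenoidal.div_cv_eq_zero {θ M : ℝ} {v : Fin 3 → T3 → ℝ}
    (hv : IsBesovSolenoidal θ M v) (hk : IsSmooth k) (x : T3) : ∑ i, pd i (cv k (v i)) x = 0 := by
  have h := hv.div_free _ (hk.comp_sub_left x)
  simp_rw [pd_comp_sub_left hk] at h
  rw [integral_finsetSum _ fun i _ => by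
    simp_rw [mul_comm (v i _)]
    exact (integrable_cv_integrand (k := fun y => -pd i k y) (hk.pd i).continuous.neg
      (hv.besov i).integrable x)] at h
  simp_rw [pd_cv hk (hv.besov _).integrable, cv]
  rw [← neg_eq_zero, ← Finset.sum_neg_distrib, ← h]
  refine Finset.sum_congr rfl fun i _ => ?_
  rw [← integral_neg]
  congr 1
  ext y
  ring

/-- The flux `∫ v ⊗ v : ∇Φ`. -/
def flux (v Φ : Fin 3 → T3 → ℝ) : ℝ := ∫ x, ∑ i, ∑ j, v i x * v j x * pd j (Φ i) x

/-- The test field `k ∗ curl (k ∗ v)`. -/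
def testF (k : T3 → ℝ) (v : Fin 3 → T3 → ℝ) (i : Fin 3) : T3 → ℝ :=
  cv k (curlF (fun l => cv k (v l)) i)

theorem IsMollifier.eLpNorm_pd_curlF_le {C ε θ M : ℝ} (hk : IsMollifier C ε k) (hε : 0 < ε)
    {v : Fin 3 → T3 → ℝ} (hv : ∀ i, IsBesov θ M (v i)) (hθ : 0 ≤ θ) (hM : 0 ≤ M) (hC : 0 ≤ C)
    (i j : Fin 3) : eLpNorm (pd j (curlF (fun l => cv k (v l)) i)) 3 volume ≤
      ENNReal.ofReal (2 * (C / ε ^ 2 * (M * ε ^ θ))) := by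
  have ha : ∀ l, IsSmooth (cv k (v l)) := fun l => hk.smooth.cv (hv l).integrable
  have key : ∀ a b a' b' : Fin 3,
      eLpNorm (fun x => pd j (pd a (cv k (v b))) x - pd j (pd a' (cv k (v b'))) x) 3 volume ≤
        ENNReal.ofReal (2 * (C / ε ^ 2 * (M * ε ^ θ))) := by
    intro a b a' b'
    refine (eLpNorm_sub_le (((ha b).pd a).pd j).continuous.aestronglyMeasurable
      (((ha b').pd a').pd j).continuous.aestronglyMeasurable (by norm_num)).trans ?_
    refine (add_le_add (hk.eLpNorm_pd_pd_cv_le hε (hv b) hθ hM a j)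
      (hk.eLpNorm_pd_pd_cv_le hε (hv b') hθ hM a' j)).trans_eq ?_
    rw [← ENNReal.ofReal_add (by positivity) (by positivity), two_mul]
  fin_cases i
  · exact (eLpNorm_congr_ae (Eventually.of_forall fun x => (pd_curlF ha j x).1)).trans_le
      (key 1 2 2 1)
  · exact (eLpNorm_congr_ae (Eventually.of_forall fun x => (pd_curlF ha j x).2.1)).trans_le
      (key 2 0 0 2)
  · exact (eLpNorm_congr_ae (Eventually.of_forall fun x => (pd_curlF ha j x).2.2)).trans_le
      (key 0 1 1 0)

theorem integrable_mul_mul {Φ : T3 → ℝ} (hf : MemLp f 2) (hg : MemLp g 2) (hΦ : Continuous Φ) :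
    Integrable fun x => f x * g x * Φ x := by
  have hfg : Integrable fun x => f x * g x := hf.integrable_mul hg
  have := integrable_continuous_mul hΦ hfg
  simpa only [mul_comm (Φ _)] using this

theorem flux_eq_sum {v Φ : Fin 3 → T3 → ℝ} (hv : ∀ i, MemLp (v i) 2) (hΦ : ∀ i, IsSmooth (Φ i)) :
    flux v Φ = ∑ i, ∑ j, ∫ x, v i x * v j x * pd j (Φ i) x := by
  have hi : ∀ i j, Integrable fun x => v i x * v j x * pd j (Φ i) x := fun i j =>
    integrable_mul_mul (hv i) (hv j) ((hΦ i).pd j).continuous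
  rw [flux, integral_finsetSum _ fun i _ => integrable_finsetSum _ fun j _ => hi i j]
  exact Finset.sum_congr rfl fun i _ => integral_finsetSum _ fun j _ => hi i j

/-- Moving one mollification onto `v ⊗ v` turns the flux into that of the smooth field `k ∗ v`,
which vanishes, plus the commutator tested against `∇ curl (k ∗ v)`. The exponent is `θ + θ + (θ -
2)`. -/
theorem IsMollifier.abs_flux_testF_le {C ε θ M : ℝ} (hk : IsMollifier C ε k) (hε : 0 < ε)
    {v : Fin 3 → T3 → ℝ} (hv : IsBesovSolenoidal θ M v) (hθ : 0 ≤ θ) (hM : 0 ≤ M) (hC : 0 ≤ C) :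
    |flux v (testF k v)| ≤ 36 * (C * M ^ 3 * ε ^ (3 * θ - 2)) := by
  set a : Fin 3 → T3 → ℝ := fun l => cv k (v l) with ha'
  have ha : ∀ l, IsSmooth (a l) := fun l => hk.smooth.cv (hv.besov l).integrable
  have hw := isSmooth_curlF ha
  have hvv : ∀ i j, Integrable fun x => v i x * v j x := fun i j =>
    (hv.besov i).memLp_two.integrable_mul (hv.besov j).memLp_two
  have hT : ∀ i, IsSmooth (testF k v i) := fun i =>
    hk.smooth.cv (integrable_of_continuous (hw i).continuous)
  have e1 : ∀ i j, ∫ x, v i x * v j x * pd j (testF k v i) x =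
      (∫ x, (cv k (fun y => v i y * v j y) x - a i x * a j x) * pd j (curlF a i) x)
        + ∫ x, a i x * a j x * pd j (curlF a i) x := by
    intro i j
    have i1 : Integrable fun x => (cv k (fun y => v i y * v j y) x - a i x * a j x) *
        pd j (curlF a i) x :=
      integrable_of_continuous ((((hk.smooth.cv (hvv i j)).sub ((ha i).mul (ha j))).mul
        ((hw i).pd j)).continuous)
    have i2 : Integrable fun x => a i x * a j x * pd j (curlF a i) x :=
      integrable_of_continuous (((ha i).mul (ha j)).mul ((hw i).pd j)).continuous
    rw [← integral_add i1 i2]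
    have h1 : ∀ x, pd j (testF k v i) x = cv k (pd j (curlF a i)) x := fun x =>
      pd_cv_right hk.smooth (hw i) j x
    simp_rw [h1]
    rw [← integral_cv_mul hk.smooth.continuous hk.even (hvv i j)
      (integrable_of_continuous ((hw i).pd j).continuous)]
    congr 1
    ext x
    ring
  have e2 : ∑ i, ∑ j, ∫ x, a i x * a j x * pd j (curlF a i) x = 0 := by
    have hm : ∀ i, MemLp (a i) 2 := fun i => (ha i).continuous.memLp_of_hasCompactSupport
      (HasCompactSupport.of_compactSpace _)
    rw [← flux_eq_sum hm hw]
    exact integral_convection_curl_eq_zero ha (hv.div_cv_eq_zero hk.smooth)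
  rw [flux_eq_sum (fun i => (hv.besov i).memLp_two) hT]
  simp_rw [e1, Finset.sum_add_distrib]
  rw [e2, add_zero]
  -- The factor `4` is two parts of the commutator times two second derivatives in a component of `∇
  -- curl`; the nine pairs `(i, j)` then give `36`.
  have hb : ∀ i j, |∫ x, (cv k (fun y => v i y * v j y) x - a i x * a j x) *
      pd j (curlF a i) x| ≤ 4 * (C * M ^ 3 * ε ^ (3 * θ - 2)) := by
    intro i j
    refine (hk.abs_integral_commutator_le hε (hv.besov i) (hv.besov j) hθ hM (by positivity)
      ((hw i).pd j).continuous (hk.eLpNorm_pd_curlF_le hε hv.besov hθ hM hC i j)).trans_eq ?_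
    have : ε ^ (3 * θ - 2) = ε ^ θ * ε ^ θ * ε ^ θ / ε ^ 2 := by
      rw [Real.rpow_sub hε, Real.rpow_ofNat, ← Real.rpow_add hε, ← Real.rpow_add hε]
      ring_nf
    rw [this]
    ring
  calc _ ≤ ∑ i : Fin 3, ∑ j : Fin 3, 4 * (C * M ^ 3 * ε ^ (3 * θ - 2)) :=
        (Finset.abs_sum_le_sum_abs _ _).trans (Finset.sum_le_sum fun i _ =>
          (Finset.abs_sum_le_sum_abs _ _).trans (Finset.sum_le_sum fun j _ => hb i j))
    _ = _ := by simp; ring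

end

section


/-! ### Weak derivatives on an interval -/

theorem exists_Icc_of_isCompact {K : Set ℝ} {a b : ℝ} (hK : IsCompact K) (hne : K.Nonempty)
    (hKab : K ⊆ Ioo a b) : ∃ a' b', a < a' ∧ a' ≤ b' ∧ b' < b ∧ K ⊆ Icc a' b' := by
  obtain ⟨a', ha', hl⟩ := hK.exists_isLeast hne
  obtain ⟨b', hb', hg⟩ := hK.exists_isGreatest hne
  exact ⟨a', b', (hKab ha').1, hl hb', (hKab hb').2, fun x hx => ⟨hl hx, hg hx⟩⟩

/-- A smooth function with zero mean supported in an interval is the derivative of a smooth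
function supported in that interval. -/
theorem exists_primitive {a b : ℝ} {h : ℝ → ℝ} (hh : ContDiff ℝ ∞ h) {a' b' : ℝ} (ha : a < a')
    (hb : b' < b) (hsupp : ∀ x, x ∉ Icc a' b' → h x = 0) (h0 : ∫ x, h x = 0) :
    ∃ η : ℝ → ℝ, ContDiff ℝ ∞ η ∧ HasCompactSupport η ∧ tsupport η ⊆ Ioo a b ∧
      ∀ x, deriv η x = h x := by
  set η : ℝ → ℝ := fun x => ∫ y in a..x, h y with hη
  have hd : ∀ x, HasDerivAt η (h x) x := fun x =>
    intervalIntegral.integral_hasDerivAt_right (hh.continuous.intervalIntegrable _ _)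
      (hh.continuous.stronglyMeasurableAtFilter _ _) hh.continuous.continuousAt
  have hde : deriv η = h := funext fun x => (hd x).deriv
  have hs : Function.support η ⊆ Icc a' b' := by
    intro x hx
    by_contra hx'
    apply hx
    rcases lt_or_ge x a' with h1 | h1
    · rw [hη]
      dsimp only
      refine intervalIntegral.integral_zero_ae (Eventually.of_forall fun y hy => hsupp y ?_)
      intro hy'
      have := hy.2
      rcases le_max_iff.1 this with h2 | h2 <;> linarith [hy'.1]
    · have h2 : b' < x := by
        by_contra h2
        exact hx' ⟨h1, not_lt.1 h2⟩
      rw [hη]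
      dsimp only
      rw [intervalIntegral.integral_eq_integral_of_support_subset, h0]
      intro y hy
      have hy' : y ∈ Icc a' b' := by
        by_contra hc
        exact hy (hsupp y hc)
      exact ⟨by linarith [hy'.1], by linarith [hy'.2]⟩
  have ht : tsupport η ⊆ Icc a' b' := closure_minimal hs isClosed_Icc
  refine ⟨η, ?_, ?_, ht.trans fun x hx => ⟨by linarith [hx.1], by linarith [hx.2]⟩,
    fun x => (hd x).deriv⟩
  · rw [contDiff_infty_iff_deriv, hde]
    exact ⟨fun x => (hd x).differentiableAt, hh⟩
  · exact isCompact_Icc.of_isClosed_subset (isClosed_tsupport _) ht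

theorem exists_contDiff_integral_eq_one {a b : ℝ} (hab : a < b) :
    ∃ ρ : ℝ → ℝ, ContDiff ℝ ∞ ρ ∧ HasCompactSupport ρ ∧ tsupport ρ ⊆ Ioo a b ∧ ∫ x, ρ x = 1 := by
  set c := (a + b) / 2
  set r := (b - a) / 4 with hr
  have hr0 : 0 < r := by rw [hr]; linarith
  let f : ContDiffBump c := ⟨r / 2, r, by linarith, by linarith⟩
  refine ⟨f.normed volume, f.contDiff_normed, f.hasCompactSupport_normed, ?_, f.integral_normed⟩
  rw [f.tsupport_normed_eq, Real.closedBall_eq_Icc]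
  change Icc (c - r) (c + r) ⊆ _
  intro x hx
  have h1 := hx.1
  have h2 := hx.2
  simp only [hr, c] at h1 h2
  constructor <;> linarith

theorem integrable_contDiff_mul {g c : ℝ → ℝ} {U : Set ℝ} (hg : Continuous g)
    (hgc : HasCompactSupport g) (hgU : tsupport g ⊆ U) (hc : LocallyIntegrableOn c U) :
    Integrable fun x => g x * c x := by
  have h1 : IntegrableOn c (tsupport g) := hc.integrableOn_compact_subset hgU hgc
  have h2 : IntegrableOn (fun x => g x * c x) (tsupport g) :=
    IntegrableOn.continuousOn_mul hg.continuousOn h1 hgc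
  refine (integrableOn_iff_integrable_of_support_subset ?_).1 h2
  intro x hx
  apply subset_tsupport
  intro h
  exact hx (by simp [h])

/-- The du Bois-Reymond lemma. -/
theorem exists_ae_eq_const {c : ℝ → ℝ} {a b : ℝ} (hab : a < b)
    (hc : LocallyIntegrableOn c (Ioo a b))
    (h : ∀ η : ℝ → ℝ, ContDiff ℝ ∞ η → HasCompactSupport η → tsupport η ⊆ Ioo a b →
      ∫ x, deriv η x * c x = 0) :
    ∃ m, ∀ᵐ x, x ∈ Ioo a b → c x = m := by
  -- Subtracting `(∫ g) ρ` from a test function `g` leaves mean zero, hence the derivative of a test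
  -- function; the constant is therefore `∫ ρ c`.
  obtain ⟨ρ, hρ, hρc, hρs, hρ1⟩ := exists_contDiff_integral_eq_one hab
  have hρi : Integrable fun x => ρ x * c x := integrable_contDiff_mul hρ.continuous hρc hρs hc
  refine ⟨∫ x, ρ x * c x, ?_⟩
  set m := ∫ x, ρ x * c x with hm
  have key := isOpen_Ioo.ae_eq_zero_of_integral_contDiff_smul_eq_zero (f := fun x => c x - m)
    (μ := volume) (U := Ioo a b) (hc.sub (locallyIntegrableOn_const _)) ?_
  · filter_upwards [key] with x hx hxI
    linarith [hx hxI]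
  intro g hg hgc hgs
  have hgi : Integrable fun x => g x * c x := integrable_contDiff_mul hg.continuous hgc hgs hc
  have hgI : Integrable g := hg.continuous.integrable_of_hasCompactSupport hgc
  have hρI : Integrable ρ := hρ.continuous.integrable_of_hasCompactSupport hρc
  set G := ∫ x, g x with hG
  have hne : (tsupport g ∪ tsupport ρ).Nonempty := by
    refine Nonempty.inr ?_
    by_contra hne
    rw [not_nonempty_iff_eq_empty, tsupport_eq_empty_iff] at hne
    rw [hne] at hρ1
    simp at hρ1
  obtain ⟨a', b', ha', -, hb', hK⟩ :=
    exists_Icc_of_isCompact (hgc.isCompact.union hρc.isCompact) hne (union_subset hgs hρs)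
  have hmean : ∫ x, (g x - G * ρ x) = 0 := by
    rw [integral_sub hgI (hρI.const_mul G), integral_const_mul, hρ1]
    ring
  obtain ⟨η, hη, hηc, hηs, hηd⟩ := exists_primitive (h := fun x => g x - G * ρ x)
    (hg.sub (contDiff_const.mul hρ)) ha' hb' (fun x hx => by
      have h1 : x ∉ tsupport g := fun h => hx (hK (Or.inl h))
      have h2 : x ∉ tsupport ρ := fun h => hx (hK (Or.inr h))
      simp [image_eq_zero_of_notMem_tsupport h1, image_eq_zero_of_notMem_tsupport h2]) hmean
  have h0 := h η hη hηc hηs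
  simp_rw [hηd, sub_mul, mul_assoc] at h0
  rw [integral_sub hgi (hρi.const_mul G), integral_const_mul, ← hm] at h0
  simp_rw [smul_eq_mul, mul_sub]
  rw [integral_sub hgi (hgI.mul_const m), integral_mul_const, ← hG]
  exact h0

/-- A function with an integrable weak derivative is a.e. equal to an indefinite integral. -/
theorem exists_ae_eq_const_add_integral {a b : ℝ → ℝ} {T : ℝ} (hT : 0 < T)
    (ha : IntegrableOn a (Ioo 0 T)) (hb : IntegrableOn b (Ioo 0 T))
    (h : ∀ η : ℝ → ℝ, ContDiff ℝ ∞ η → HasCompactSupport η → tsupport η ⊆ Ioo 0 T →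
      ∫ t in Ioo 0 T, (deriv η t * a t + η t * b t) = 0) :
    ∃ m, ∀ᵐ t, t ∈ Ioo 0 T → a t = m + ∫ r in 0..t, b r := by
  have hbi : IntervalIntegrable b volume 0 T := by
    rw [intervalIntegrable_iff_integrableOn_Ioo_of_le hT.le]
    exact hb
  set B : ℝ → ℝ := fun t => ∫ r in 0..t, b r with hB
  have hBac : AbsolutelyContinuousOnInterval B 0 T :=
    hbi.absolutelyContinuousOnInterval_intervalIntegral left_mem_uIcc
  have hBc : ContinuousOn B (Icc 0 T) := by
    rw [← uIcc_of_le hT.le]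
    exact hBac.continuousOn
  have hBi : IntegrableOn B (Ioo 0 T) :=
    (hBc.integrableOn_compact isCompact_Icc).mono_set Ioo_subset_Icc_self
  have hderiv := hbi.ae_hasDerivAt_integral
  have hz : ∀ η : ℝ → ℝ, ContDiff ℝ ∞ η → HasCompactSupport η → tsupport η ⊆ Ioo 0 T →
      ∫ t, deriv η t * (a t - B t) = 0 := by
    intro η hη hηc hηs
    have hη' : Continuous (deriv η) := hη.continuous_deriv (by simp)
    have hs' : tsupport (deriv η) ⊆ Ioo 0 T := tsupport_deriv_subset.trans hηs
    have e1 : ∫ t, deriv η t * (a t - B t) = ∫ t in Ioo 0 T, deriv η t * (a t - B t) := by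
      rw [setIntegral_eq_integral_of_forall_compl_eq_zero]
      intro t ht
      rw [image_eq_zero_of_notMem_tsupport fun h => ht (hs' h), zero_mul]
    have i1 : IntegrableOn (fun t => deriv η t * a t) (Ioo 0 T) :=
      (integrable_contDiff_mul hη' hηc.deriv hs' ha.locallyIntegrableOn).integrableOn
    have i2 : IntegrableOn (fun t => deriv η t * B t) (Ioo 0 T) :=
      (integrable_contDiff_mul hη' hηc.deriv hs' hBi.locallyIntegrableOn).integrableOn
    have i3 : IntegrableOn (fun t => η t * b t) (Ioo 0 T) :=
      (integrable_contDiff_mul hη.continuous hηc hηs hb.locallyIntegrableOn).integrableOn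
    have hηz : ∀ t, t ∉ Ioo 0 T → η t = 0 := fun t ht =>
      image_eq_zero_of_notMem_tsupport fun h => ht (hηs h)
    -- `B` is only absolutely continuous, with derivative `b` almost everywhere; this suffices for
    -- integration by parts, and `η` vanishes at both ends.
    have e2 : ∫ t in Ioo 0 T, deriv η t * B t = -∫ t in Ioo 0 T, η t * b t := by
      have hηac : AbsolutelyContinuousOnInterval η 0 T :=
        (hη.of_le (by simp)).contDiffOn.absolutelyContinuousOnInterval
      have := hηac.integral_mul_deriv_eq_deriv_mul hBac
      rw [hηz 0 (by simp), hηz T (by simp), intervalIntegral.integral_of_le hT.le,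
        intervalIntegral.integral_of_le hT.le, integral_Ioc_eq_integral_Ioo,
        integral_Ioc_eq_integral_Ioo] at this
      have e3 : ∫ t in Ioo 0 T, η t * deriv B t = ∫ t in Ioo 0 T, η t * b t := by
        refine setIntegral_congr_ae measurableSet_Ioo ?_
        filter_upwards [hderiv] with t ht htI
        rw [(ht (by rw [uIcc_of_le hT.le]; exact Ioo_subset_Icc_self htI) 0 left_mem_uIcc).deriv]
      rw [e3] at this
      linarith
    have h0 := h η hη hηc hηs
    rw [integral_add i1 i3] at h0
    rw [e1]
    simp_rw [mul_sub]
    rw [integral_sub i1 i2, e2]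
    linarith
  obtain ⟨m, hm⟩ := exists_ae_eq_const (c := fun t => a t - B t) hT
    (IntegrableOn.locallyIntegrableOn (integrable_fun_sub ha hBi)) hz
  refine ⟨m, ?_⟩
  filter_upwards [hm] with t ht htI
  linarith [ht htI]

/-! ### Hölder functions on the line -/

/-- On a dense set, a quadratic error in a Lipschitz bound can be dropped. -/
theorem abs_sub_le_of_quadratic {f : ℝ → ℝ} {G I : Set ℝ} {A L : ℝ} (hI : Convex ℝ I)
    (hGI : G ⊆ I) (hG : I ⊆ closure G)
    (h : ∀ s ∈ G, ∀ t ∈ G, |f t - f s| ≤ A * |t - s| + L * |t - s| ^ 2) :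
    ∀ s ∈ G, ∀ t ∈ G, |f t - f s| ≤ A * |t - s| := by
  have key : ∀ n : ℕ, ∀ s ∈ G, ∀ t ∈ G,
      |f t - f s| ≤ A * |t - s| + L * |t - s| ^ 2 * (1 / 2) ^ n := by
    intro n
    induction n with
    | zero => simpa using h
    | succ n ih =>
      intro s hs t ht
      -- Bisection halves the quadratic error, but the midpoint need not lie in `G`. The inequality
      -- is closed in the intermediate point `m` and does not involve `f m`, so it passes from `G`
      -- to its closure.
      have hcl : IsClosed {m : ℝ | |f t - f s| ≤ A * (|t - m| + |m - s|)
          + L * (|t - m| ^ 2 + |m - s| ^ 2) * (1 / 2) ^ n} :=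
        isClosed_le continuous_const (by fun_prop)
      have hsub : closure G ⊆ {m : ℝ | |f t - f s| ≤ A * (|t - m| + |m - s|)
          + L * (|t - m| ^ 2 + |m - s| ^ 2) * (1 / 2) ^ n} := by
        refine closure_minimal (fun m hm => ?_) hcl
        have h1 := ih m hm t ht
        have h2 := ih s hs m hm
        have h3 := abs_sub_le (f t) (f m) (f s)
        simp only [mem_ofPred_eq]
        linarith
      have hmid : (1 / 2 : ℝ) • s + (1 / 2 : ℝ) • t ∈ I :=
        hI (hGI hs) (hGI ht) (by norm_num) (by norm_num) (by norm_num)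
      have := hsub (hG hmid)
      simp only [mem_ofPred_eq, smul_eq_mul] at this
      have e1 : |t - (1 / 2 * s + 1 / 2 * t)| = |t - s| / 2 := by
        rw [show t - (1 / 2 * s + 1 / 2 * t) = (t - s) / 2 by ring, abs_div, abs_two]
      have e2 : |1 / 2 * s + 1 / 2 * t - s| = |t - s| / 2 := by
        rw [show 1 / 2 * s + 1 / 2 * t - s = (t - s) / 2 by ring, abs_div, abs_two]
      rw [e1, e2] at this
      refine this.trans_eq ?_
      ring
  intro s hs t ht
  have hlim : Tendsto (fun n : ℕ => A * |t - s| + L * |t - s| ^ 2 * (1 / 2 : ℝ) ^ n) atTop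
      (𝓝 (A * |t - s| + L * |t - s| ^ 2 * 0)) :=
    ((tendsto_pow_atTop_nhds_zero_of_lt_one (by norm_num) (by norm_num)).const_mul _).const_add _
  have := ge_of_tendsto' hlim fun n => key n s hs t ht
  simpa using this

theorem abs_rpow_le_add {α : ℝ} (h0 : 0 ≤ α) (h1 : α ≤ 1) (x y z : ℝ) :
    |x - z| ^ α ≤ |x - y| ^ α + |y - z| ^ α :=
  (Real.rpow_le_rpow (abs_nonneg _) (abs_sub_le x y z) h0).trans
    (Real.rpow_add_le_add_rpow (abs_nonneg _) (abs_nonneg _) h0 h1)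

/-- A Hölder function on a set extends to a Hölder function on the line. -/
theorem exists_holder_extension {f : ℝ → ℝ} {G : Set ℝ} {K α : ℝ} (hK : 0 ≤ K) (hα : 0 < α)
    (h1 : α ≤ 1) (hG : G.Nonempty) (h : ∀ s ∈ G, ∀ t ∈ G, |f t - f s| ≤ K * |t - s| ^ α) :
    ∃ g : ℝ → ℝ, (∀ s t, |g t - g s| ≤ K * |t - s| ^ α) ∧ ∀ t ∈ G, g t = f t := by
  have h0 := hα.le
  have : Nonempty G := hG.to_subtype
  have hbd : ∀ x : ℝ, BddBelow (range fun t : G => f t + K * |x - t| ^ α) := by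
    intro x
    obtain ⟨t₀, ht₀⟩ := hG
    refine ⟨f t₀ - K * |t₀ - x| ^ α, ?_⟩
    rintro _ ⟨t, rfl⟩
    have h2 := (abs_le.1 (h t t.2 t₀ ht₀)).2
    have h3 := mul_le_mul_of_nonneg_left (abs_rpow_le_add h0 h1 t₀ x t) hK
    dsimp only
    linarith
  have hle : ∀ x y : ℝ, (⨅ t : G, f t + K * |x - t| ^ α) ≤
      (⨅ t : G, f t + K * |y - t| ^ α) + K * |x - y| ^ α := by
    intro x y
    rw [← sub_le_iff_le_add]
    refine le_ciInf fun t => ?_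
    have h3 := mul_le_mul_of_nonneg_left (abs_rpow_le_add h0 h1 x y t) hK
    have := ciInf_le (hbd x) t
    linarith
  -- McShane's extension, for the metric `|x - y|^α`; the triangle inequality requires `α ≤ 1`.
  refine ⟨fun x => ⨅ t : G, f t + K * |x - t| ^ α, fun s t => ?_, fun t ht => ?_⟩
  · have h2 := hle s t
    rw [abs_sub_comm] at h2
    exact abs_sub_le_iff.2 ⟨by linarith [hle t s], by linarith⟩
  · refine le_antisymm ?_ (le_ciInf fun s => ?_)
    · refine (ciInf_le (hbd t) ⟨t, ht⟩).trans ?_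
      simp [Real.zero_rpow hα.ne']
    · linarith [(abs_le.1 (h s s.2 t ht)).2]

/-- A Hölder function that is locally constant off a set of small dimension is constant. -/
theorem eq_of_dimH_lt {f : ℝ → ℝ} {T K α : ℝ} {S : Set ℝ} (hK : 0 ≤ K) (hα : 0 < α)
    (h : ∀ s t, |f t - f s| ≤ K * |t - s| ^ α)
    (hloc : ∀ x ∈ Ioo 0 T, x ∉ S → ∃ U ∈ 𝓝 x, ∃ m, ∀ y ∈ U, f y = m)
    (hS : dimH S < ENNReal.ofReal α) {s t : ℝ} (hs : s ∈ Ioo 0 T) (ht : t ∈ Ioo 0 T) :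
    f s = f t := by
  have hH : HolderWith K.toNNReal α.toNNReal f := by
    intro x y
    rw [edist_dist, edist_dist, Real.dist_eq, Real.dist_eq, ENNReal.ofReal_rpow_of_nonneg
      (abs_nonneg _) (by positivity), ← ENNReal.ofReal, ← ENNReal.ofReal_mul hK]
    simpa [Real.coe_toNNReal _ hα.le] using ENNReal.ofReal_le_ofReal (h y x)
  have hα' : 0 < α.toNNReal := Real.toNNReal_pos.2 hα
  -- An `α`-Hölder map multiplies dimension by at most `1/α`.
  have hd1 : dimH (f '' S) < 1 := by
    refine (hH.dimH_image_le hα' S).trans_lt ?_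
    rw [ENNReal.div_lt_iff (Or.inl (by simpa using hα)) (Or.inl ENNReal.coe_ne_top), one_mul]
    exact hS
  -- By the Lindelöf property, countably many neighbourhoods of constancy cover the complement of
  -- `S`.
  have hcount : (f '' (Ioo 0 T \ S)).Countable := by
    choose! U hU m hm using hloc
    obtain ⟨c, hcs, hcc, hcov⟩ := TopologicalSpace.countable_cover_nhdsWithin
      (s := Ioo 0 T \ S) (f := U) fun x hx => mem_nhdsWithin_of_mem_nhds (hU x hx.1 hx.2)
    refine (hcc.image m).mono ?_
    rintro _ ⟨x, hx, rfl⟩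
    obtain ⟨y, hy, hxy⟩ := mem_iUnion₂.1 (hcov hx)
    exact ⟨y, hy, (hm y (hcs hy).1 (hcs hy).2 x hxy).symm⟩
  have hd : dimH (f '' Ioo 0 T) < 1 := by
    have hsub : f '' Ioo 0 T ⊆ f '' S ∪ f '' (Ioo 0 T \ S) := by
      rw [← image_union]
      refine image_mono fun x hx => ?_
      by_cases hxS : x ∈ S
      · exact Or.inl hxS
      · exact Or.inr ⟨hx, hxS⟩
    refine (dimH_mono hsub).trans_lt ?_
    rw [dimH_union, dimH_countable hcount]
    simpa using hd1
  -- The image of the interval is connected: two distinct values would force it to contain a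
  -- segment, of dimension one.
  by_contra hne
  have hfc : Continuous f := hH.continuous hα'
  have hconv : (f '' Ioo 0 T).OrdConnected :=
    (isPreconnected_Ioo.image f hfc.continuousOn).ordConnected
  have : segment ℝ (f s) (f t) ⊆ f '' Ioo 0 T := by
    rw [segment_eq_uIcc]
    exact hconv.uIcc_subset (mem_image_of_mem f hs) (mem_image_of_mem f ht)
  have h2 := (dimH_mono this).trans_lt hd
  rw [Real.dimH_segment hne] at h2
  exact lt_irrefl _ h2

end

section


variable {k : T3 → ℝ} {θ M T : ℝ}

/-! ### Pairing with smooth solenoidal fields -/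

/-- Smooth divergence-free fields, given by their components. -/
structure IsSolenoidalTest (Φ : Fin 3 → T3 → ℝ) : Prop where
  smooth : ∀ i, IsSmooth (Φ i)
  div_eq_zero : ∀ x, ∑ i, pd i (Φ i) x = 0

/-- The `L²` pairing `∫ v · Φ`. -/
def pairF (v Φ : Fin 3 → T3 → ℝ) : ℝ := ∫ x, ∑ i, v i x * Φ i x

theorem isSolenoidalTest_curlF {a : Fin 3 → T3 → ℝ} (ha : ∀ i, IsSmooth (a i)) :
    IsSolenoidalTest (curlF a) :=
  ⟨isSmooth_curlF ha, div_curlF ha⟩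

theorem isSolenoidalTest_testF {v : Fin 3 → T3 → ℝ} (hk : IsSmooth k)
    (hv : ∀ i, Integrable (v i)) : IsSolenoidalTest (testF k v) := by
  have ha : ∀ l, IsSmooth (cv k (v l)) := fun l => hk.cv (hv l)
  have hw := isSmooth_curlF ha
  refine ⟨fun i => hk.cv (integrable_of_continuous (hw i).continuous), fun x => ?_⟩
  have h : ∀ i, pd i (testF k v i) x =
      ∫ y, k (x - y) * pd i (curlF (fun l => cv k (v l)) i) y := fun i =>
    pd_cv_right hk (hw i) i x
  simp_rw [h]
  rw [← integral_finsetSum _ fun i _ => integrable_cv_integrand hk.continuous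
    (integrable_of_continuous ((hw i).pd i).continuous) x]
  simp_rw [← Finset.mul_sum, div_curlF ha, mul_zero, integral_zero]

/-- Rewrites the mollified helicity as the field itself tested against a smooth solenoidal field,
the form in which the weak equation can be used. -/
theorem curlPair_cv_eq_pairF {v w : Fin 3 → T3 → ℝ} (hk : IsSmooth k)
    (he : ∀ x, k (-x) = k x) (hv : ∀ i, Integrable (v i)) (hw : ∀ i, Integrable (w i)) :
    curlPair (fun i => cv k (v i)) (fun i => cv k (w i)) = pairF v (testF k w) := by
  have hb : ∀ i, IsSmooth (cv k (w i)) := fun i => hk.cv (hw i)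
  have hc := isSmooth_curlF hb
  have hT := (isSolenoidalTest_testF hk hw).smooth
  rw [curlPair_eq_integral (fun i => integrable_of_continuous (hk.cv (hv i)).continuous) hb, pairF,
    integral_finsetSum _ fun i _ => integrable_of_continuous ((hk.cv (hv i)).mul (hc i)).continuous,
    integral_finsetSum _ fun i _ => by
      simp_rw [mul_comm (v i _)]
      exact integrable_continuous_mul (hT i).continuous (hv i)]
  exact Finset.sum_congr rfl fun i _ => integral_cv_mul hk.continuous he (hv i)
    (integrable_of_continuous (hc i).continuous)

theorem pairF_testF_comm {v w : Fin 3 → T3 → ℝ} (hk : IsSmooth k)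
    (he : ∀ x, k (-x) = k x) (hv : ∀ i, Integrable (v i)) (hw : ∀ i, Integrable (w i)) :
    pairF v (testF k w) = pairF w (testF k v) := by
  rw [← curlPair_cv_eq_pairF hk he hv hw, ← curlPair_cv_eq_pairF hk he hw hv,
    curlPair_comm (fun i => hk.cv (hv i)) fun i => hk.cv (hw i)]

theorem IsBesov.eLpNorm_two_le {f : T3 → ℝ} (hf : IsBesov θ M f) :
    eLpNorm f 2 volume ≤ ENNReal.ofReal M :=
  (eLpNorm_le_eLpNorm_of_exponent_le (by norm_num) hf.aesm).trans hf.norm_le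

theorem IsBesov.abs_integral_mul_le {f φ : T3 → ℝ} {δ : ℝ} (hf : IsBesov θ M f) (hM : 0 ≤ M)
    (hφ : Continuous φ) (hδ : ∀ x, |φ x| ≤ δ) : |∫ x, f x * φ x| ≤ M * δ := by
  refine EulerHelicity.abs_integral_mul_le hM ((abs_nonneg _).trans (hδ 0)) hf.aesm
    hφ.aestronglyMeasurable hf.eLpNorm_two_le ?_
  refine (eLpNorm_le_of_ae_bound (Eventually.of_forall hδ)).trans ?_
  simp

theorem IsBesov.abs_integral_mul_mul_le {f g φ : T3 → ℝ} {δ : ℝ} (hf : IsBesov θ M f)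
    (hg : IsBesov θ M g) (hM : 0 ≤ M) (hφ : Continuous φ) (hδ : ∀ x, |φ x| ≤ δ) :
    |∫ x, f x * g x * φ x| ≤ M * (M * δ) := by
  have hδ0 : 0 ≤ δ := (abs_nonneg _).trans (hδ 0)
  simp_rw [mul_assoc]
  refine EulerHelicity.abs_integral_mul_le hM (by positivity) hf.aesm
    (hg.aesm.mul hφ.aestronglyMeasurable) hf.eLpNorm_two_le ?_
  refine (eLpNorm_le_mul_eLpNorm_of_ae_le_mul (g := g) (c := δ) (Eventually.of_forall fun x => ?_)
    2).trans ?_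
  · rw [norm_mul, mul_comm]
    exact mul_le_mul_of_nonneg_right (hδ x) (norm_nonneg _)
  · rw [mul_comm M, ENNReal.ofReal_mul hδ0]
    gcongr
    exact hg.eLpNorm_two_le

theorem pairF_eq_sum {v Φ : Fin 3 → T3 → ℝ} (hv : ∀ i, Integrable (v i))
    (hΦ : ∀ i, Continuous (Φ i)) : pairF v Φ = ∑ i, ∫ x, v i x * Φ i x :=
  integral_finsetSum _ fun i _ => by
    simp_rw [mul_comm (v i _)]
    exact integrable_continuous_mul (hΦ i) (hv i)

theorem abs_pairF_sub_le {v Φ Ψ : Fin 3 → T3 → ℝ} {δ : ℝ} (hv : ∀ i, IsBesov θ M (v i))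
    (hM : 0 ≤ M) (hΦ : ∀ i, Continuous (Φ i)) (hΨ : ∀ i, Continuous (Ψ i))
    (hδ : ∀ i x, |Φ i x - Ψ i x| ≤ δ) : |pairF v Φ - pairF v Ψ| ≤ 3 * (M * δ) := by
  have h : ∀ i, |(∫ x, v i x * Φ i x) - ∫ x, v i x * Ψ i x| ≤ M * δ := by
    intro i
    have i1 : ∀ {φ : T3 → ℝ}, Continuous φ → Integrable fun x => v i x * φ x := fun hφ => by
      simp_rw [mul_comm (v i _)]
      exact integrable_continuous_mul hφ (hv i).integrable
    rw [← integral_sub (i1 (hΦ i)) (i1 (hΨ i))]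
    simp_rw [← mul_sub]
    exact (hv i).abs_integral_mul_le hM ((hΦ i).sub (hΨ i)) (hδ i)
  rw [pairF_eq_sum (fun i => (hv i).integrable) hΦ, pairF_eq_sum (fun i => (hv i).integrable) hΨ,
    ← Finset.sum_sub_distrib]
  refine (Finset.abs_sum_le_sum_abs _ _).trans ((Finset.sum_le_sum fun i _ => h i).trans_eq ?_)
  simp

theorem abs_flux_sub_le {v Φ Ψ : Fin 3 → T3 → ℝ} {δ : ℝ} (hv : ∀ i, IsBesov θ M (v i))
    (hM : 0 ≤ M) (hΦ : ∀ i, IsSmooth (Φ i)) (hΨ : ∀ i, IsSmooth (Ψ i))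
    (hδ : ∀ i j x, |pd j (Φ i) x - pd j (Ψ i) x| ≤ δ) :
    |flux v Φ - flux v Ψ| ≤ 9 * (M * (M * δ)) := by
  have hm : ∀ i, MemLp (v i) 2 := fun i => (hv i).memLp_two
  have h : ∀ i j, |(∫ x, v i x * v j x * pd j (Φ i) x) - ∫ x, v i x * v j x * pd j (Ψ i) x| ≤
      M * (M * δ) := by
    intro i j
    rw [← integral_sub (integrable_mul_mul (hm i) (hm j) ((hΦ i).pd j).continuous)
      (integrable_mul_mul (hm i) (hm j) ((hΨ i).pd j).continuous)]
    simp_rw [← mul_sub]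
    exact (hv i).abs_integral_mul_mul_le (hv j) hM
      (((hΦ i).pd j).sub ((hΨ i).pd j)).continuous (hδ i j)
  rw [flux_eq_sum hm hΦ, flux_eq_sum hm hΨ, ← Finset.sum_sub_distrib]
  simp_rw [← Finset.sum_sub_distrib]
  refine (Finset.abs_sum_le_sum_abs _ _).trans ((Finset.sum_le_sum fun i _ =>
    (Finset.abs_sum_le_sum_abs _ _).trans (Finset.sum_le_sum fun j _ => h i j)).trans_eq ?_)
  simp
  ring

theorem abs_flux_le {v Φ : Fin 3 → T3 → ℝ} {δ : ℝ} (hv : ∀ i, IsBesov θ M (v i))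
    (hM : 0 ≤ M) (hΦ : ∀ i, IsSmooth (Φ i)) (hδ : ∀ i j x, |pd j (Φ i) x| ≤ δ) :
    |flux v Φ| ≤ 9 * (M * (M * δ)) := by
  have := abs_flux_sub_le (Ψ := fun _ _ => 0) hv hM hΦ (fun i => IsSmooth.const 0)
    (δ := δ) (fun i j x => by simpa [pd_const] using hδ i j x)
  simpa [flux, pd_const] using this

theorem exists_forall_abs_pd_le {Φ : Fin 3 → T3 → ℝ} (hΦ : ∀ i, IsSmooth (Φ i)) :
    ∃ C, 0 ≤ C ∧ ∀ i j x, |pd j (Φ i) x| ≤ C := by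
  choose C hC0 hC using fun i j => exists_forall_abs_le ((hΦ i).pd j).continuous
  refine ⟨∑ i, ∑ j, C i j, Finset.sum_nonneg fun i _ => Finset.sum_nonneg fun j _ => hC0 i j,
    fun i j x => (hC i j x).trans ?_⟩
  exact (Finset.single_le_sum (f := fun j => C i j) (fun j _ => hC0 i j) (Finset.mem_univ j)).trans
    (Finset.single_le_sum (f := fun i => ∑ j, C i j)
      (fun i _ => Finset.sum_nonneg fun j _ => hC0 i j) (Finset.mem_univ i))

/-- The smooth solenoidal fields are separable for the `C¹` norm. -/
theorem exists_countable_dense_solenoidal :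
    ∃ Ψ : ℕ → Fin 3 → T3 → ℝ, (∀ n, IsSolenoidalTest (Ψ n)) ∧
      ∀ Φ, IsSolenoidalTest Φ → ∀ δ > 0, ∃ n, (∀ i x, |Φ i x - Ψ n i x| ≤ δ) ∧
        ∀ i j x, |pd j (Φ i) x - pd j (Ψ n i) x| ≤ δ := by
  let S := {Φ : Fin 3 → T3 → ℝ // IsSolenoidalTest Φ}
  let J : S → C(T3, (Fin 3 → ℝ) × (Fin 3 → Fin 3 → ℝ)) := fun Φ =>
    ⟨fun x => (fun i => Φ.1 i x, fun i j => pd j (Φ.1 i) x),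
      (continuous_pi fun i => (Φ.2.smooth i).continuous).prodMk
        (continuous_pi fun i => continuous_pi fun j => ((Φ.2.smooth i).pd j).continuous)⟩
  -- Fields are recorded together with their gradients as continuous maps on a compact space. The
  -- induced topology is second countable, and a dense sequence of the subspace consists of
  -- solenoidal fields.
  let _ : TopologicalSpace S := TopologicalSpace.induced J inferInstance
  have : SecondCountableTopology S := TopologicalSpace.secondCountableTopology_induced _ _ J
  have : Nonempty S := ⟨⟨fun _ _ => 0, fun i => IsSmooth.const 0, fun x => by simp [pd_const]⟩⟩
  refine ⟨fun n => (TopologicalSpace.denseSeq S n).1,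
    fun n => (TopologicalSpace.denseSeq S n).2, fun Φ hΦ δ hδ => ?_⟩
  have hJ : Continuous J := continuous_induced_dom
  obtain ⟨n, hn⟩ := (TopologicalSpace.denseRange_denseSeq S).exists_mem_open
    (Metric.isOpen_ball.preimage hJ) (s := J ⁻¹' Metric.ball (J ⟨Φ, hΦ⟩) δ)
    ⟨⟨Φ, hΦ⟩, Metric.mem_ball_self hδ⟩
  rw [mem_preimage, Metric.mem_ball, dist_comm] at hn
  have hx : ∀ x, dist (J ⟨Φ, hΦ⟩ x) (J (TopologicalSpace.denseSeq S n) x) ≤ δ := fun x =>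
    (ContinuousMap.dist_apply_le_dist x).trans hn.le
  refine ⟨n, fun i x => ?_, fun i j x => ?_⟩
  · exact (dist_le_pi_dist (J ⟨Φ, hΦ⟩ x).1 (J (TopologicalSpace.denseSeq S n) x).1 i).trans
      ((le_max_left _ _).trans (hx x))
  · exact (dist_le_pi_dist ((J ⟨Φ, hΦ⟩ x).2 i) ((J (TopologicalSpace.denseSeq S n) x).2 i)
      j).trans ((dist_le_pi_dist (J ⟨Φ, hΦ⟩ x).2 (J (TopologicalSpace.denseSeq S n) x).2 i).trans
      ((le_max_right _ _).trans (hx x)))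

end

section


variable {k : T3 → ℝ} {θ M T : ℝ} {v : ℝ → Fin 3 → T3 → ℝ}

/-! ### Evolution of the mollified helicity -/

/-- A bounded family of Besov fields solving the Euler equations weakly, tested with products of
functions of time and solenoidal fields. -/
structure IsEulerFamily (T θ M : ℝ) (v : ℝ → Fin 3 → T3 → ℝ) : Prop where
  aesm : ∀ i, AEStronglyMeasurable (fun q : ℝ × T3 => v q.1 i q.2)
    ((volume.restrict (Ioo 0 T)).prod volume)
  solenoidal : ∀ᵐ t ∂(volume.restrict (Ioo 0 T)), IsBesovSolenoidal θ M (v t)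
  weak : ∀ Φ, IsSolenoidalTest Φ → ∀ η : ℝ → ℝ, ContDiff ℝ ∞ η → HasCompactSupport η →
    tsupport η ⊆ Ioo 0 T →
      ∫ t in Ioo 0 T, (deriv η t * pairF (v t) Φ + η t * flux (v t) Φ) = 0

theorem IsEulerFamily.integrableOn_pairF (hv : IsEulerFamily T θ M v) (hM : 0 ≤ M)
    {Φ : Fin 3 → T3 → ℝ} (hΦ : ∀ i, IsSmooth (Φ i)) :
    IntegrableOn (fun t => pairF (v t) Φ) (Ioo 0 T) := by
  choose C hC0 hC using fun i => exists_forall_abs_le (hΦ i).continuous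
  have hCi : ∀ i x, |Φ i x - (fun _ _ => 0 : Fin 3 → T3 → ℝ) i x| ≤ ∑ i, C i := fun i x => by
    rw [sub_zero]
    exact (hC i x).trans (Finset.single_le_sum (fun j _ => hC0 j) (Finset.mem_univ i))
  have hm : AEStronglyMeasurable (fun q : ℝ × T3 => ∑ i, v q.1 i q.2 * Φ i q.2)
      ((volume.restrict (Ioo 0 T)).prod volume) :=
    Finset.aestronglyMeasurable_fun_sum _ fun i _ => (hv.aesm i).mul
      (hΦ i).continuous.aestronglyMeasurable.comp_snd
  refine Integrable.of_bound hm.integral_prod_right' (3 * (M * ∑ i, C i)) ?_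
  filter_upwards [hv.solenoidal] with t ht
  have := abs_pairF_sub_le ht.besov hM (fun i => (hΦ i).continuous)
    (fun i => continuous_const) hCi
  simpa [pairF] using this

theorem IsEulerFamily.integrableOn_flux (hv : IsEulerFamily T θ M v) (hM : 0 ≤ M)
    {Φ : Fin 3 → T3 → ℝ} (hΦ : ∀ i, IsSmooth (Φ i)) :
    IntegrableOn (fun t => flux (v t) Φ) (Ioo 0 T) := by
  obtain ⟨C, -, hC⟩ := exists_forall_abs_pd_le hΦ
  have hm : AEStronglyMeasurable
      (fun q : ℝ × T3 => ∑ i, ∑ j, v q.1 i q.2 * v q.1 j q.2 * pd j (Φ i) q.2)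
      ((volume.restrict (Ioo 0 T)).prod volume) :=
    Finset.aestronglyMeasurable_fun_sum _ fun i _ => Finset.aestronglyMeasurable_fun_sum _
      fun j _ => ((hv.aesm i).mul (hv.aesm j)).mul
        ((hΦ i).pd j).continuous.aestronglyMeasurable.comp_snd
  refine Integrable.of_bound hm.integral_prod_right' (9 * (M * (M * C))) ?_
  filter_upwards [hv.solenoidal] with t ht
  exact abs_flux_le ht.besov hM hΦ hC

/-- A set of times of full measure at which the weak formulation holds in integrated form. -/
structure IsGoodSet (T θ M : ℝ) (v : ℝ → Fin 3 → T3 → ℝ) (G : Set ℝ) : Prop where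
  subset : G ⊆ Ioo 0 T
  ae_mem : ∀ᵐ t, t ∈ Ioo 0 T → t ∈ G
  solenoidal : ∀ t ∈ G, IsBesovSolenoidal θ M (v t)
  sub_eq : ∀ Φ, IsSolenoidalTest Φ → ∀ s ∈ G, ∀ t ∈ G,
    pairF (v t) Φ - pairF (v s) Φ = ∫ r in s..t, flux (v r) Φ

theorem abs_intervalIntegral_le {f : ℝ → ℝ} {s t C : ℝ} (h : ∀ᵐ r, r ∈ uIoc s t → |f r| ≤ C) :
    |∫ r in s..t, f r| ≤ C * |t - s| :=
  intervalIntegral.norm_integral_le_of_norm_le_const_ae (f := f) h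

theorem uIoc_subset_Ioo {a b s t : ℝ} (hs : s ∈ Ioo a b) (ht : t ∈ Ioo a b) :
    uIoc s t ⊆ Ioo a b :=
  uIoc_subset_uIcc.trans (ordConnected_Ioo.uIcc_subset hs ht)

/-- For each test field the integrated equation fails on a null set that depends on the field.
Discarding the null sets of a countable `C¹`-dense family is enough, since both sides are continuous
in the `C¹` norm of the field. -/
theorem IsEulerFamily.exists_isGoodSet (hv : IsEulerFamily T θ M v) (hM : 0 ≤ M) (hT : 0 < T) :
    ∃ G, IsGoodSet T θ M v G := by
  obtain ⟨Ψ, hΨ, hdense⟩ := exists_countable_dense_solenoidal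
  have h1 : ∀ n, ∃ m, ∀ᵐ t, t ∈ Ioo 0 T →
      pairF (v t) (Ψ n) = m + ∫ r in 0..t, flux (v r) (Ψ n) := fun n =>
    exists_ae_eq_const_add_integral hT (hv.integrableOn_pairF hM (hΨ n).smooth)
      (hv.integrableOn_flux hM (hΨ n).smooth) (hv.weak (Ψ n) (hΨ n))
  choose m hm using h1
  have hsol := (ae_restrict_iff' measurableSet_Ioo).1 hv.solenoidal
  have hii : ∀ Φ, IsSolenoidalTest Φ → ∀ s ∈ Icc 0 T, ∀ t ∈ Icc 0 T,
      IntervalIntegrable (fun r => flux (v r) Φ) volume s t := by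
    intro Φ hΦ s hs t ht
    have h0 : IntervalIntegrable (fun r => flux (v r) Φ) volume 0 T := by
      rw [intervalIntegrable_iff_integrableOn_Ioo_of_le hT.le]
      exact hv.integrableOn_flux hM hΦ.smooth
    refine h0.mono_set ?_
    rw [uIcc_of_le hT.le]
    exact ordConnected_Icc.uIcc_subset hs ht
  refine ⟨{t | t ∈ Ioo 0 T ∧ IsBesovSolenoidal θ M (v t) ∧
    ∀ n, pairF (v t) (Ψ n) = m n + ∫ r in 0..t, flux (v r) (Ψ n)}, fun t ht => ht.1, ?_,
    fun t ht => ht.2.1, fun Φ hΦ s hs t ht => ?_⟩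
  · filter_upwards [hsol, ae_all_iff.2 hm] with t h1 h2 ht
    exact ⟨ht, h1 ht, fun n => h2 n ht⟩
  have hs' := Ioo_subset_Icc_self hs.1
  have ht' := Ioo_subset_Icc_self ht.1
  have h0T : (0 : ℝ) ∈ Icc 0 T := ⟨le_rfl, hT.le⟩
  have hn : ∀ n, pairF (v t) (Ψ n) - pairF (v s) (Ψ n) = ∫ r in s..t, flux (v r) (Ψ n) := by
    intro n
    rw [ht.2.2 n, hs.2.2 n, ← intervalIntegral.integral_interval_sub_left
      (hii _ (hΨ n) 0 h0T t ht') (hii _ (hΨ n) 0 h0T s hs')]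
    ring
  rw [← sub_eq_zero]
  refine abs_eq_zero.1 (le_antisymm (le_of_forall_pos_le_add fun e he => ?_) (abs_nonneg _))
  -- `L` is the combined Lipschitz constant, in the `C¹` norm, of the two pairings and the
  -- integrated flux; dividing by `L + 1` below covers `L = 0`.
  set L := 3 * M + 3 * M + 9 * (M * M) * |t - s| with hL
  have hL0 : 0 ≤ L := by positivity
  obtain ⟨n, hn1, hn2⟩ := hdense Φ hΦ (e / (L + 1)) (by positivity)
  set δ := e / (L + 1) with hδ
  have b1 := abs_pairF_sub_le ht.2.1.besov hM (fun i => (hΦ.smooth i).continuous)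
    (fun i => ((hΨ n).smooth i).continuous) hn1
  have b2 := abs_pairF_sub_le hs.2.1.besov hM (fun i => (hΦ.smooth i).continuous)
    (fun i => ((hΨ n).smooth i).continuous) hn1
  have b3 : |(∫ r in s..t, flux (v r) Φ) - ∫ r in s..t, flux (v r) (Ψ n)| ≤
      9 * (M * (M * δ)) * |t - s| := by
    rw [← intervalIntegral.integral_sub (hii _ hΦ s hs' t ht') (hii _ (hΨ n) s hs' t ht')]
    refine abs_intervalIntegral_le ?_
    filter_upwards [hsol] with r hr hrI
    exact abs_flux_sub_le (hr (uIoc_subset_Ioo hs.1 ht.1 hrI)).besov hM hΦ.smooth (hΨ n).smooth hn2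
  have hLe : L * δ ≤ e := by
    rw [hδ, mul_div_assoc', div_le_iff₀ (by positivity)]
    nlinarith
  have := hn n
  rw [abs_le] at b1 b2 b3 ⊢
  rw [hL] at hLe
  constructor <;> linarith [b1.1, b1.2, b2.1, b2.2, b3.1, b3.2]

variable {G : Set ℝ}

/-- A nonempty open subset of `(0,T)` has positive measure, so it meets `G`. -/
theorem IsGoodSet.subset_closure (hG : IsGoodSet T θ M v G) : Ioo 0 T ⊆ closure G := by
  intro x hx
  rw [mem_closure_iff]
  intro U hU hxU
  by_contra hne
  rw [not_nonempty_iff_eq_empty] at hne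
  have h0 : volume (U ∩ Ioo 0 T) = 0 := by
    refine measure_mono_null (fun y hy => ?_) (ae_iff.1 hG.ae_mem)
    simp only [mem_ofPred_eq, Classical.not_imp]
    exact ⟨hy.2, fun hyG => (eq_empty_iff_forall_notMem.1 hne y) ⟨hy.1, hyG⟩⟩
  exact ((hU.inter isOpen_Ioo).measure_pos volume ⟨x, hxU, hx⟩).ne' h0

theorem IsGoodSet.ae_mem_of_mem_uIoc (hG : IsGoodSet T θ M v G) {s t : ℝ} (hs : s ∈ G)
    (ht : t ∈ G) : ∀ᵐ r, r ∈ uIoc s t → r ∈ G := by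
  filter_upwards [hG.ae_mem] with r hr hrI
  exact hr (uIoc_subset_Ioo (hG.subset hs) (hG.subset ht) hrI)

theorem IsGoodSet.abs_pairF_sub_le (hG : IsGoodSet T θ M v G) (hM : 0 ≤ M)
    {Φ : Fin 3 → T3 → ℝ} (hΦ : IsSolenoidalTest Φ) {δ : ℝ} (hδ : ∀ i j x, |pd j (Φ i) x| ≤ δ)
    {s t : ℝ} (hs : s ∈ G) (ht : t ∈ G) :
    |pairF (v t) Φ - pairF (v s) Φ| ≤ 9 * (M * (M * δ)) * |t - s| := by
  rw [hG.sub_eq Φ hΦ s hs t ht]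
  refine abs_intervalIntegral_le ?_
  filter_upwards [hG.ae_mem_of_mem_uIoc hs ht] with r hr hrI
  exact abs_flux_le (hG.solenoidal r (hr hrI)).besov hM hΦ.smooth hδ

/-! ### Dependence of the mollified test fields on time -/

theorem isSmooth_single {κ : T3 → ℝ} (hκ : IsSmooth κ) (i j : Fin 3) :
    IsSmooth ((Pi.single i κ : Fin 3 → T3 → ℝ) j) := by
  rcases eq_or_ne j i with rfl | h
  · simpa using hκ
  · rw [Pi.single_eq_of_ne h]
    exact IsSmooth.const 0

/-- A point value of a mollified curl is a pairing with the solenoidal field `curl (κ(x - ·) eᵢ)`,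
so its variation in time is controlled by the equation. -/
theorem curlF_cv_eq_pairF {w : Fin 3 → T3 → ℝ} (hw : ∀ i, Integrable (w i)) {κ : T3 → ℝ}
    (hκ : IsSmooth κ) (i : Fin 3) (x : T3) :
    curlF (fun l => cv κ (w l)) i x =
      pairF w (curlF (Pi.single i fun y => κ (x - y))) := by
  have hs := isSmooth_single (hκ.comp_sub_left x) i
  have h0 : ∀ l a, distPartial a (w l) (0 : T3 → ℝ) = 0 := fun l a => by
    have : pd a (0 : T3 → ℝ) = fun _ => 0 := pd_const 0 a
    simp [distPartial, this]
  have h1 : ∀ l a, distPartial a (w l) (fun y => κ (x - y)) = pd a (cv κ (w l)) x := fun l a => by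
    rw [pd_cv hκ (hw l), distPartial, cv, ← integral_neg]
    congr 1
    ext y
    rw [pd_comp_sub_left hκ]
    ring
  rw [pairF, ← curlPair_eq_integral hw hs]
  fin_cases i <;> simp [curlPair, curlF, h0, h1]

theorem pd_curlF_cv {w : Fin 3 → T3 → ℝ} (hw : ∀ i, Integrable (w i)) (hk : IsSmooth k)
    (i j : Fin 3) (x : T3) :
    pd j (curlF (fun l => cv k (w l)) i) x = curlF (fun l => cv (pd j k) (w l)) i x := by
  have ha : ∀ l, IsSmooth (cv k (w l)) := fun l => hk.cv (hw l)
  have e : ∀ a l, pd j (pd a (cv k (w l))) x = pd a (cv (pd j k) (w l)) x := fun a l => by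
    rw [pd_comm (ha l)]
    congr 1
    exact funext (pd_cv hk (hw l) j)
  obtain ⟨h0, h1, h2⟩ := pd_curlF ha j x
  fin_cases i
  · exact h0.trans (by rw [e, e]; rfl)
  · exact h1.trans (by rw [e, e]; rfl)
  · exact h2.trans (by rw [e, e]; rfl)

theorem exists_forall_abs_pd_curlF_single_le {κ : T3 → ℝ} (hκ : IsSmooth κ) :
    ∃ C, 0 ≤ C ∧ ∀ x l i j y,
      |pd j (curlF (Pi.single l fun y => κ (x - y)) i) y| ≤ C := by
  choose C hC0 hC using fun a b => exists_forall_abs_le ((hκ.pd a).pd b).continuous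
  set D := ∑ a, ∑ b, C a b with hD
  have hD0 : 0 ≤ D := Finset.sum_nonneg fun a _ => Finset.sum_nonneg fun b _ => hC0 a b
  have hCD : ∀ a b, C a b ≤ D := fun a b =>
    (Finset.single_le_sum (f := fun b => C a b) (fun b _ => hC0 a b) (Finset.mem_univ b)).trans
      (Finset.single_le_sum (f := fun a => ∑ b, C a b)
        (fun a _ => Finset.sum_nonneg fun b _ => hC0 a b) (Finset.mem_univ a))
  refine ⟨2 * D, by positivity, fun x l i j y => ?_⟩
  have hs := isSmooth_single (hκ.comp_sub_left x) l
  have hp : ∀ a m, |pd j (pd a ((Pi.single l fun y => κ (x - y) : Fin 3 → T3 → ℝ) m)) y| ≤ D := by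
    intro a m
    rcases eq_or_ne m l with rfl | h
    · rw [Pi.single_eq_same]
      have e : pd a (fun y => κ (x - y)) = fun y => -pd a κ (x - y) :=
        funext (pd_comp_sub_left hκ a x)
      rw [e, pd_neg ((hκ.pd a).comp_sub_left x), pd_comp_sub_left (hκ.pd a), neg_neg]
      exact (hC a j _).trans (hCD a j)
    · rw [Pi.single_eq_of_ne h]
      have e : pd a (0 : T3 → ℝ) = fun _ => 0 := pd_const 0 a
      rw [e, pd_const]
      simpa using hD0
  have hab : ∀ p q : ℝ, |p| ≤ D → |q| ≤ D → |p - q| ≤ 2 * D := fun p q h1 h2 =>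
    (abs_sub _ _).trans (by linarith)
  obtain ⟨h0, h1, h2⟩ := pd_curlF hs j y
  fin_cases i
  · exact h0 ▸ hab _ _ (hp _ _) (hp _ _)
  · exact h1 ▸ hab _ _ (hp _ _) (hp _ _)
  · exact h2 ▸ hab _ _ (hp _ _) (hp _ _)

theorem IsMollifier.abs_cv_sub_le {C ε δ : ℝ} (hk : IsMollifier C ε k) {f g : T3 → ℝ}
    (hf : Continuous f) (hg : Continuous g) (h : ∀ x, |f x - g x| ≤ δ) (x : T3) :
    |cv k f x - cv k g x| ≤ δ := by
  have hkc := hk.smooth.continuous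
  rw [← cv_sub hkc (integrable_of_continuous hf) (integrable_of_continuous hg),
    cv_eq_integral_comp_sub]
  refine (abs_integral_le_of_abs_le (g := fun z => k z * δ)
    ((integrable_of_continuous hkc).mul_const δ) fun z => ?_).trans_eq ?_
  · rw [abs_mul, abs_of_nonneg (hk.nonneg z)]
    exact mul_le_mul_of_nonneg_left (h _) (hk.nonneg z)
  · rw [integral_mul_const, hk.integral_eq_one, one_mul]

/-- `∂ⱼ curl (k ∗ v)` equals `curl (∂ⱼk ∗ v)`, whose point values are pairings of `v` with fixed
solenoidal fields, Lipschitz in time; the outer convolution preserves sup bounds. How `L` depends on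
`ε` is irrelevant, as it enters only a quadratic error that is removed. -/
theorem IsGoodSet.exists_abs_pd_testF_sub_le {C ε : ℝ} (hG : IsGoodSet T θ M v G) (hM : 0 ≤ M)
    (hk : IsMollifier C ε k) : ∃ L, 0 ≤ L ∧ ∀ s ∈ G, ∀ t ∈ G, ∀ i j x,
      |pd j (testF k (v t) i) x - pd j (testF k (v s) i) x| ≤ L * |t - s| := by
  choose D hD0 hD using fun j => exists_forall_abs_pd_curlF_single_le (hk.smooth.pd j)
  have hDj : ∀ j, D j ≤ ∑ j, D j := fun j =>
    Finset.single_le_sum (fun j _ => hD0 j) (Finset.mem_univ j)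
  have hs0 : 0 ≤ ∑ j, D j := Finset.sum_nonneg fun j _ => hD0 j
  refine ⟨9 * (M * (M * ∑ j, D j)), by positivity, fun s hs t ht i j x => ?_⟩
  have hi : ∀ r ∈ G, ∀ l, Integrable (v r l) := fun r hr l =>
    ((hG.solenoidal r hr).besov l).integrable
  have hc : ∀ r ∈ G, IsSmooth (curlF (fun l => cv k (v r l)) i) := fun r hr =>
    isSmooth_curlF (fun l => hk.smooth.cv (hi r hr l)) i
  rw [show testF k (v t) i = cv k (curlF (fun l => cv k (v t l)) i) from rfl,
    show testF k (v s) i = cv k (curlF (fun l => cv k (v s l)) i) from rfl,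
    pd_cv_right hk.smooth (hc t ht), pd_cv_right hk.smooth (hc s hs)]
  refine hk.abs_cv_sub_le ((hc t ht).pd j).continuous ((hc s hs).pd j).continuous (fun y => ?_) x
  rw [pd_curlF_cv (hi t ht) hk.smooth, pd_curlF_cv (hi s hs) hk.smooth,
    curlF_cv_eq_pairF (hi t ht) (hk.smooth.pd j), curlF_cv_eq_pairF (hi s hs) (hk.smooth.pd j)]
  exact hG.abs_pairF_sub_le hM
    (isSolenoidalTest_curlF (isSmooth_single ((hk.smooth.pd j).comp_sub_left y) i))
    (fun a b z => (hD j y i a b z).trans (hDj j)) hs ht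

/-- With `B(t, s) = pairF (v t) (testF k (v s))`, symmetric in its arguments, `B(t,t) - B(s,s) =
[B(t,t) - B(s,t)] + [B(t,s) - B(s,s)]`. In each bracket the test field is frozen, so the integrated
equation applies. -/
theorem IsGoodSet.abs_pairF_testF_sub_le {C ε : ℝ} (hG : IsGoodSet T θ M v G) (hM : 0 ≤ M)
    (hC : 0 ≤ C) (hθ : 0 ≤ θ) (hε : 0 < ε) (hk : IsMollifier C ε k) {s t : ℝ} (hs : s ∈ G)
    (ht : t ∈ G) :
    |pairF (v t) (testF k (v t)) - pairF (v s) (testF k (v s))| ≤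
      2 * (36 * (C * M ^ 3 * ε ^ (3 * θ - 2))) * |t - s| := by
  set A := 36 * (C * M ^ 3 * ε ^ (3 * θ - 2)) with hA
  obtain ⟨L, hL0, hL⟩ := hG.exists_abs_pd_testF_sub_le hM hk
  have hi : ∀ r ∈ G, ∀ l, Integrable (v r l) := fun r hr l =>
    ((hG.solenoidal r hr).besov l).integrable
  have hT : ∀ r ∈ G, IsSolenoidalTest (testF k (v r)) := fun r hr =>
    isSolenoidalTest_testF hk.smooth (hi r hr)
  refine abs_sub_le_of_quadratic (f := fun t => pairF (v t) (testF k (v t))) (I := Ioo 0 T)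
    (L := 18 * (M * (M * L))) (convex_Ioo 0 T) hG.subset hG.subset_closure ?_ s hs t ht
  intro s hs t ht
  -- Replacing the field frozen at time `q` by the one at time `r` brings in the commutator bound;
  -- the cost is linear in `|t - s|`, and quadratic once integrated.
  have hD : ∀ r ∈ uIoc s t, r ∈ G → ∀ q ∈ G, |r - q| ≤ |t - s| →
      |flux (v r) (testF k (v q))| ≤ A + 9 * (M * (M * (L * |t - s|))) := by
    intro r _ hr q hq hrq
    have h1 := hk.abs_flux_testF_le hε (hG.solenoidal r hr) hθ hM hC
    have h2 := abs_flux_sub_le (hG.solenoidal r hr).besov hM (hT q hq).smooth (hT r hr).smooth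
      (δ := L * |t - s|) fun i j x => (hL r hr q hq i j x).trans
        (mul_le_mul_of_nonneg_left (by rwa [abs_sub_comm]) hL0)
    rw [← hA] at h1
    have h3 := abs_sub_abs_le_abs_sub (flux (v r) (testF k (v q))) (flux (v r) (testF k (v r)))
    linarith
  have hI : ∀ q ∈ G, (∀ r ∈ uIoc s t, |r - q| ≤ |t - s|) →
      |∫ r in s..t, flux (v r) (testF k (v q))| ≤
        (A + 9 * (M * (M * (L * |t - s|)))) * |t - s| := by
    intro q hq hrq
    refine abs_intervalIntegral_le ?_
    filter_upwards [hG.ae_mem_of_mem_uIoc hs ht] with r hr hrI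
    exact hD r hrI (hr hrI) q hq (hrq r hrI)
  have e1 := hG.sub_eq _ (hT t ht) s hs t ht
  have e2 := hG.sub_eq _ (hT s hs) s hs t ht
  have e3 := pairF_testF_comm hk.smooth hk.even (hi t ht) (hi s hs)
  have hbt := hI t ht fun r hr => by
    rw [abs_sub_comm]
    exact abs_sub_right_of_mem_uIcc (uIoc_subset_uIcc hr)
  have hbs := hI s hs fun r hr => abs_sub_left_of_mem_uIcc (uIoc_subset_uIcc hr)
  have e4 : pairF (v t) (testF k (v t)) - pairF (v s) (testF k (v s)) =
      (∫ r in s..t, flux (v r) (testF k (v t))) + ∫ r in s..t, flux (v r) (testF k (v s)) := by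
    rw [← e1, ← e2, e3]
    ring
  rw [e4]
  refine (abs_add_le _ _).trans ((add_le_add hbt hbs).trans_eq ?_)
  ring

end

section


variable {θ M T : ℝ} {u : ℝ → T3 → E3} {p : ℝ → T3 → ℝ}

/-! ### Weak Euler solutions -/

theorem isBesov_apply {C : ℝ} {w : T3 → E3} (hw : AEStronglyMeasurable w)
    (hC : besovNorm θ 3 w ≤ ENNReal.ofReal C) (i : Fin 3) :
    IsBesov θ (max C 0) fun x => w x i := by
  have hM : ENNReal.ofReal C = ENNReal.ofReal (max C 0) := by
    rcases le_total 0 C with h | h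
    · rw [max_eq_left h]
    · rw [max_eq_right h, ENNReal.ofReal_of_nonpos h, ENNReal.ofReal_zero]
  have hc : ∀ {f : T3 → E3}, eLpNorm (fun x => f x i) 3 volume ≤ eLpNorm f 3 volume := fun {f} =>
    eLpNorm_mono fun x => PiLp.norm_apply_le (f x) i
  rw [hM] at hC
  refine ⟨(EuclideanSpace.proj (𝕜 := ℝ) i).continuous.comp_aestronglyMeasurable hw,
    hc.trans (le_self_add.trans hC), fun z => ?_⟩
  -- The Besov norm controls every shift in `ℝ³`; the shortest representative turns `‖h‖` into the
  -- torus distance.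
  obtain ⟨h, hz, hn⟩ := exists_proj_norm_eq (-z)
  rw [torusAbs_neg] at hn
  have e : (fun x => w (x - z) i - w x i) = fun x => (w (x + proj h) - w x) i := by
    ext x
    rw [hz, ← sub_eq_add_neg]
    rfl
  rw [e]
  refine (hc (f := fun x => w (x + proj h) - w x)).trans ?_
  by_cases h0 : h = 0
  · simp [h0, proj_zero]
  have hpos : 0 < ‖h‖ ^ θ := Real.rpow_pos_of_pos (norm_pos_iff.2 h0) _
  have h1 : eLpNorm (fun x => w (x + proj h) - w x) 3 volume / ENNReal.ofReal (‖h‖ ^ θ) ≤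
      ENNReal.ofReal (max C 0) :=
    (le_iSup₂ (f := fun (h : E3) (_ : h ≠ 0) =>
      eLpNorm (fun x => w (x + proj h) - w x) 3 volume / ENNReal.ofReal (‖h‖ ^ θ)) h h0).trans
      (le_add_self.trans hC)
  rw [ENNReal.div_le_iff (by simpa using hpos) ENNReal.ofReal_ne_top, hn,
    ← ENNReal.ofReal_mul (le_max_right _ _)] at h1
  exact h1

theorem isTestField_mul {η : ℝ → ℝ} (hη : ContDiff ℝ ∞ η) (hηc : HasCompactSupport η)
    (hηs : tsupport η ⊆ Ioo 0 T) {Φ : Fin 3 → T3 → ℝ} (hΦ : ∀ i, IsSmooth (Φ i)) :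
    IsTestField T fun t x => (WithLp.toLp 2 fun i => η t * Φ i x : E3) := by
  have h0 : ∀ q : ℝ × T3, q ∉ tsupport η ×ˢ univ →
      Function.uncurry (fun t x => (WithLp.toLp 2 fun i => η t * Φ i x : E3)) q = 0 := by
    intro q hq
    have : η q.1 = 0 := image_eq_zero_of_notMem_tsupport fun h => hq ⟨h, mem_univ _⟩
    ext i
    simp [Function.uncurry, this]
  refine ⟨contDiff_euclidean.2 fun i => ?_,
    HasCompactSupport.intro (hηc.isCompact.prod isCompact_univ) h0, ?_⟩
  · exact (hη.comp contDiff_fst).mul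
      (ContDiff.comp (g := fun y => Φ i (proj y)) (hΦ i) contDiff_snd)
  · refine (closure_minimal (fun q hq => ?_) ((isClosed_tsupport η).prod isClosed_univ)).trans
      (prod_mono_left hηs)
    by_contra hc
    exact hq (h0 q hc)

theorem exists_isEulerFamily (hu : MemLinftyBesov T θ 3 u) (hE : IsWeakEulerSolution T u p) :
    ∃ M, 0 ≤ M ∧ IsEulerFamily T θ M fun t i x => u t x i := by
  obtain ⟨C, hC⟩ := hu.bound
  have hm : AEStronglyMeasurable (Function.uncurry u)
      ((volume.restrict (Ioo 0 T)).prod volume) := by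
    have := hu.measurable
    rwa [Measure.volume_eq_prod, ← Measure.prod_restrict, Measure.restrict_univ] at this
  have hsol : ∀ᵐ t ∂(volume.restrict (Ioo 0 T)),
      IsBesovSolenoidal θ (max C 0) fun i x => u t x i := by
    filter_upwards [hC, hm.prodMk_left, hE.divergence_free] with t h1 h2 h3
    exact ⟨isBesov_apply h2 h1, h3⟩
  refine ⟨max C 0, le_max_right _ _,
    fun i => (EuclideanSpace.proj (𝕜 := ℝ) i).continuous.comp_aestronglyMeasurable hm, hsol, ?_⟩
  intro Φ hΦ η hη hηc hηs
  refine Eq.trans (integral_congr_ae ?_) (hE.momentum _ (isTestField_mul hη hηc hηs hΦ.smooth))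
  filter_upwards [hsol] with t ht
  have i1 : Integrable fun x => ∑ i, u t x i * Φ i x := integrable_finsetSum _ fun i _ => by
    simp_rw [mul_comm (u t _ i)]
    exact integrable_continuous_mul (hΦ.smooth i).continuous (ht.besov i).integrable
  have i2 : Integrable fun x => ∑ i, ∑ j, u t x i * u t x j * pd j (Φ i) x :=
    integrable_finsetSum _ fun i _ => integrable_finsetSum _ fun j _ =>
      integrable_mul_mul (ht.besov i).memLp_two (ht.besov j).memLp_two
        ((hΦ.smooth i).pd j).continuous
  rw [pairF, flux, ← integral_const_mul, ← integral_const_mul,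
    ← integral_add (i1.const_mul _) (i2.const_mul _)]
  congr 1
  ext x
  have e1 : ∀ i, deriv (fun s => η s * Φ i x) t = deriv η t * Φ i x := fun i =>
    deriv_mul_const (hη.differentiable (by simp) t) _
  -- The pressure term vanishes pointwise because `Φ` is divergence free.
  simp only [e1, pd_const_mul (hΦ.smooth _), ← Finset.mul_sum, hΦ.div_eq_zero, mul_zero, add_zero]
  congr 1
  · rw [Finset.mul_sum]
    exact Finset.sum_congr rfl fun i _ => by ring
  · simp only [Finset.mul_sum]
    exact Finset.sum_congr rfl fun i _ => Finset.sum_congr rfl fun j _ => by ring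

/-- The helicity is Hölder continuous on the good set of times. -/
theorem IsGoodSet.exists_holder {G : Set ℝ} (hG : IsGoodSet T θ M (fun t i x => u t x i) G)
    (hT : 0 < T) (hM : 0 ≤ M) (hθ : 1 / 2 < θ) (hθ1 : θ < 1) :
    ∃ K, 0 ≤ K ∧ ∀ s ∈ G, ∀ t ∈ G,
      |helicity (u t) - helicity (u s)| ≤ K * |t - s| ^ ((2 * θ - 1) / (1 - θ)) := by
  set α := (2 * θ - 1) / (1 - θ) with hα
  have hC := mollConst_nonneg
  have hg := geomConst_nonneg (γ := 2 * θ - 1) (by linarith)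
  have h1θ : 0 < 1 - θ := by linarith
  set A := 6 * (geomConst (2 * θ - 1) * ((1 + mollConst) * M) ^ 2) with hA
  set B := 2 * (36 * (mollConst * M ^ 3)) with hB
  have hA0 : 0 ≤ A := by positivity
  have hB0 : 0 ≤ B := by positivity
  refine ⟨(2 * A + B * T) / T ^ α, by positivity, fun s hs t ht => ?_⟩
  rcases eq_or_ne s t with rfl | hst
  · rw [sub_self, abs_zero]
    positivity
  -- Dividing by `T` gives `d ≤ 1`, so the scale chosen next lies in the admissible range `(0, 1]`.
  set d := |t - s| / T with hd
  have hts : 0 < |t - s| := abs_pos.2 (sub_ne_zero.2 hst.symm)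
  have hd0 : 0 < d := by positivity
  have hd1 : d ≤ 1 := by
    rw [hd, div_le_one hT, abs_le]
    constructor <;> linarith [(hG.subset hs).1, (hG.subset hs).2, (hG.subset ht).1,
      (hG.subset ht).2]
  -- This scale equates `ε^(2θ-1)` with `ε^(3θ-2) d`, since the exponents differ by `1 - θ`; both
  -- are then `d^α`.
  set ε := d ^ (1 / (1 - θ)) with hε
  have hε0 : 0 < ε := Real.rpow_pos_of_pos hd0 _
  have hε1 : ε ≤ 1 := Real.rpow_le_one hd0.le hd1 (by positivity)
  have p1 : ε ^ (2 * θ - 1) = d ^ α := by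
    rw [hε, ← Real.rpow_mul hd0.le, hα]
    congr 1
    ring
  have p2 : ε ^ (3 * θ - 2) * |t - s| = T * d ^ α := by
    have : |t - s| = T * d ^ (1 : ℝ) := by
      rw [Real.rpow_one, hd]
      field_simp
    rw [this, hε, ← Real.rpow_mul hd0.le, mul_left_comm, ← Real.rpow_add hd0, hα]
    congr 2
    field_simp
    ring
  have p3 : d ^ α = |t - s| ^ α / T ^ α := Real.div_rpow hts.le hT.le _
  have hk := isMollifier_moll hε0 hε1
  have hpair : ∀ r ∈ G, |helicity (u r) - pairF (fun i x => u r x i)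
      (testF (moll ε) fun i x => u r x i)| ≤ A * d ^ α := by
    intro r hr
    have hb := (hG.solenoidal r hr).besov
    have h := (helicity_spec hθ hθ1.le hM hb).2 ε hε0 hε1
    have e := curlPair_cv_eq_pairF hk.smooth hk.even (fun i => (hb i).integrable)
      fun i => (hb i).integrable
    rw [← e]
    refine h.trans_eq ?_
    rw [p1, hA]
    ring
  have hmid := hG.abs_pairF_testF_sub_le hM hC (by linarith) hε0 hk hs ht
  have hmid' : 2 * (36 * (mollConst * M ^ 3 * ε ^ (3 * θ - 2))) * |t - s| = B * (T * d ^ α) := by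
    rw [← p2, hB]
    ring
  rw [hmid'] at hmid
  have h1 := abs_le.1 (hpair s hs)
  have h2 := abs_le.1 (hpair t ht)
  have h3 := abs_le.1 hmid
  have e : (2 * A + B * T) / T ^ α * |t - s| ^ α = 2 * (A * d ^ α) + B * (T * d ^ α) := by
    rw [p3]
    ring
  rw [e, abs_le]
  constructor <;> linarith [h1.1, h1.2, h2.1, h2.2, h3.1, h3.2]

/-! ### The distributional derivative -/

theorem helicityDeriv_apply (hH : LocallyIntegrableOn (fun t => helicity (u t)) (Ioo 0 T))
    (η : 𝓓(timeInterval T, ℝ)) :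
    helicityDeriv T u η = -∫ t, deriv η t * helicity (u t) := by
  rw [helicityDeriv, Distribution.lineDerivOp_apply_apply, map_neg, regularDistribution,
    ContinuousLinearMap.toUniformConvergenceCLM_apply,
    TestFunction.integralAgainstBilinCLM_eq_integral hH]
  rfl

theorem continuous_of_holder {g : ℝ → ℝ} {K α : ℝ} (hα : 0 < α)
    (hg : ∀ s t, |g t - g s| ≤ K * |t - s| ^ α) : Continuous g := by
  refine continuous_iff_continuousAt.2 fun t => tendsto_iff_dist_tendsto_zero.2 ?_
  have hlim : Tendsto (fun s => K * |s - t| ^ α) (𝓝 t) (𝓝 (K * |t - t| ^ α)) :=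
    ((((continuous_id.sub continuous_const).abs).rpow_const
      fun _ => Or.inr hα.le).const_mul K).continuousAt
  rw [sub_self, abs_zero, Real.zero_rpow hα.ne', mul_zero] at hlim
  exact squeeze_zero (fun _ => dist_nonneg) (fun s => hg t s) hlim

/-- If the support had dimension below `α`, the Hölder representative `g` would be constant on
`(0,T)`, and `H'` would vanish. -/
theorem le_dimH_spt {g : ℝ → ℝ} {K α : ℝ} (hT : 0 < T) (hK : 0 ≤ K) (hα : 0 < α)
    (hg : ∀ s t, |g t - g s| ≤ K * |t - s| ^ α)
    (hgH : ∀ᵐ t, t ∈ Ioo 0 T → g t = helicity (u t))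
    (hH : LocallyIntegrableOn (fun t => helicity (u t)) (Ioo 0 T))
    (hne : helicityDeriv T u ≠ 0) :
    ENNReal.ofReal α ≤ dimH (spt (helicityDeriv T u)) := by
  by_contra hlt
  rw [not_le] at hlt
  have hgc := continuous_of_holder hα hg
  have happ : ∀ η : ℝ → ℝ, tsupport η ⊆ Ioo 0 T →
      ∫ t, deriv η t * helicity (u t) = ∫ t, deriv η t * g t := by
    intro η hη
    refine integral_congr_ae ?_
    filter_upwards [hgH] with t ht
    by_cases htI : t ∈ Ioo 0 T
    · rw [ht htI]
    · rw [image_eq_zero_of_notMem_tsupport fun h => htI (hη (tsupport_deriv_subset h)), zero_mul,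
        zero_mul]
  have hloc : ∀ x ∈ Ioo 0 T, x ∉ spt (helicityDeriv T u) → ∃ U ∈ 𝓝 x, ∃ m, ∀ y ∈ U, g y = m := by
    intro x hx hxs
    have hxd : x ∉ Distribution.dsupport (helicityDeriv T u) := fun h => hxs ⟨hx, h⟩
    obtain ⟨s, hs, hso, hxs⟩ := (Distribution.notMem_dsupport_iff x).1 hxd
    obtain ⟨a, b, hxab, hab⟩ := mem_nhds_iff_exists_Ioo_subset.1
      ((hso.inter isOpen_Ioo).mem_nhds ⟨hxs, hx⟩)
    obtain ⟨m, hm⟩ := exists_ae_eq_const (c := g) (hxab.1.trans hxab.2)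
      (hgc.locallyIntegrable.locallyIntegrableOn _) (fun η hη hηc hηs => by
        have hηT : tsupport η ⊆ Ioo 0 T := hηs.trans (hab.trans inter_subset_right)
        have h := hs (⟨η, hη, hηc, hηT⟩ : 𝓓(timeInterval T, ℝ))
          (hηs.trans (hab.trans inter_subset_left))
        rw [helicityDeriv_apply hH, neg_eq_zero] at h
        exact (happ η hηT).symm.trans h)
    refine ⟨Ioo a b, Ioo_mem_nhds hxab.1 hxab.2, m, ?_⟩
    -- The du Bois-Reymond lemma gives constancy almost everywhere near `x`; continuity of `g`
    -- upgrades it to every point.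
    exact Measure.eqOn_open_of_ae_eq (μ := volume) (g := fun _ => m)
      ((ae_restrict_iff' measurableSet_Ioo).2 hm) isOpen_Ioo hgc.continuousOn continuousOn_const
  have hconst : ∀ t ∈ Ioo 0 T, g t = g (T / 2) := fun t ht =>
    eq_of_dimH_lt hK hα hg hloc hlt ht ⟨by linarith, by linarith⟩
  refine hne (DFunLike.ext _ _ fun η => ?_)
  have hηT : tsupport η ⊆ Ioo 0 T := η.tsupport_subset
  have e : ∫ t, deriv η t * g t = ∫ t, deriv η t * g (T / 2) := by
    congr 1
    ext t
    by_cases htI : t ∈ Ioo 0 T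
    · rw [hconst t htI]
    · rw [image_eq_zero_of_notMem_tsupport fun h => htI (hηT (tsupport_deriv_subset h)), zero_mul,
        zero_mul]
  have hd : ∀ t, HasDerivAt η (deriv η t) t := fun t =>
    (η.contDiff.differentiable (by simp) t).hasDerivAt
  rw [helicityDeriv_apply hH, happ η hηT, e, integral_mul_const,
    integral_eq_zero_of_hasDerivAt_of_integrable hd
      ((η.contDiff.continuous_deriv (by simp)).integrable_of_hasCompactSupport
        η.hasCompactSupport.deriv)
      (η.continuous.integrable_of_hasCompactSupport η.hasCompactSupport)]
  simp

end

end EulerHelicity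

end

/-! ### Conclusion -/

theorem mainTheorem4 (T θ : ℝ) (hT : 0 < T) (hθ : θ ∈ Set.Ioc (1 / 2 : ℝ) (2 / 3))
    (u : ℝ → EulerHelicity.T3 → EulerHelicity.E3) (p : ℝ → EulerHelicity.T3 → ℝ)
    (hu : EulerHelicity.MemLinftyBesov T θ 3 u)
    (hE : EulerHelicity.IsWeakEulerSolution T u p) :
    (∀ᵐ t ∂(MeasureTheory.volume.restrict (Set.Ioo 0 T)),
      EulerHelicity.HasHelicity (u t) (EulerHelicity.helicity (u t))) ∧
    MeasureTheory.LocallyIntegrableOn (fun t => EulerHelicity.helicity (u t)) (Set.Ioo 0 T) ∧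
    (EulerHelicity.helicityDeriv T u ≠ 0 →
      ENNReal.ofReal ((2 * θ - 1) / (1 - θ)) ≤
        dimH (EulerHelicity.spt (EulerHelicity.helicityDeriv T u))) := by
  obtain ⟨hθ0, hθ1⟩ := hθ
  have h1θ : 0 < 1 - θ := by linarith
  have hα : 0 < (2 * θ - 1) / (1 - θ) := div_pos (by linarith) h1θ
  -- This is where `θ ≤ 2/3` enters; the Hölder extension needs an exponent at most one.
  have hα1 : (2 * θ - 1) / (1 - θ) ≤ 1 := by
    rw [div_le_one h1θ]
    linarith
  obtain ⟨M, hM, hv⟩ := EulerHelicity.exists_isEulerFamily hu hE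
  obtain ⟨G, hG⟩ := hv.exists_isGoodSet hM hT
  obtain ⟨K, hK, hH⟩ := hG.exists_holder hT hM hθ0 (by linarith)
  have hGne : G.Nonempty :=
    closure_nonempty_iff.1 ⟨T / 2, hG.subset_closure ⟨by linarith, by linarith⟩⟩
  obtain ⟨g, hg, hgG⟩ := EulerHelicity.exists_holder_extension
    (f := fun t => EulerHelicity.helicity (u t)) hK hα hα1 hGne hH
  have hgH : ∀ᵐ t, t ∈ Ioo 0 T → g t = EulerHelicity.helicity (u t) := by
    filter_upwards [hG.ae_mem] with t ht htI using hgG t (ht htI)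
  have hgc := EulerHelicity.continuous_of_holder hα hg
  have hint : LocallyIntegrableOn (fun t => EulerHelicity.helicity (u t)) (Ioo 0 T) := by
    -- Measurability and integrability of the helicity are inherited from its continuous
    -- representative `g`.
    have h1 : IntegrableOn g (Ioo 0 T) :=
      (hgc.integrableOn_Icc (a := 0) (b := T)).mono_set Ioo_subset_Icc_self
    exact (h1.congr_fun_ae ((ae_restrict_iff' measurableSet_Ioo).2 hgH)).locallyIntegrableOn
  refine ⟨?_, hint, EulerHelicity.le_dimH_spt hT hK hα hg hgH hint⟩
  refine (ae_restrict_iff' measurableSet_Ioo).2 ?_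
  filter_upwards [hG.ae_mem] with t ht htI
  exact (EulerHelicity.helicity_spec hθ0 (by linarith) hM (hG.solenoidal t (ht htI)).besov).1
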